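/- Let $K$ be a field and $r\ge 0$ an integer. A multi-graded ring of finite type is a commutative, finitely generated $K$-algebra $R=\bigoplus_{d\in\mathbb N^r}R_d$, graded by $K$-subspaces, with $R_0$ finite dimensional over $K$. For a finitely generated $\mathbb Z^r$-graded $R$-module $M=\bigoplus_{d\in\mathbb Z^r}M_d$ and a multi-graded submodule $P\subseteq M$, let $H(P,t)=\sum_{d\in\mathbb Z^r}\dim_K(P\cap M_d)\,t^d$ be its Hilbert series in $t=(t_1,\dots,t_r)$. The universal denominator $\operatorname{udenom}_R(M,t)\in\mathbb Q[t_1,\dots,t_r]$ is the unique polynomial $B(t)$ that is smallest with respect to divisibility among the polynomials such that $B(0)=1$ and $B(t)H(P,t)$ is a Laurent polynomial for every multi-graded $R$-submodule $P\subseteq M$. Let $R$ and $S$ be multi-graded rings of finite type over $K$ (both graded by $\mathbb N^r$), let $M$ be a nonzero finitely generated $\mathbb Z^r$-graded $R$-module and $N$ a nonzero finitely generated $\mathbb Z^r$-graded $S$-module. Consider $M\otimes_K N$ as a module over $R\otimes_K S$ via $(a\otimes b)(m\otimes n)=am\otimes bn$, with the grading $(M\otimes_K N)_d=\bigoplus_{e\in\mathbb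 Z^r}M_e\otimes_K N_{d-e}$. Then the universal denominators of $M$ over $R$, of $N$ over $S$ and of $M\otimes_K N$ over $R\otimes_K S$ exist, and $$\operatorname{udenom}_{R\otimes_K S}(M\otimes_K N,t)=\operatorname{udenom}_R(M,t)\cdot\operatorname{udenom}_S(N,t).$$ -/

import Mathlib

open scoped TensorProduct DirectSum

noncomputable section

namespace UDenom

/-! ### Multi-graded modules -/

/-- The inclusion `ℕ^r → ℤ^r` of multidegrees. -/
def natToInt {r : ℕ} (d : Fin r → ℕ) : Fin r → ℤ := fun i => (d i : ℤ)

/-- `𝓜` makes `M` a `ℤ^r`-graded module over the `ℕ^r`-graded `K`-algebra `(R, 𝓡)`: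
`M = ⨁ M_d` and `R_d M_e ⊆ M_{d+e}`. -/
structure IsGradedModule {K R M : Type*} [Field K] [CommRing R] [Algebra K R]
    [AddCommGroup M] [Module K M] [Module R M] {r : ℕ}
    (𝓡 : (Fin r → ℕ) → Submodule K R) (𝓜 : (Fin r → ℤ) → Submodule K M) : Prop where
  isInternal : DirectSum.IsInternal 𝓜
  smul_mem : ∀ (d : Fin r → ℕ) (e : Fin r → ℤ) (a : R) (m : M),
    a ∈ 𝓡 d → m ∈ 𝓜 e → a • m ∈ 𝓜 (natToInt d + e)

section Series

variable {K R M : Type*} [Field K] [CommRing R] [Algebra K R]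
  [AddCommGroup M] [Module K M] [Module R M] [IsScalarTower K R M] {r : ℕ}

/-- `P` is a multi-graded submodule of `M = ⨁ M_d`, i.e. `P` is the sum of the `P ∩ M_d`. -/
def IsGradedSubmodule (𝓜 : (Fin r → ℤ) → Submodule K M) (P : Submodule R M) : Prop :=
  P.restrictScalars K = ⨆ d, P.restrictScalars K ⊓ 𝓜 d

/-- The Hilbert series `∑_{d ∈ ℤ^r} dim_K (P ∩ M_d) t^d` of a graded submodule `P` of `M`,
given by its coefficients. -/
def hilbertSeries (𝓜 : (Fin r → ℤ) → Submodule K M) (P : Submodule R M) :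
    (Fin r → ℤ) → ℚ :=
  fun d => (Module.finrank K ↥(P.restrictScalars K ⊓ 𝓜 d) : ℚ)

end Series

/-- The product `B(t) · ∑_d H_d t^d` of a polynomial and a formal Laurent series, given by its
coefficients. -/
def polyMul {r : ℕ} (B : MvPolynomial (Fin r) ℚ) (H : (Fin r → ℤ) → ℚ) : (Fin r → ℤ) → ℚ :=
  fun d => ∑ e ∈ B.support, B.coeff e * H (d - natToInt e)

/-- A formal series is a Laurent polynomial if it has only finitely many nonzero coefficients. -/
def IsLaurentPolynomial {r : ℕ} (F : (Fin r → ℤ) → ℚ) : Prop :=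
  (Function.support F).Finite

/-! ### The universal denominator -/

section UDenominator

variable {K : Type*} (R : Type*) {M : Type*} [Field K] [CommRing R] [Algebra K R]
  [AddCommGroup M] [Module K M] [Module R M] [IsScalarTower K R M] {r : ℕ}

/-- `B(0) = 1` and `B(t) H(P, t)` is a Laurent polynomial for every multi-graded `R`-submodule
`P ⊆ M`. -/
def IsCommonDenom (𝓜 : (Fin r → ℤ) → Submodule K M) (B : MvPolynomial (Fin r) ℚ) : Prop :=
  MvPolynomial.constantCoeff B = 1 ∧
    ∀ P : Submodule R M, IsGradedSubmodule 𝓜 P →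
      IsLaurentPolynomial (polyMul B (hilbertSeries 𝓜 P))

/-- `B` is the smallest (for divisibility) common denominator. -/
def IsUDenom (𝓜 : (Fin r → ℤ) → Submodule K M) (B : MvPolynomial (Fin r) ℚ) : Prop :=
  IsCommonDenom R 𝓜 B ∧ ∀ C, IsCommonDenom R 𝓜 C → B ∣ C

theorem IsUDenom.unique {𝓜 : (Fin r → ℤ) → Submodule K M} {B C : MvPolynomial (Fin r) ℚ}
    (hB : IsUDenom R 𝓜 B) (hC : IsUDenom R 𝓜 C) : B = C := by
  obtain ⟨u, hu⟩ := associated_of_dvd_dvd (hB.2 C hC.1) (hC.2 B hB.1)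
  obtain ⟨c, -, hc⟩ := MvPolynomial.isUnit_iff_eq_C_of_isReduced.1 u.isUnit
  have h := congrArg MvPolynomial.constantCoeff hu
  rw [map_mul, hB.1.1, hC.1.1, hc, MvPolynomial.constantCoeff_C, one_mul] at h
  rw [← hu, hc, h, map_one, mul_one]

open Classical in
/-- The universal denominator `udenom_R(M, t)` of the graded `R`-module `M = ⨁ M_d`
(with the value `0` if there is none). -/
def udenom (𝓜 : (Fin r → ℤ) → Submodule K M) : MvPolynomial (Fin r) ℚ :=
  if h : ∃ B, IsUDenom R 𝓜 B then h.choose else 0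

theorem IsUDenom.udenom_eq {𝓜 : (Fin r → ℤ) → Submodule K M} {B : MvPolynomial (Fin r) ℚ}
    (hB : IsUDenom R 𝓜 B) : udenom R 𝓜 = B := by
  have h : ∃ B, IsUDenom R 𝓜 B := ⟨B, hB⟩
  rw [udenom, dif_pos h]
  exact h.choose_spec.unique R hB

end UDenominator

/-! ### Tensor products -/

section TensorModule

variable {K R S M N : Type*} [Field K] [CommRing R] [Algebra K R] [CommRing S] [Algebra K S]
  [AddCommGroup M] [Module K M] [Module R M] [IsScalarTower K R M]
  [AddCommGroup N] [Module K N] [Module S N] [IsScalarTower K S N]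

/-- The action of `R ⊗ S` on `M ⊗ N` by `(a ⊗ b) (m ⊗ n) = (a m) ⊗ (b n)`. -/
def tensorAction (K R S M N : Type*) [Field K] [CommRing R] [Algebra K R] [CommRing S]
    [Algebra K S] [AddCommGroup M] [Module K M] [Module R M] [IsScalarTower K R M]
    [AddCommGroup N] [Module K N] [Module S N] [IsScalarTower K S N] :
    R ⊗[K] S →ₐ[K] Module.End K (M ⊗[K] N) :=
  (Module.endTensorEndAlgHom (R := K) (S := K) (A := K) (M := M) (N := N)).comp
    (Algebra.TensorProduct.map (Algebra.lsmul K K M) (Algebra.lsmul K K N))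

instance tensorModule : Module (R ⊗[K] S) (M ⊗[K] N) :=
  Module.compHom _ (tensorAction K R S M N).toRingHom

theorem tensor_smul_def (x : R ⊗[K] S) (y : M ⊗[K] N) :
    x • y = tensorAction K R S M N x y := rfl

theorem tmul_smul_tmul (a : R) (b : S) (m : M) (n : N) :
    (a ⊗ₜ[K] b) • (m ⊗ₜ[K] n) = (a • m) ⊗ₜ[K] (b • n) := by
  rw [tensor_smul_def, tensorAction, AlgHom.comp_apply, Algebra.TensorProduct.map_tmul,
    Module.endTensorEndAlgHom_apply]
  rfl

instance tensorModule_isScalarTower : IsScalarTower K (R ⊗[K] S) (M ⊗[K] N) where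
  smul_assoc c x y := by simp [tensor_smul_def]

end TensorModule

section TensorGrading

variable {K M N ι : Type*} [Field K] [AddCommGroup M] [Module K M] [AddCommGroup N] [Module K N]
  [AddCommMonoid ι]

/-- The grading `(M ⊗ N)_d = ⨁_{a + b = d} M_a ⊗ N_b`. -/
def tensorGrading (𝓜 : ι → Submodule K M) (𝓝 : ι → Submodule K N) :
    ι → Submodule K (M ⊗[K] N) :=
  fun d => ⨆ (a : ι) (b : ι) (_ : a + b = d), LinearMap.range (TensorProduct.mapIncl (𝓜 a) (𝓝 b))

theorem tmul_mem_tensorGrading {𝓜 : ι → Submodule K M} {𝓝 : ι → Submodule K N} {a b : ι}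
    {m : M} {n : N} (hm : m ∈ 𝓜 a) (hn : n ∈ 𝓝 b) :
    m ⊗ₜ[K] n ∈ tensorGrading 𝓜 𝓝 (a + b) := by
  refine Submodule.mem_iSup_of_mem a (Submodule.mem_iSup_of_mem b
    (Submodule.mem_iSup_of_mem rfl ?_))
  exact ⟨(⟨m, hm⟩ : 𝓜 a) ⊗ₜ[K] (⟨n, hn⟩ : 𝓝 b), by simp [TensorProduct.mapIncl]⟩

theorem tensorGrading_induction {𝓜 : ι → Submodule K M} {𝓝 : ι → Submodule K N} {d : ι}
    (Q : Submodule K (M ⊗[K] N))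
    (h : ∀ a b, a + b = d → ∀ m ∈ 𝓜 a, ∀ n ∈ 𝓝 b, m ⊗ₜ[K] n ∈ Q) :
    tensorGrading 𝓜 𝓝 d ≤ Q := by
  refine iSup_le fun a => iSup_le fun b => iSup_le fun hab => ?_
  rintro _ ⟨x, rfl⟩
  induction x with
  | zero => simp
  | add x y hx hy => rw [map_add]; exact Q.add_mem hx hy
  | tmul m n => simpa [TensorProduct.mapIncl] using h a b hab m m.2 n n.2

/-- The tensor product of two gradings is a grading. -/
theorem tensorGrading_isInternal [DecidableEq ι] {𝓜 : ι → Submodule K M} {𝓝 : ι → Submodule K N}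
    (hM : DirectSum.IsInternal 𝓜) (hN : DirectSum.IsInternal 𝓝) :
    DirectSum.IsInternal (tensorGrading 𝓜 𝓝) := by
  classical
  let := hM.chooseDecomposition
  let := hN.chooseDecomposition
  let φ : (⨁ p : ι × ι, (𝓜 p.1 ⊗[K] 𝓝 p.2)) →ₗ[K] ⨁ d, tensorGrading 𝓜 𝓝 d :=
    DirectSum.toModule K _ _ fun p =>
      (DirectSum.lof K ι (fun d => tensorGrading 𝓜 𝓝 d) (p.1 + p.2)).comp
        ((TensorProduct.mapIncl (𝓜 p.1) (𝓝 p.2)).codRestrict (tensorGrading 𝓜 𝓝 (p.1 + p.2))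
          fun x => Submodule.mem_iSup_of_mem p.1 (Submodule.mem_iSup_of_mem p.2
            (Submodule.mem_iSup_of_mem rfl ⟨x, rfl⟩)))
  let ψ : M ⊗[K] N →ₗ[K] ⨁ d, tensorGrading 𝓜 𝓝 d :=
    φ ∘ₗ (TensorProduct.directSum K K (fun a => 𝓜 a) (fun b => 𝓝 b)).toLinearMap ∘ₗ
      (TensorProduct.congr (DirectSum.decomposeLinearEquiv 𝓜)
        (DirectSum.decomposeLinearEquiv 𝓝)).toLinearMap
  have hψ : ∀ a b (m : M) (n : N) (hm : m ∈ 𝓜 a) (hn : n ∈ 𝓝 b),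
      ψ (m ⊗ₜ n) = DirectSum.lof K ι (fun d => tensorGrading 𝓜 𝓝 d) (a + b)
        ⟨m ⊗ₜ n, tmul_mem_tensorGrading hm hn⟩ := by
    intro a b m n hm hn
    have h1 : DirectSum.decompose 𝓜 m = DirectSum.lof K ι (fun a => 𝓜 a) a ⟨m, hm⟩ :=
      DirectSum.decompose_of_mem _ hm
    have h2 : DirectSum.decompose 𝓝 n = DirectSum.lof K ι (fun a => 𝓝 a) b ⟨n, hn⟩ :=
      DirectSum.decompose_of_mem _ hn
    simp only [ψ, LinearMap.comp_apply, LinearEquiv.coe_coe, TensorProduct.congr_tmul,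
      DirectSum.decomposeLinearEquiv_apply, h1, h2, TensorProduct.directSum_lof_tmul_lof, φ,
      DirectSum.toModule_lof]
    rfl
  have key : ∀ d, ∀ x (hx : x ∈ tensorGrading 𝓜 𝓝 d),
      ψ x = DirectSum.lof K ι (fun d => tensorGrading 𝓜 𝓝 d) d ⟨x, hx⟩ := by
    intro d
    let Q : Submodule K (M ⊗[K] N) := Submodule.map (tensorGrading 𝓜 𝓝 d).subtype
      (LinearMap.eqLocus (ψ ∘ₗ (tensorGrading 𝓜 𝓝 d).subtype)
        (DirectSum.lof K ι (fun d => tensorGrading 𝓜 𝓝 d) d))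
    have hQ : tensorGrading 𝓜 𝓝 d ≤ Q := by
      refine tensorGrading_induction Q ?_
      rintro a b rfl m hm n hn
      exact ⟨⟨m ⊗ₜ n, tmul_mem_tensorGrading hm hn⟩, hψ a b m n hm hn, rfl⟩
    intro x hx
    obtain ⟨y, hy, rfl⟩ := hQ hx
    exact hy
  refine ⟨?_, ?_⟩
  · have hleft : ψ ∘ₗ DirectSum.coeLinearMap (tensorGrading 𝓜 𝓝) = LinearMap.id := by
      refine DirectSum.linearMap_ext _ fun d => LinearMap.ext fun x => ?_
      simp only [LinearMap.comp_apply, DirectSum.coeLinearMap_lof, LinearMap.id_apply]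
      exact key d x x.2
    exact Function.LeftInverse.injective (g := ψ) fun x => LinearMap.congr_fun hleft x
  · have htop : LinearMap.range (DirectSum.coeLinearMap (tensorGrading 𝓜 𝓝)) = ⊤ := by
      rw [DirectSum.range_coeLinearMap, eq_top_iff, ← TensorProduct.span_tmul_eq_top,
        Submodule.span_le]
      rintro _ ⟨m, n, rfl⟩
      rw [SetLike.mem_coe, ← DirectSum.sum_support_decompose 𝓜 m,
        ← DirectSum.sum_support_decompose 𝓝 n, TensorProduct.sum_tmul]
      refine Submodule.sum_mem _ fun a _ => ?_
      rw [TensorProduct.tmul_sum]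
      exact Submodule.sum_mem _ fun b _ => Submodule.mem_iSup_of_mem (a + b)
        (tmul_mem_tensorGrading (SetLike.coe_mem _) (SetLike.coe_mem _))
    exact LinearMap.range_eq_top.1 htop

end TensorGrading

/-- `M ⊗ N` is a graded module over the graded ring `R ⊗ S`. -/
theorem IsGradedModule.tensor {K R S M N : Type*} [Field K] [CommRing R] [Algebra K R]
    [CommRing S] [Algebra K S] [AddCommGroup M] [Module K M] [Module R M] [IsScalarTower K R M]
    [AddCommGroup N] [Module K N] [Module S N] [IsScalarTower K S N] {r : ℕ}
    {𝓡 : (Fin r → ℕ) → Submodule K R} {𝓢 : (Fin r → ℕ) → Submodule K S}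
    {𝓜 : (Fin r → ℤ) → Submodule K M} {𝓝 : (Fin r → ℤ) → Submodule K N}
    (hM : IsGradedModule 𝓡 𝓜) (hN : IsGradedModule 𝓢 𝓝) :
    IsGradedModule (tensorGrading 𝓡 𝓢) (tensorGrading 𝓜 𝓝) where
  isInternal := tensorGrading_isInternal hM.isInternal hN.isInternal
  smul_mem d e x y hx hy := by
    have h1 : tensorGrading 𝓡 𝓢 d ≤ (tensorGrading 𝓜 𝓝 (natToInt d + e)).comap
        ((tensorAction K R S M N).toLinearMap.flip y) := by
      refine tensorGrading_induction _ ?_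
      rintro a b rfl p hp q hq
      have h2 : tensorGrading 𝓜 𝓝 e ≤ (tensorGrading 𝓜 𝓝 (natToInt (a + b) + e)).comap
          (tensorAction K R S M N (p ⊗ₜ q)) := by
        refine tensorGrading_induction _ ?_
        rintro a' b' rfl m hm n hn
        have h3 : natToInt (a + b) + (a' + b') = (natToInt a + a') + (natToInt b + b') := by
          funext i
          simp only [natToInt, Pi.add_apply, Nat.cast_add]
          ring
        rw [Submodule.mem_comap, ← tensor_smul_def, tmul_smul_tmul, h3]
        exact tmul_mem_tensorGrading (hM.smul_mem _ _ _ _ hp hm) (hN.smul_mem _ _ _ _ hq hn)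
      exact h2 hy
    exact h1 hx

end UDenom

end

/-! Existence. By the Hilbert–Serre argument (`IsIrrelevantSystem.prod_mul_hser_mem`) a product of
factors `1 - t^δ` clears the denominators of all graded submodules at once. Since ℚ[t] is factorial,
the polynomials that clear all these denominators are closed under gcd, so one of them divides all
the others (`exists_forall_dvd`).

The product divides every common denominator `C` of `M ⊗ N`. The submodules `P ⊗ Q` have Hilbert
series `H(P) H(Q)` (`hser_tensorSub`), so `B B'` divides `C a b` for all numerators `a = B H(P)` and
`b = B' H(Q)`. By minimality of `B` and `B'` these numerators can be cancelled
(`IsFiniteGraded.dvd_of_forall_dvd_mul`).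

The product is a common denominator. It suffices to bound, for each prime `p` of ℚ[t], the pole
along `p` of the Hilbert series of a subquotient `P₂/P₁` of `M ⊗ N` (`mem_polys_of_isLocalDenom`).
Noetherian induction runs over pairs `(I, J)` of homogeneous ideals of `R` and `S` that kill
`P₂/P₁`. For a homogeneous `a ∉ I` of degree `d`, the kernel and cokernel of `a` on `P₂/P₁` are
killed by `I + (a)`, so the induction hypothesis finishes the proof unless `p ∣ 1 - t^d`. Similar
filtrations allow the assumption that `I` is prime on homogeneous elements and contains the
homogeneous elements of `R` that annihilate `M ⊗ N`, and likewise for `J` (`isLocalDenom_or_prime`).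

In the remaining case the exponents `d` with `p ∣ 1 - t^d` are the multiples of a single `c`
(`exists_generator_of_prime_dvd`), so `R/I` and `S/J` live on the ray ℕc. Some homogeneous `m ∈ M`
has its homogeneous annihilators in `I`, and the Hilbert series `f` of `Rm/Im` dominates that of
`R/I` up to a shift; similarly `g` for `N`. A subquotient of `M ⊗ N` generated by one element and
killed by `I` and `J` is a quotient of a shift of `R/I ⊗ S/J`, so its series `h` satisfies `0 ≤ h ≤
f g` along the ray. As series in `u = t^c`, growth of coefficients bounds the pole of `h` at `u = 1`
by that of `f g` (`pow_rootMultiplicity_dvd_of_coeff_le`), and this is the only pole that `p` sees.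
As `B f` and `B' g` are polynomials, `B B'` clears the pole of `h` along `p`
(`isLocalDenom_of_coeff_le`, `isLocalDenom_of_ray`). -/

open scoped TensorProduct DirectSum

noncomputable section

namespace UDenom

/-! ### Homogeneous components -/

section Components

variable {K M : Type*} [Field K] [AddCommGroup M] [Module K M] {ι : Type*} [DecidableEq ι]
  {𝓜 : ι → Submodule K M}

/-- The isomorphism `⨁ M_d ≃ M` given by a grading. -/
def gradingEquiv (h : DirectSum.IsInternal 𝓜) : (⨁ d, 𝓜 d) ≃ₗ[K] M :=
  LinearEquiv.ofBijective (DirectSum.coeLinearMap 𝓜) h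

theorem gradingEquiv_apply (h : DirectSum.IsInternal 𝓜) (x : ⨁ d, 𝓜 d) :
    gradingEquiv h x = DirectSum.coeLinearMap 𝓜 x := rfl

/-- The projection of `M = ⨁ M_d` onto its component of degree `d`. -/
def homComp (h : DirectSum.IsInternal 𝓜) (d : ι) : M →ₗ[K] M :=
  (𝓜 d).subtype ∘ₗ DirectSum.component K ι (fun i => 𝓜 i) d ∘ₗ
    (gradingEquiv h).symm.toLinearMap

theorem homComp_mem (h : DirectSum.IsInternal 𝓜) (d : ι) (m : M) : homComp h d m ∈ 𝓜 d :=
  Subtype.property _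

theorem homComp_of_mem_eq_ite (h : DirectSum.IsInternal 𝓜) {d e : ι} {m : M} (hm : m ∈ 𝓜 e) :
    homComp h d m = if e = d then m else 0 := by
  have h1 : (gradingEquiv h).symm m =
      DirectSum.lof K ι (fun i => 𝓜 i) e ⟨m, hm⟩ := by
    rw [LinearEquiv.symm_apply_eq, gradingEquiv_apply, DirectSum.coeLinearMap_lof]
  simp only [homComp, LinearMap.comp_apply, LinearEquiv.coe_coe, h1, Submodule.subtype_apply]
  split_ifs with hed
  · subst hed
    rw [DirectSum.component.lof_self]
  · rw [DirectSum.component.of, dif_neg hed]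
    rfl

theorem homComp_of_mem (h : DirectSum.IsInternal 𝓜) {d : ι} {m : M} (hm : m ∈ 𝓜 d) :
    homComp h d m = m := by
  rw [homComp_of_mem_eq_ite h hm, if_pos rfl]

theorem homComp_of_mem_ne (h : DirectSum.IsInternal 𝓜) {d e : ι} {m : M} (hm : m ∈ 𝓜 e)
    (hed : e ≠ d) : homComp h d m = 0 := by
  rw [homComp_of_mem_eq_ite h hm, if_neg hed]

theorem exists_sum_homComp (h : DirectSum.IsInternal 𝓜) (m : M) :
    ∃ s : Finset ι, ∑ d ∈ s, homComp h d m = m := by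
  classical
  refine ⟨DFinsupp.support ((gradingEquiv h).symm m), ?_⟩
  conv_rhs => rw [← (gradingEquiv h).apply_symm_apply m]
  rw [gradingEquiv_apply, DirectSum.coeLinearMap_eq_dfinsuppSum]
  rfl

theorem mem_of_homComp_mem (h : DirectSum.IsInternal 𝓜) {Q : Submodule K M} {m : M}
    (hm : ∀ d, homComp h d m ∈ Q) : m ∈ Q := by
  obtain ⟨s, hs⟩ := exists_sum_homComp h m
  rw [← hs]
  exact Q.sum_mem fun d _ => hm d

end Components

section Graded

variable {K R M : Type*} [Field K] [CommRing R] [Algebra K R]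
  [AddCommGroup M] [Module K M] [Module R M] [IsScalarTower K R M] {r : ℕ}
  {𝓡 : (Fin r → ℕ) → Submodule K R} {𝓜 : (Fin r → ℤ) → Submodule K M}

theorem isGradedSubmodule_iff (h : DirectSum.IsInternal 𝓜) {P : Submodule R M} :
    IsGradedSubmodule 𝓜 P ↔ ∀ m ∈ P, ∀ d, homComp h d m ∈ P := by
  constructor
  · intro hP m hm d
    have h1 : m ∈ ⨆ d, P.restrictScalars K ⊓ 𝓜 d := by
      rw [← (show P.restrictScalars K = _ from hP)]
      exact hm
    have h2 : ⨆ d, P.restrictScalars K ⊓ 𝓜 d ≤ (P.restrictScalars K).comap (homComp h d) := by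
      refine iSup_le fun e => ?_
      rintro x ⟨hx, hxe⟩
      rw [Submodule.mem_comap, homComp_of_mem_eq_ite h hxe]
      split_ifs
      · exact hx
      · exact Submodule.zero_mem _
    exact h2 h1
  · intro hP
    refine le_antisymm (fun m hm => ?_) (iSup_le fun d => inf_le_left)
    exact mem_of_homComp_mem h fun d => Submodule.mem_iSup_of_mem d ⟨hP m hm d, homComp_mem h d m⟩

/-- Both sides are linear in `m`, so it is enough to compare them on homogeneous elements. All
stability properties of graded submodules below rest on this shift rule. -/
theorem homComp_smul (hM : IsGradedModule 𝓡 𝓜) {δ : Fin r → ℕ} {a : R} (ha : a ∈ 𝓡 δ)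
    (d : Fin r → ℤ) (m : M) :
    homComp hM.isInternal d (a • m) = a • homComp hM.isInternal (d - natToInt δ) m := by
  have h1 : m ∈ LinearMap.eqLocus (homComp hM.isInternal d ∘ₗ (Algebra.lsmul K K M a))
      (Algebra.lsmul K K M a ∘ₗ homComp hM.isInternal (d - natToInt δ)) := by
    refine mem_of_homComp_mem hM.isInternal fun e => ?_
    have he := homComp_mem hM.isInternal e m
    simp only [LinearMap.mem_eqLocus, LinearMap.comp_apply, Algebra.lsmul_coe]
    rw [homComp_of_mem_eq_ite _ he, homComp_of_mem_eq_ite _ (hM.smul_mem _ _ _ _ ha he)]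
    by_cases hed : e = d - natToInt δ
    · rw [if_pos hed, if_pos (by rw [hed]; abel)]
    · rw [if_neg hed, if_neg (fun h => hed (by rw [← h]; abel)), smul_zero]
  exact h1

theorem IsGradedSubmodule.bot (h : DirectSum.IsInternal 𝓜) :
    IsGradedSubmodule 𝓜 (⊥ : Submodule R M) := by
  rw [isGradedSubmodule_iff h]
  intro m hm d
  rw [(Submodule.mem_bot R).1 hm, map_zero]
  exact Submodule.zero_mem _

theorem IsGradedSubmodule.top (h : DirectSum.IsInternal 𝓜) :
    IsGradedSubmodule 𝓜 (⊤ : Submodule R M) := by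
  rw [isGradedSubmodule_iff h]
  exact fun _ _ _ => Submodule.mem_top

theorem IsGradedSubmodule.sup (h : DirectSum.IsInternal 𝓜) {P Q : Submodule R M}
    (hP : IsGradedSubmodule 𝓜 P) (hQ : IsGradedSubmodule 𝓜 Q) :
    IsGradedSubmodule 𝓜 (P ⊔ Q) := by
  rw [isGradedSubmodule_iff h] at *
  intro m hm d
  obtain ⟨p, hp, q, hq, rfl⟩ := Submodule.mem_sup.1 hm
  rw [map_add]
  exact Submodule.add_mem_sup (hP p hp d) (hQ q hq d)

theorem IsGradedSubmodule.inf (h : DirectSum.IsInternal 𝓜) {P Q : Submodule R M}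
    (hP : IsGradedSubmodule 𝓜 P) (hQ : IsGradedSubmodule 𝓜 Q) :
    IsGradedSubmodule 𝓜 (P ⊓ Q) := by
  rw [isGradedSubmodule_iff h] at *
  exact fun m hm d => ⟨hP m hm.1 d, hQ m hm.2 d⟩

theorem IsGradedSubmodule.map_lsmul (hM : IsGradedModule 𝓡 𝓜) {P : Submodule R M}
    (hP : IsGradedSubmodule 𝓜 P) {δ : Fin r → ℕ} {a : R} (ha : a ∈ 𝓡 δ) :
    IsGradedSubmodule 𝓜 (P.map (LinearMap.lsmul R M a)) := by
  rw [isGradedSubmodule_iff hM.isInternal] at *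
  rintro _ ⟨m, hm, rfl⟩ d
  rw [LinearMap.lsmul_apply, homComp_smul hM ha]
  exact ⟨_, hP m hm _, rfl⟩

theorem IsGradedSubmodule.comap_lsmul (hM : IsGradedModule 𝓡 𝓜) {P : Submodule R M}
    (hP : IsGradedSubmodule 𝓜 P) {δ : Fin r → ℕ} {a : R} (ha : a ∈ 𝓡 δ) :
    IsGradedSubmodule 𝓜 (P.comap (LinearMap.lsmul R M a)) := by
  rw [isGradedSubmodule_iff hM.isInternal] at *
  intro m hm d
  have h1 := hP _ hm (natToInt δ + d)
  rwa [LinearMap.lsmul_apply, homComp_smul hM ha, add_sub_cancel_left] at h1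

theorem isGradedSubmodule_span (hM : IsGradedModule 𝓡 𝓜) (h𝓡 : iSup 𝓡 = ⊤) {X : Set M}
    (hX : ∀ x ∈ X, ∃ d, x ∈ 𝓜 d) : IsGradedSubmodule 𝓜 (Submodule.span R X) := by
  rw [isGradedSubmodule_iff hM.isInternal]
  intro m hm
  induction hm using Submodule.span_induction with
  | mem x hx =>
    intro d
    obtain ⟨e, he⟩ := hX x hx
    rw [homComp_of_mem_eq_ite _ he]
    split_ifs
    · exact Submodule.subset_span hx
    · exact Submodule.zero_mem _
  | zero => simp
  | add x y _ _ hx hy => intro d; rw [map_add]; exact Submodule.add_mem _ (hx d) (hy d)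
  | smul a x _ hx =>
    have ha : a ∈ iSup 𝓡 := h𝓡 ▸ Submodule.mem_top
    induction ha using Submodule.iSup_induction' with
    | mem δ a ha => intro d; rw [homComp_smul hM ha]; exact Submodule.smul_mem _ _ (hx _)
    | zero => simp
    | add a b _ _ h1 h2 =>
      intro d; rw [add_smul, map_add]; exact Submodule.add_mem _ (h1 d) (h2 d)

theorem span_homogeneous_inter (h : DirectSum.IsInternal 𝓜) {P : Submodule R M}
    (hP : IsGradedSubmodule 𝓜 P) : Submodule.span R {m | m ∈ P ∧ ∃ d, m ∈ 𝓜 d} = P := by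
  refine le_antisymm (Submodule.span_le.2 fun m hm => hm.1) fun m hm => ?_
  have h1 : m ∈ (Submodule.span R {m | m ∈ P ∧ ∃ d, m ∈ 𝓜 d}).restrictScalars K :=
    mem_of_homComp_mem h fun d => Submodule.subset_span
      ⟨(isGradedSubmodule_iff h).1 hP m hm d, d, homComp_mem h d m⟩
  exact h1

theorem exists_finset_span_eq [IsNoetherian R M] (h : DirectSum.IsInternal 𝓜)
    {P : Submodule R M} (hP : IsGradedSubmodule 𝓜 P) :
    ∃ X : Finset M, (∀ x ∈ X, ∃ d, x ∈ 𝓜 d) ∧ Submodule.span R (X : Set M) = P := by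
  obtain ⟨X, hX, h1⟩ := (Submodule.fg_span_iff_fg_span_finset_subset
    {m | m ∈ P ∧ ∃ d, m ∈ 𝓜 d}).1 (IsNoetherian.noetherian (R := R) _)
  exact ⟨X, fun x hx => (hX hx).2, h1 ▸ span_homogeneous_inter h hP⟩

/-- All degrees of a finitely generated graded module are bounded below. -/
theorem exists_lower_bound [IsNoetherian R M] (hM : IsGradedModule 𝓡 𝓜) (h𝓡 : iSup 𝓡 = ⊤) :
    ∃ s : Fin r → ℤ, ∀ d, 𝓜 d ≠ ⊥ → s ≤ d := by
  obtain ⟨X, hX, hspan⟩ := exists_finset_span_eq (R := R) hM.isInternal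
    (IsGradedSubmodule.top hM.isInternal)
  choose! deg hdeg using hX
  obtain ⟨s, hs⟩ := (X.image deg).finite_toSet.bddBelow
  refine ⟨s, fun d hd => ?_⟩
  by_contra hsd
  apply hd
  have key : ∀ m : M, homComp hM.isInternal d m = 0 := by
    suffices ∀ m ∈ Submodule.span R (X : Set M), ∀ d, ¬ s ≤ d → homComp hM.isInternal d m = 0 from
      fun m => this m (hspan ▸ Submodule.mem_top) d hsd
    intro m hm
    induction hm using Submodule.span_induction with
    | mem x hx =>
      intro d hd
      refine homComp_of_mem_ne _ (hdeg x hx) ?_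
      rintro rfl
      exact hd (hs (by simpa using ⟨x, hx, rfl⟩))
    | zero => simp
    | add x y _ _ hx hy => intro d hd; rw [map_add, hx d hd, hy d hd, add_zero]
    | smul a x _ hx =>
      have ha : a ∈ iSup 𝓡 := h𝓡 ▸ Submodule.mem_top
      induction ha using Submodule.iSup_induction' with
      | mem δ a ha =>
        intro d hd
        rw [homComp_smul hM ha, hx, smul_zero]
        refine fun h => hd (h.trans fun i => ?_)
        simp [natToInt]
      | zero => simp
      | add a b _ _ h1 h2 => intro d hd; rw [add_smul, map_add, h1 d hd, h2 d hd, add_zero]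
  rw [eq_bot_iff]
  intro m hm
  rw [Submodule.mem_bot, ← homComp_of_mem hM.isInternal hm, key]

end Graded

/-! ### Hilbert series as power series -/

section Series

variable {r : ℕ}

/-- The monomial `t^δ`. -/
def tpow (δ : Fin r → ℕ) : MvPolynomial (Fin r) ℚ :=
  MvPolynomial.monomial (Finsupp.equivFunOnFinite.symm δ) 1

theorem tpow_zero : tpow (0 : Fin r → ℕ) = 1 := by
  have h : Finsupp.equivFunOnFinite.symm (0 : Fin r → ℕ) = 0 := by ext; simp
  rw [tpow, h]
  rfl

theorem tpow_add (a b : Fin r → ℕ) : tpow (a + b) = tpow a * tpow b := by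
  have h : Finsupp.equivFunOnFinite.symm (a + b) =
    Finsupp.equivFunOnFinite.symm a + Finsupp.equivFunOnFinite.symm b := by ext; simp
  rw [tpow, tpow, tpow, MvPolynomial.monomial_mul, h, one_mul]

theorem tpow_nsmul (k : ℕ) (a : Fin r → ℕ) : tpow (k • a) = tpow a ^ k := by
  induction k with
  | zero => rw [zero_smul, tpow_zero, pow_zero]
  | succ k ih => rw [succ_nsmul, tpow_add, ih, pow_succ]

theorem constantCoeff_tpow {δ : Fin r → ℕ} (hδ : δ ≠ 0) :
    MvPolynomial.constantCoeff (tpow δ) = 0 := by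
  rw [tpow, MvPolynomial.constantCoeff_monomial, if_neg]
  intro h
  apply hδ
  funext i
  simpa using DFunLike.congr_fun h i

/-- The power series that are polynomials. -/
def polys (r : ℕ) : Subring (MvPowerSeries (Fin r) ℚ) :=
  (MvPolynomial.coeToMvPowerSeries.ringHom (σ := Fin r) (R := ℚ)).range

theorem coe_mem_polys (p : MvPolynomial (Fin r) ℚ) :
    (p : MvPowerSeries (Fin r) ℚ) ∈ polys r := ⟨p, rfl⟩

theorem mem_polys_iff {f : MvPowerSeries (Fin r) ℚ} :
    f ∈ polys r ↔ ∃ p : MvPolynomial (Fin r) ℚ, f = p :=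
  ⟨fun ⟨p, hp⟩ => ⟨p, hp.symm⟩, fun ⟨p, hp⟩ => ⟨p, hp.symm⟩⟩

theorem mem_polys_iff_finite {f : MvPowerSeries (Fin r) ℚ} :
    f ∈ polys r ↔ {n | MvPowerSeries.coeff n f ≠ 0}.Finite := by
  constructor
  · rintro ⟨p, rfl⟩
    refine p.support.finite_toSet.subset fun n hn => ?_
    simpa using hn
  · intro h
    refine ⟨∑ n ∈ h.toFinset, MvPolynomial.monomial n (MvPowerSeries.coeff n f), ?_⟩
    ext n
    simp only [MvPolynomial.coeToMvPowerSeries.ringHom_apply, MvPolynomial.coeff_coe,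
      MvPolynomial.coeff_sum, MvPolynomial.coeff_monomial]
    rw [Finset.sum_ite_eq' h.toFinset n]
    simp only [Set.Finite.mem_toFinset, Set.mem_ofPred_eq]
    split_ifs with h1
    · rfl
    · exact (not_not.1 h1).symm

/-- The power series `∑_n H_{s + n} t^n`. -/
def toSeries (s : Fin r → ℤ) (H : (Fin r → ℤ) → ℚ) : MvPowerSeries (Fin r) ℚ :=
  fun n => H (s + natToInt n)

theorem coeff_toSeries (s : Fin r → ℤ) (H : (Fin r → ℤ) → ℚ) (n : Fin r →₀ ℕ) :
    MvPowerSeries.coeff n (toSeries s H) = H (s + natToInt n) := rfl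

theorem exists_eq_add_natToInt {s d : Fin r → ℤ} (h : s ≤ d) :
    ∃ n : Fin r →₀ ℕ, d = s + natToInt n := by
  refine ⟨Finsupp.equivFunOnFinite.symm fun i => (d i - s i).toNat, ?_⟩
  funext i
  have := h i
  simp [natToInt, Int.toNat_of_nonneg (sub_nonneg.2 this)]

theorem natToInt_injective : Function.Injective (natToInt (r := r)) := by
  intro a b h
  funext i
  exact Int.ofNat_injective (congrFun h i)

theorem natToInt_add (a b : Fin r → ℕ) : natToInt (a + b) = natToInt a + natToInt b := by
  funext i
  simp [natToInt]

/-- Because `H` is supported in degrees `≥ s`, a shift by `s` loses nothing, and the Laurent product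
becomes a product of power series. The terms with `e ≰ n` vanish by `hH`; the others match the
antidiagonal of `n`. -/
theorem polyMul_eq_coeff {s : Fin r → ℤ} {H : (Fin r → ℤ) → ℚ} (hH : ∀ d, H d ≠ 0 → s ≤ d)
    (B : MvPolynomial (Fin r) ℚ) (n : Fin r →₀ ℕ) :
    polyMul B H (s + natToInt n) =
      MvPowerSeries.coeff n ((B : MvPowerSeries (Fin r) ℚ) * toSeries s H) := by
  classical
  rw [MvPowerSeries.coeff_mul, polyMul,
    ← Finset.sum_filter_of_ne (p := fun e : Fin r →₀ ℕ => e ≤ n)]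
  · symm
    refine Finset.sum_bij_ne_zero (fun p _ _ => p.1) ?_ ?_ ?_ ?_
    · intro p hp hne
      rw [Finset.HasAntidiagonal.mem_antidiagonal] at hp
      rw [Finset.mem_filter, MvPolynomial.mem_support_iff]
      exact ⟨fun h => hne (by simp [h]), hp ▸ le_self_add⟩
    · intro p hp _ q hq _ hpq
      rw [Finset.HasAntidiagonal.mem_antidiagonal] at hp hq
      refine Prod.ext hpq ?_
      rw [← hq, hpq] at hp
      exact add_left_cancel hp
    · intro e he _
      rw [Finset.mem_filter] at he
      refine ⟨(e, n - e), ?_, ?_, rfl⟩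
      · rw [Finset.HasAntidiagonal.mem_antidiagonal]; exact add_tsub_cancel_of_le he.2
      · rename_i hne
        convert hne using 2
        · exact MvPolynomial.coeff_coe B e
        rw [coeff_toSeries]
        congr 1
        funext i
        have := he.2 i
        simp [natToInt, Nat.cast_sub this]
        ring
    · intro p hp _
      rw [Finset.HasAntidiagonal.mem_antidiagonal] at hp
      subst hp
      rw [MvPolynomial.coeff_coe, coeff_toSeries, Finsupp.coe_add, natToInt_add]
      congr 2
      abel
  · intro e _ hne
    have h1 := hH _ (right_ne_zero_of_mul hne)
    intro i
    have := h1 i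
    simp only [natToInt, Pi.add_apply, Pi.sub_apply] at this
    omega

theorem polyMul_ne_zero_le {s : Fin r → ℤ} {H : (Fin r → ℤ) → ℚ} (hH : ∀ d, H d ≠ 0 → s ≤ d)
    (B : MvPolynomial (Fin r) ℚ) {d : Fin r → ℤ} (hd : polyMul B H d ≠ 0) : s ≤ d := by
  obtain ⟨e, -, he⟩ := Finset.exists_ne_zero_of_sum_ne_zero hd
  refine (hH _ (right_ne_zero_of_mul he)).trans fun i => ?_
  simp [natToInt]

theorem isLaurentPolynomial_polyMul_iff {s : Fin r → ℤ} {H : (Fin r → ℤ) → ℚ}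
    (hH : ∀ d, H d ≠ 0 → s ≤ d) (B : MvPolynomial (Fin r) ℚ) :
    IsLaurentPolynomial (polyMul B H) ↔
      (B : MvPowerSeries (Fin r) ℚ) * toSeries s H ∈ polys r := by
  rw [mem_polys_iff_finite, IsLaurentPolynomial]
  constructor
  · intro h
    refine Set.Finite.of_finite_image (f := fun n : Fin r →₀ ℕ => s + natToInt n)
      (h.subset ?_) ?_
    · rintro _ ⟨n, hn, rfl⟩
      rw [Function.mem_support, polyMul_eq_coeff hH]
      exact hn
    · intro a _ b _ hab
      exact DFunLike.coe_injective (natToInt_injective (add_left_cancel hab))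
  · intro h
    refine (h.image fun n : Fin r →₀ ℕ => s + natToInt n).subset fun d hd => ?_
    obtain ⟨n, rfl⟩ := exists_eq_add_natToInt (polyMul_ne_zero_le hH B hd)
    refine ⟨n, ?_, rfl⟩
    rw [Function.mem_support, polyMul_eq_coeff hH] at hd
    exact hd

theorem coeff_tpow_mul_toSeries {s : Fin r → ℤ} {H : (Fin r → ℤ) → ℚ}
    (hH : ∀ d, H d ≠ 0 → s ≤ d) (δ : Fin r → ℕ) (n : Fin r →₀ ℕ) :
    MvPowerSeries.coeff n ((tpow δ : MvPowerSeries (Fin r) ℚ) * toSeries s H) =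
      H (s + natToInt n - natToInt δ) := by
  rw [← polyMul_eq_coeff hH, polyMul, tpow, MvPolynomial.support_monomial, if_neg one_ne_zero,
    Finset.sum_singleton, MvPolynomial.coeff_monomial, if_pos rfl, one_mul]
  rfl

end Series

section LinearAlgebra

variable {K V W : Type*} [Field K] [AddCommGroup V] [Module K V] [AddCommGroup W] [Module K W]

theorem finrank_map_add_finrank_inf_ker (f : V →ₗ[K] W) (B : Submodule K V) [Module.Finite K B] :
    Module.finrank K (B.map f) + Module.finrank K ↥(B ⊓ LinearMap.ker f) =
      Module.finrank K B := by
  rw [← LinearMap.finrank_range_add_finrank_ker (f.domRestrict B), LinearMap.range_domRestrict,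
    LinearMap.ker_domRestrict, ← Submodule.map_comap_subtype, Submodule.finrank_map_subtype_eq]

end LinearAlgebra

section HilbertSeries

variable {K R M : Type*} [Field K] [CommRing R] [Algebra K R]
  [AddCommGroup M] [Module K M] [Module R M] [IsScalarTower K R M] {r : ℕ}
  {𝓡 : (Fin r → ℕ) → Submodule K R} {𝓜 : (Fin r → ℤ) → Submodule K M}

theorem hilbertSeries_eq_zero_of_eq_bot {d : Fin r → ℤ} (h : 𝓜 d = ⊥) (P : Submodule R M) :
    hilbertSeries 𝓜 P d = 0 := by
  rw [hilbertSeries, h, inf_bot_eq, finrank_bot, Nat.cast_zero]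

theorem le_of_hilbertSeries_ne_zero {s : Fin r → ℤ} (hs : ∀ d, 𝓜 d ≠ ⊥ → s ≤ d)
    (P : Submodule R M) (d : Fin r → ℤ) (h : hilbertSeries 𝓜 P d ≠ 0) : s ≤ d :=
  hs d fun h1 => h (hilbertSeries_eq_zero_of_eq_bot h1 P)

theorem hilbertSeries_mono (hfin : ∀ d, Module.Finite K (𝓜 d)) {P Q : Submodule R M}
    (hPQ : P ≤ Q) (d : Fin r → ℤ) : hilbertSeries 𝓜 P d ≤ hilbertSeries 𝓜 Q d := by
  have := hfin d
  rw [hilbertSeries, hilbertSeries, Nat.cast_le]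
  have : Module.Finite K ↥(Q.restrictScalars K ⊓ 𝓜 d) :=
    Submodule.finiteDimensional_of_le inf_le_right
  exact Submodule.finrank_mono (inf_le_inf_right _ hPQ)

/-- Multiplication by a homogeneous element `a` on the subquotient `P₂ / P₁`. -/
theorem hilbertSeries_smul (hM : IsGradedModule 𝓡 𝓜) (hfin : ∀ d, Module.Finite K (𝓜 d))
    {P₁ P₂ : Submodule R M} (h₁ : IsGradedSubmodule 𝓜 P₁) (h₂ : IsGradedSubmodule 𝓜 P₂)
    {δ : Fin r → ℕ} {a : R} (ha : a ∈ 𝓡 δ) (d : Fin r → ℤ) :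
    hilbertSeries 𝓜 (P₁ ⊔ P₂.map (LinearMap.lsmul R M a)) d - hilbertSeries 𝓜 P₁ d =
      hilbertSeries 𝓜 P₂ (d - natToInt δ) -
        hilbertSeries 𝓜 (P₂ ⊓ P₁.comap (LinearMap.lsmul R M a)) (d - natToInt δ) := by
  set e := d - natToInt δ with he
  have hde : natToInt δ + e = d := by rw [he]; abel
  have := hfin d
  have := hfin e
  set Q := P₁ ⊔ P₂.map (LinearMap.lsmul R M a) with hQ
  have hQg : IsGradedSubmodule 𝓜 Q := h₁.sup hM.isInternal (h₂.map_lsmul hM ha)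
  have : Module.Finite K ↥(Q.restrictScalars K ⊓ 𝓜 d) :=
    Submodule.finiteDimensional_of_le inf_le_right
  have : Module.Finite K ↥(P₂.restrictScalars K ⊓ 𝓜 e) :=
    Submodule.finiteDimensional_of_le inf_le_right
  -- Multiplication by `a`, read modulo the degree `d` part of `P₁`, maps the degree `e` part of
  -- `P₂` onto that of `Q / P₁` in degree `d` (`k3`), with kernel the degree `e` part of `P₂ ∩ (P₁ :
  -- a)` (`k1`). The claim is rank–nullity for this map.
  let A := P₁.restrictScalars K ⊓ 𝓜 d
  let f : M →ₗ[K] M ⧸ A := A.mkQ ∘ₗ Algebra.lsmul K K M a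
  have e1 := finrank_map_add_finrank_inf_ker f (P₂.restrictScalars K ⊓ 𝓜 e)
  have e2 := finrank_map_add_finrank_inf_ker A.mkQ (Q.restrictScalars K ⊓ 𝓜 d)
  have k1 : P₂.restrictScalars K ⊓ 𝓜 e ⊓ LinearMap.ker f =
      (P₂ ⊓ P₁.comap (LinearMap.lsmul R M a)).restrictScalars K ⊓ 𝓜 e := by
    ext m
    simp only [Submodule.mem_inf, LinearMap.mem_ker, f, LinearMap.comp_apply, A,
      Submodule.mkQ_apply, Submodule.Quotient.mk_eq_zero, Algebra.lsmul_coe,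
      Submodule.restrictScalars_mem, Submodule.mem_comap, LinearMap.lsmul_apply]
    constructor
    · rintro ⟨⟨h1, h2⟩, h3, -⟩
      exact ⟨⟨h1, h3⟩, h2⟩
    · rintro ⟨⟨h1, h3⟩, h2⟩
      exact ⟨⟨h1, h2⟩, h3, hde ▸ hM.smul_mem _ _ _ _ ha h2⟩
  have k2 : Q.restrictScalars K ⊓ 𝓜 d ⊓ LinearMap.ker A.mkQ = A := by
    rw [Submodule.ker_mkQ]
    exact inf_eq_right.2 (inf_le_inf_right _ (le_sup_left (α := Submodule R M)))
  have k3 : (P₂.restrictScalars K ⊓ 𝓜 e).map f =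
      (Q.restrictScalars K ⊓ 𝓜 d).map A.mkQ := by
    apply le_antisymm
    · rintro _ ⟨m, ⟨hm, hme⟩, rfl⟩
      refine ⟨a • m, ⟨?_, hde ▸ hM.smul_mem _ _ _ _ ha hme⟩, rfl⟩
      exact (le_sup_right : _ ≤ Q) ⟨m, hm, rfl⟩
    · rintro _ ⟨q, ⟨hq, hqd⟩, rfl⟩
      obtain ⟨p, hp, _, ⟨m, hm, rfl⟩, rfl⟩ := Submodule.mem_sup.1 hq
      -- In `q = p + a m` of degree `d`, only the degree `e` component of `m` contributes, up to the
      -- degree `d` component of `p`, which dies in the quotient.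
      refine ⟨homComp hM.isInternal e m, ⟨?_, homComp_mem _ _ _⟩, ?_⟩
      · exact (isGradedSubmodule_iff hM.isInternal).1 h₂ m hm e
      · have h3 := homComp_of_mem hM.isInternal hqd
        rw [← h3, map_add, LinearMap.lsmul_apply, homComp_smul hM ha, ← he, map_add]
        have h4 : A.mkQ (homComp hM.isInternal d p) = 0 := by
          rw [Submodule.mkQ_apply, Submodule.Quotient.mk_eq_zero]
          exact ⟨(isGradedSubmodule_iff hM.isInternal).1 h₁ p hp d, homComp_mem _ _ _⟩
        rw [h4, zero_add]
        rfl
  rw [k1, k3] at e1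
  rw [k2] at e2
  have e1' := congrArg (Nat.cast : ℕ → ℚ) e1
  have e2' := congrArg (Nat.cast : ℕ → ℚ) e2
  push_cast at e1' e2'
  simp only [hilbertSeries]
  linarith

/-- The Hilbert series of `P` as a power series, shifted by `s`. -/
def hser (𝓜 : (Fin r → ℤ) → Submodule K M) (s : Fin r → ℤ) (P : Submodule R M) :
    MvPowerSeries (Fin r) ℚ :=
  toSeries s (hilbertSeries 𝓜 P)

theorem coeff_hser (s : Fin r → ℤ) (P : Submodule R M) (n : Fin r →₀ ℕ) :
    MvPowerSeries.coeff n (hser 𝓜 s P) = hilbertSeries 𝓜 P (s + natToInt n) := rfl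

/-- Additivity of dimension along the kernel and cokernel of `a` on `P₂/P₁`. Both are killed by `a`,
which is what drives the Hilbert–Serre induction and the later Noetherian induction. -/
theorem hser_smul (hM : IsGradedModule 𝓡 𝓜) (hfin : ∀ d, Module.Finite K (𝓜 d))
    {s : Fin r → ℤ} (hs : ∀ d, 𝓜 d ≠ ⊥ → s ≤ d)
    {P₁ P₂ : Submodule R M} (h₁ : IsGradedSubmodule 𝓜 P₁) (h₂ : IsGradedSubmodule 𝓜 P₂)
    {δ : Fin r → ℕ} {a : R} (ha : a ∈ 𝓡 δ) :
    ((1 - tpow δ : MvPolynomial (Fin r) ℚ) : MvPowerSeries (Fin r) ℚ) *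
        (hser 𝓜 s P₂ - hser 𝓜 s P₁) =
      (hser 𝓜 s P₂ - hser 𝓜 s (P₁ ⊔ P₂.map (LinearMap.lsmul R M a))) -
        (tpow δ : MvPowerSeries (Fin r) ℚ) *
          (hser 𝓜 s (P₂ ⊓ P₁.comap (LinearMap.lsmul R M a)) - hser 𝓜 s P₁) := by
  have key : hser 𝓜 s (P₁ ⊔ P₂.map (LinearMap.lsmul R M a)) - hser 𝓜 s P₁ =
      (tpow δ : MvPowerSeries (Fin r) ℚ) *
        (hser 𝓜 s P₂ - hser 𝓜 s (P₂ ⊓ P₁.comap (LinearMap.lsmul R M a))) := by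
    ext n
    rw [mul_sub, map_sub, map_sub, hser, hser, hser, hser,
      coeff_tpow_mul_toSeries (le_of_hilbertSeries_ne_zero hs _),
      coeff_tpow_mul_toSeries (le_of_hilbertSeries_ne_zero hs _)]
    exact hilbertSeries_smul hM hfin h₁ h₂ ha _
  have h1 : ((1 - tpow δ : MvPolynomial (Fin r) ℚ) : MvPowerSeries (Fin r) ℚ) =
      1 - (tpow δ : MvPowerSeries (Fin r) ℚ) :=
    (map_sub (MvPolynomial.coeToMvPowerSeries.ringHom (σ := Fin r) (R := ℚ)) 1 (tpow δ)).trans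
      (by rw [map_one]; rfl)
  rw [h1]
  linear_combination key

end HilbertSeries

/-! ### Rationality of Hilbert series -/

section Rationality

variable {K R M : Type*} [Field K] [CommRing R] [Algebra K R]
  [AddCommGroup M] [Module K M] [Module R M] [IsScalarTower K R M] {r : ℕ}
  {𝓡 : (Fin r → ℕ) → Submodule K R} {𝓜 : (Fin r → ℤ) → Submodule K M}

theorem hilbertSeries_congr {P₁ P₂ : Submodule R M} (hle : P₁ ≤ P₂) {d : Fin r → ℤ}
    (h : ∀ p ∈ P₂, p ∈ 𝓜 d → p ∈ P₁) : hilbertSeries 𝓜 P₂ d = hilbertSeries 𝓜 P₁ d := by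
  have h1 : P₂.restrictScalars K ⊓ 𝓜 d = P₁.restrictScalars K ⊓ 𝓜 d :=
    le_antisymm (fun p hp => ⟨h p hp.1 hp.2, hp.2⟩) (inf_le_inf_right _ hle)
  rw [hilbertSeries, hilbertSeries, h1]

theorem finite_homComp_ne_zero (h : DirectSum.IsInternal 𝓜) (m : M) :
    {d | homComp h d m ≠ 0}.Finite := by
  obtain ⟨s, hs⟩ := exists_sum_homComp h m
  refine s.finite_toSet.subset fun d hd => ?_
  by_contra hds
  apply hd
  rw [← hs, map_sum]
  refine Finset.sum_eq_zero fun e he => homComp_of_mem_ne h (homComp_mem h e m) ?_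
  rintro rfl
  exact hds he

theorem finite_homComp_map_ne_bot (h : DirectSum.IsInternal 𝓜) {F : Submodule K M} (hF : F.FG) :
    {d | F.map (homComp h d) ≠ ⊥}.Finite := by
  obtain ⟨X, rfl⟩ := hF
  refine (X.finite_toSet.biUnion fun x _ => finite_homComp_ne_zero h x).subset fun d hd => ?_
  by_contra hdX
  apply hd
  rw [Submodule.map_span, Submodule.span_eq_bot]
  rintro _ ⟨x, hx, rfl⟩
  by_contra hne
  exact hdX (Set.mem_biUnion hx hne)

/-- Homogeneous elements of nonzero degree which generate an ideal of finite codimension. -/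
structure IsIrrelevantSystem (𝓡 : (Fin r → ℕ) → Submodule K R) {ι : Type*} (x : ι → R)
    (δ : ι → Fin r → ℕ) : Prop where
  mem : ∀ i, x i ∈ 𝓡 (δ i)
  ne_zero : ∀ i, δ i ≠ 0
  exists_fg : ∃ F : Submodule K R, F.FG ∧
    F ⊔ (Ideal.span (Set.range x)).restrictScalars K = ⊤

variable {ι : Type*} {x : ι → R} {δ : ι → Fin r → ℕ}

/-- When every `x i` kills `P₂/P₁`, this quotient is a finitely generated module over `R/(x)`, which
is finite dimensional over `K`. The space `F` is spanned by the products of a complementing subspace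
of `R` with finitely many generators of `P₂`. -/
theorem IsIrrelevantSystem.exists_fg_le_sup [IsNoetherian R M] (hx : IsIrrelevantSystem 𝓡 x δ)
    {P₁ P₂ : Submodule R M} (h : ∀ i, ∀ p ∈ P₂, x i • p ∈ P₁) :
    ∃ F : Submodule K M, F.FG ∧ P₂.restrictScalars K ≤ P₁.restrictScalars K ⊔ F := by
  obtain ⟨F₀, hF₀, htop⟩ := hx.exists_fg
  obtain ⟨X, hX⟩ := IsNoetherian.noetherian P₂
  let φ : M → R →ₗ[K] M := fun m => (LinearMap.toSpanSingleton R M m).restrictScalars K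
  refine ⟨⨆ m ∈ X, F₀.map (φ m), Submodule.fg_biSup _ _ fun m _ => hF₀.map _, fun p hp => ?_⟩
  rw [Submodule.restrictScalars_mem, ← hX, Submodule.mem_span_finset] at hp
  obtain ⟨c, -, rfl⟩ := hp
  refine Submodule.sum_mem _ fun m hm => ?_
  have hm₂ : m ∈ P₂ := hX ▸ Submodule.subset_span hm
  have hc : c m ∈ F₀ ⊔ (Ideal.span (Set.range x)).restrictScalars K := htop ▸ Submodule.mem_top
  obtain ⟨b, hb, e, he, hbe⟩ := Submodule.mem_sup.1 hc
  rw [← hbe, add_smul, add_comm]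
  refine Submodule.add_mem_sup ?_ ?_
  · have h1 : Ideal.span (Set.range x) ≤ P₁.comap (LinearMap.toSpanSingleton R M m) := by
      rw [Ideal.span, Submodule.span_le]
      rintro _ ⟨i, rfl⟩
      exact h i m hm₂
    exact h1 he
  · exact Submodule.mem_iSup_of_mem m (Submodule.mem_iSup_of_mem hm ⟨b, hb, rfl⟩)

/-- Modulo a finite-dimensional space, `M_d` is the sum of the `x_i M_{d - δ_i}`. Each `δ_i` is
nonzero, so induction on the total degree of `d - s` applies. -/
theorem IsIrrelevantSystem.finite [IsNoetherian R M] [Finite ι] (hx : IsIrrelevantSystem 𝓡 x δ)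
    (hM : IsGradedModule 𝓡 𝓜) {s : Fin r → ℤ} (hs : ∀ d, 𝓜 d ≠ ⊥ → s ≤ d) (d : Fin r → ℤ) :
    Module.Finite K (𝓜 d) := by
  suffices ∀ k : ℕ, ∀ d : Fin r → ℤ, ∑ i, (d i - s i) < k → Module.Finite K (𝓜 d) by
    exact this ((∑ i, (d i - s i)).toNat + 1) d (by omega)
  have hbot : ∀ d, ¬ s ≤ d → Module.Finite K (𝓜 d) := by
    intro d hd
    have : 𝓜 d = ⊥ := by
      by_contra h
      exact hd (hs d h)
    rw [this]
    infer_instance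
  let Q : Submodule R M := ⨆ i, (⊤ : Submodule R M).map (LinearMap.lsmul R M (x i))
  obtain ⟨F, hF, htop⟩ := hx.exists_fg_le_sup (P₁ := Q) (P₂ := ⊤)
    fun i p _ => Submodule.mem_iSup_of_mem i ⟨p, trivial, rfl⟩
  intro k
  induction k with
  | zero =>
    intro d hd
    refine hbot d fun h => ?_
    have : 0 ≤ ∑ i, (d i - s i) := Finset.sum_nonneg fun i _ => sub_nonneg.2 (h i)
    simp only [Nat.cast_zero] at hd
    omega
  | succ k ih =>
    intro d hd
    let B : Submodule K M := F.map (homComp hM.isInternal d) ⊔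
      ⨆ i, (𝓜 (d - natToInt (δ i))).map (Algebra.lsmul K K M (x i))
    have hfin : ∀ i, Module.Finite K (𝓜 (d - natToInt (δ i))) := by
      intro i
      refine ih _ ?_
      have h1 : 0 < ∑ j, (δ i j : ℤ) := by
        refine Finset.sum_pos' (fun j _ => by positivity) ?_
        obtain ⟨j, hj⟩ := Function.ne_iff.1 (hx.ne_zero i)
        exact ⟨j, Finset.mem_univ _, by simp at hj; omega⟩
      have h2 : ∑ j, ((d - natToInt (δ i)) j - s j) = ∑ j, (d j - s j) - ∑ j, (δ i j : ℤ) := by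
        rw [← Finset.sum_sub_distrib]
        refine Finset.sum_congr rfl fun j _ => ?_
        simp only [Pi.sub_apply, natToInt]
        ring
      rw [h2]
      push_cast at hd
      omega
    have hB : B.FG := by
      refine (hF.map _).sup (Submodule.fg_iSup _ fun i => ?_)
      have := hfin i
      exact (Module.Finite.iff_fg.1 (hfin i)).map _
    have hle : 𝓜 d ≤ B := by
      intro m hm
      obtain ⟨q, hq, f, hf, rfl⟩ := Submodule.mem_sup.1 (htop (x := m) trivial)
      rw [← homComp_of_mem hM.isInternal hm, map_add, add_comm]
      refine Submodule.add_mem_sup ⟨f, hf, rfl⟩ ?_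
      clear hm
      change q ∈ ⨆ i, (⊤ : Submodule R M).map (LinearMap.lsmul R M (x i)) at hq
      induction hq using Submodule.iSup_induction' with
      | mem i q hq =>
        obtain ⟨m, -, rfl⟩ := hq
        rw [LinearMap.lsmul_apply, homComp_smul hM (hx.mem i)]
        exact Submodule.mem_iSup_of_mem i ⟨_, homComp_mem _ _ _, rfl⟩
      | zero => simp
      | add a b _ _ h1 h2 => rw [map_add]; exact Submodule.add_mem _ h1 h2
    have := Module.Finite.iff_fg.2 hB
    exact Submodule.finiteDimensional_of_le hle

/-- Hilbert–Serre for the subquotients `P₂ / P₁` of `M`. -/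
theorem IsIrrelevantSystem.prod_mul_hser_mem [IsNoetherian R M]
    (hx : IsIrrelevantSystem 𝓡 x δ) (hM : IsGradedModule 𝓡 𝓜)
    (hfin : ∀ d, Module.Finite K (𝓜 d)) {s : Fin r → ℤ} (hs : ∀ d, 𝓜 d ≠ ⊥ → s ≤ d)
    (A : Finset ι) {P₁ P₂ : Submodule R M} (hle : P₁ ≤ P₂) (h₁ : IsGradedSubmodule 𝓜 P₁)
    (h₂ : IsGradedSubmodule 𝓜 P₂) (hA : ∀ i ∉ A, ∀ p ∈ P₂, x i • p ∈ P₁) :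
    ((∏ i ∈ A, (1 - tpow (δ i)) : MvPolynomial (Fin r) ℚ) : MvPowerSeries (Fin r) ℚ) *
      (hser 𝓜 s P₂ - hser 𝓜 s P₁) ∈ polys r := by
  classical
  induction A using Finset.induction_on generalizing P₁ P₂ with
  | empty =>
    -- All `x i` kill `P₂/P₁`, so it is finite dimensional and has only finitely many nonzero
    -- degrees.
    rw [Finset.prod_empty, MvPolynomial.coe_one, one_mul, mem_polys_iff_finite]
    obtain ⟨F, hF, hle'⟩ := hx.exists_fg_le_sup fun i => hA i (Finset.notMem_empty i)
    refine Set.Finite.of_finite_image (f := fun n : Fin r →₀ ℕ => s + natToInt n)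
      ((finite_homComp_map_ne_bot hM.isInternal hF).subset ?_)
      fun a _ b _ hab => DFunLike.coe_injective (natToInt_injective (add_left_cancel hab))
    rintro _ ⟨n, hn, rfl⟩ hbot
    apply hn
    rw [map_sub, coeff_hser, coeff_hser, sub_eq_zero]
    refine hilbertSeries_congr hle fun p hp₂ hpd => ?_
    obtain ⟨q, hq, f, hf, hqf⟩ := Submodule.mem_sup.1 (hle' hp₂)
    have hf0 : homComp hM.isInternal (s + natToInt n) f = 0 := by
      rw [← Submodule.mem_bot K, ← hbot]
      exact ⟨f, hf, rfl⟩
    rw [← homComp_of_mem hM.isInternal hpd, ← hqf, map_add, hf0, add_zero]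
    exact (isGradedSubmodule_iff hM.isInternal).1 h₁ q hq _
  | insert i A hi ih =>
    rw [Finset.prod_insert hi, mul_comm (1 - tpow (δ i)), MvPolynomial.coe_mul, mul_assoc,
      hser_smul hM hfin hs h₁ h₂ (hx.mem i), mul_sub, mul_left_comm]
    -- The cokernel and the kernel of `x i` are killed by `x i` as well as by all `x j` that already
    -- killed `P₂/P₁`, so the smaller set `A` suffices for both.
    refine Subring.sub_mem _ (ih ?_ ?_ h₂ ?_) (Subring.mul_mem _ (coe_mem_polys _) (ih ?_ h₁ ?_ ?_))
    · refine sup_le hle ?_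
      rintro _ ⟨p, hp, rfl⟩
      exact P₂.smul_mem _ hp
    · exact h₁.sup hM.isInternal (h₂.map_lsmul hM (hx.mem i))
    · intro j hj p hp
      by_cases hji : j = i
      · subst hji
        exact Submodule.mem_sup_right ⟨p, hp, rfl⟩
      · exact Submodule.mem_sup_left (hA j (by simp [hji, hj]) p hp)
    · exact le_inf hle fun p hp => P₁.smul_mem _ hp
    · exact h₂.inf hM.isInternal (h₁.comap_lsmul hM (hx.mem i))
    · intro j hj p hp
      by_cases hji : j = i
      · subst hji
        exact hp.2
      · exact hA j (by simp [hji, hj]) p hp.1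

end Rationality

/-! ### Denominators of power series -/

section Denominators

variable {r : ℕ}

/-- After the common factor of `D` and `E` is removed, what remains of `D` divides both `b` and `c`,
hence is a unit. Applied to a fraction with denominator `D`, this shows that its clearing
polynomials are closed under gcd. -/
theorem dvd_of_isRelPrime_of_dvd_mul {A : Type*} [CommRing A] [IsDomain A]
    [UniqueFactorizationMonoid A] {D E b c : A} (hD : D ≠ 0) (hbc : IsRelPrime b c)
    (hb : D ∣ E * b) (hc : D ∣ E * c) : D ∣ E := by
  obtain ⟨D', E', h, hrel, rfl, rfl⟩ := UniqueFactorizationMonoid.exists_reduced_factors D hD E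
  have hh : h ≠ 0 := left_ne_zero_of_mul hD
  rw [mul_assoc, mul_dvd_mul_iff_left hh] at hb hc
  have hu : IsUnit D' := hbc (hrel.dvd_of_dvd_mul_left hb) (hrel.dvd_of_dvd_mul_left hc)
  exact mul_dvd_mul_left h (hu.dvd)

/-- Local–global principle for divisibility: a prime factor of the part of `D` not shared with `E`
would have to divide the corresponding `G`. -/
theorem dvd_of_forall_prime {A : Type*} [CommRing A] [IsDomain A]
    [UniqueFactorizationMonoid A] {D E : A} (hD : D ≠ 0)
    (h : ∀ p, Prime p → ∃ G, ¬ p ∣ G ∧ D ∣ G * E) : D ∣ E := by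
  obtain ⟨D', E', c, hrel, rfl, rfl⟩ := UniqueFactorizationMonoid.exists_reduced_factors D hD E
  have hc : c ≠ 0 := left_ne_zero_of_mul hD
  have hD' : D' ≠ 0 := right_ne_zero_of_mul hD
  by_cases hu : IsUnit D'
  · exact mul_dvd_mul_left c (hu.dvd)
  · obtain ⟨p, hp, hpD⟩ := WfDvdMonoid.exists_irreducible_factor hu hD'
    obtain ⟨G, hG, hdvd⟩ := h p (UniqueFactorizationMonoid.irreducible_iff_prime.1 hp)
    rw [mul_left_comm, mul_dvd_mul_iff_left hc] at hdvd
    exact absurd (hpD.trans (hrel.dvd_of_dvd_mul_right hdvd)) hG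

/-- Take `B` minimal for strict divisibility among the nonzero elements of `J`. By `hJ` the gcd of
`B` and any `C` in `J` is again in `J`, so by minimality it is associated to `B`. -/
theorem exists_forall_dvd {A : Type*} [CommRing A] [IsDomain A] [UniqueFactorizationMonoid A]
    {J : A → Prop} {D : A} (hD : D ≠ 0) (hJD : J D)
    (hJ : ∀ g b c, IsRelPrime b c → J (g * b) → J (g * c) → J g) :
    ∃ B, J B ∧ ∀ C, J C → B ∣ C := by
  obtain ⟨B, ⟨hB0, hB⟩, hmin⟩ := WellFounded.has_min (wellFounded_dvdNotUnit (α := A))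
    {B : A | B ≠ 0 ∧ J B} ⟨D, hD, hJD⟩
  refine ⟨B, hB, fun C hC => ?_⟩
  obtain ⟨b, c, g, hrel, rfl, rfl⟩ := UniqueFactorizationMonoid.exists_reduced_factors B hB0 C
  have hg := hJ g b c hrel hB hC
  have hu : IsUnit b := by
    by_contra hb
    exact hmin g ⟨left_ne_zero_of_mul hB0, hg⟩ ⟨left_ne_zero_of_mul hB0, b, hb, rfl⟩
  exact mul_dvd_mul_left g hu.dvd

/-- With `f = A / D`, questions about power series become divisibility questions in the factorial
ring ℚ[t]. -/
theorem coe_mul_mem_polys_iff {D A : MvPolynomial (Fin r) ℚ} (hD : D ≠ 0)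
    {f : MvPowerSeries (Fin r) ℚ} (hDf : (D : MvPowerSeries (Fin r) ℚ) * f = A)
    (F : MvPolynomial (Fin r) ℚ) :
    (F : MvPowerSeries (Fin r) ℚ) * f ∈ polys r ↔ D ∣ F * A := by
  rw [mem_polys_iff]
  refine exists_congr fun q => ?_
  rw [← MvPolynomial.coe_inj, MvPolynomial.coe_mul, MvPolynomial.coe_mul, ← hDf, mul_left_comm,
    mul_right_inj' (MvPolynomial.coe_eq_zero_iff.not.2 hD)]

theorem mem_polys_of_isRelPrime {D : MvPolynomial (Fin r) ℚ} (hD : D ≠ 0)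
    {f : MvPowerSeries (Fin r) ℚ} (hDf : (D : MvPowerSeries (Fin r) ℚ) * f ∈ polys r)
    {g b c : MvPolynomial (Fin r) ℚ} (hbc : IsRelPrime b c)
    (hb : ((g * b : MvPolynomial (Fin r) ℚ) : MvPowerSeries (Fin r) ℚ) * f ∈ polys r)
    (hc : ((g * c : MvPolynomial (Fin r) ℚ) : MvPowerSeries (Fin r) ℚ) * f ∈ polys r) :
    (g : MvPowerSeries (Fin r) ℚ) * f ∈ polys r := by
  obtain ⟨A, hA⟩ := mem_polys_iff.1 hDf
  rw [coe_mul_mem_polys_iff hD hA] at *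
  rw [mul_right_comm] at hb hc
  exact dvd_of_isRelPrime_of_dvd_mul hD hbc hb hc

/-- `X(t) f` is a polynomial up to a denominator prime to `p`. -/
def IsLocalDenom (p X : MvPolynomial (Fin r) ℚ) (f : MvPowerSeries (Fin r) ℚ) : Prop :=
  ∃ G : MvPolynomial (Fin r) ℚ, ¬ p ∣ G ∧
    ((G * X : MvPolynomial (Fin r) ℚ) : MvPowerSeries (Fin r) ℚ) * f ∈ polys r

theorem mem_polys_of_isLocalDenom {D X : MvPolynomial (Fin r) ℚ} (hD : D ≠ 0)
    {f : MvPowerSeries (Fin r) ℚ} (hDf : (D : MvPowerSeries (Fin r) ℚ) * f ∈ polys r)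
    (h : ∀ p, Prime p → IsLocalDenom p X f) : (X : MvPowerSeries (Fin r) ℚ) * f ∈ polys r := by
  obtain ⟨A, hA⟩ := mem_polys_iff.1 hDf
  rw [coe_mul_mem_polys_iff hD hA]
  refine dvd_of_forall_prime hD fun p hp => ?_
  obtain ⟨G, hG, hmem⟩ := h p hp
  rw [coe_mul_mem_polys_iff hD hA, mul_assoc] at hmem
  exact ⟨G, hG, hmem⟩

theorem IsLocalDenom.zero {p X : MvPolynomial (Fin r) ℚ} (hp : Prime p) :
    IsLocalDenom p X 0 :=
  ⟨1, hp.not_dvd_one, by rw [mul_zero]; exact Subring.zero_mem _⟩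

theorem IsLocalDenom.add {p X : MvPolynomial (Fin r) ℚ} (hp : Prime p)
    {f g : MvPowerSeries (Fin r) ℚ} (hf : IsLocalDenom p X f) (hg : IsLocalDenom p X g) :
    IsLocalDenom p X (f + g) := by
  obtain ⟨F, hF, hf⟩ := hf
  obtain ⟨G, hG, hg⟩ := hg
  refine ⟨F * G, hp.not_dvd_mul hF hG, ?_⟩
  have h1 := Subring.add_mem _ (Subring.mul_mem _ (coe_mem_polys G) hf)
    (Subring.mul_mem _ (coe_mem_polys F) hg)
  convert h1 using 1
  simp only [MvPolynomial.coe_mul]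
  ring

theorem IsLocalDenom.coe_mul {p X : MvPolynomial (Fin r) ℚ}
    {f : MvPowerSeries (Fin r) ℚ} (hf : IsLocalDenom p X f) (q : MvPolynomial (Fin r) ℚ) :
    IsLocalDenom p X ((q : MvPowerSeries (Fin r) ℚ) * f) := by
  obtain ⟨F, hF, hf⟩ := hf
  refine ⟨F, hF, ?_⟩
  rw [mul_left_comm]
  exact Subring.mul_mem _ (coe_mem_polys q) hf

theorem IsLocalDenom.sub {p X : MvPolynomial (Fin r) ℚ} (hp : Prime p)
    {f g : MvPowerSeries (Fin r) ℚ} (hf : IsLocalDenom p X f) (hg : IsLocalDenom p X g) :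
    IsLocalDenom p X (f - g) := by
  have h1 := hf.add hp (hg.coe_mul (-1))
  rwa [← MvPolynomial.coeToMvPowerSeries.ringHom_apply, map_neg, map_one, neg_one_mul,
    ← sub_eq_add_neg] at h1

theorem IsLocalDenom.of_coe_mul {p X : MvPolynomial (Fin r) ℚ} (hp : Prime p)
    {f : MvPowerSeries (Fin r) ℚ} {q : MvPolynomial (Fin r) ℚ} (hq : ¬ p ∣ q)
    (hf : IsLocalDenom p X ((q : MvPowerSeries (Fin r) ℚ) * f)) : IsLocalDenom p X f := by
  obtain ⟨F, hF, hf⟩ := hf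
  refine ⟨F * q, hp.not_dvd_mul hF hq, ?_⟩
  rwa [mul_right_comm, MvPolynomial.coe_mul, mul_assoc]

/-- The prime factors of `t^n` are variables, and no variable divides a polynomial with nonzero
constant term. -/
theorem isRelPrime_tpow {g : MvPolynomial (Fin r) ℚ} (hg : MvPolynomial.constantCoeff g ≠ 0)
    (n : Fin r → ℕ) : IsRelPrime g (tpow n) := by
  rw [tpow, ← MvPolynomial.prod_X_pow_eq_monomial]
  refine IsRelPrime.prod_right fun i _ => IsRelPrime.pow_right (IsRelPrime.symm ?_)
  rw [(MvPolynomial.X_prime (R := ℚ) (i := i)).irreducible.isRelPrime_iff_not_dvd]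
  rintro ⟨c, rfl⟩
  exact hg (by rw [map_mul, MvPolynomial.constantCoeff_X, zero_mul])

end Denominators

/-! ### Existence of the universal denominator -/

section Existence

variable {K R M : Type*} [Field K] [CommRing R] [Algebra K R]
  [AddCommGroup M] [Module K M] [Module R M] [IsScalarTower K R M] {r : ℕ}

/-- `M = ⨁ M_d` is a graded module over `R = ⨁ R_d` with finite dimensional components in degrees
`≥ s`, and `x` is an irrelevant system of `R`. -/
structure IsFiniteGraded (𝓡 : (Fin r → ℕ) → Submodule K R) (𝓜 : (Fin r → ℤ) → Submodule K M)
    (s : Fin r → ℤ) {ι : Type*} (x : ι → R) (δ : ι → Fin r → ℕ) : Prop where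
  graded : IsGradedModule 𝓡 𝓜
  iSup_eq_top : iSup 𝓡 = ⊤
  irrelevant : IsIrrelevantSystem 𝓡 x δ
  finite : ∀ d, Module.Finite K (𝓜 d)
  lower : ∀ d, 𝓜 d ≠ ⊥ → s ≤ d

variable {𝓡 : (Fin r → ℕ) → Submodule K R} {𝓜 : (Fin r → ℤ) → Submodule K M}
  {s : Fin r → ℤ} {ι : Type*} {x : ι → R} {δ : ι → Fin r → ℕ}

theorem IsIrrelevantSystem.exists_isFiniteGraded [IsNoetherian R M] [Finite ι]
    (hx : IsIrrelevantSystem 𝓡 x δ) (hM : IsGradedModule 𝓡 𝓜) (h𝓡 : iSup 𝓡 = ⊤) :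
    ∃ s, IsFiniteGraded 𝓡 𝓜 s x δ := by
  obtain ⟨s, hs⟩ := exists_lower_bound hM h𝓡
  exact ⟨s, hM, h𝓡, hx, hx.finite hM hs, hs⟩

theorem isCommonDenom_iff (hs : ∀ d, 𝓜 d ≠ ⊥ → s ≤ d) (B : MvPolynomial (Fin r) ℚ) :
    IsCommonDenom R 𝓜 B ↔ MvPolynomial.constantCoeff B = 1 ∧
      ∀ P : Submodule R M, IsGradedSubmodule 𝓜 P →
        (B : MvPowerSeries (Fin r) ℚ) * hser 𝓜 s P ∈ polys r := by
  refine and_congr_right fun _ => forall₂_congr fun P _ => ?_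
  exact isLaurentPolynomial_polyMul_iff (le_of_hilbertSeries_ne_zero hs P) B

theorem hser_bot (s : Fin r → ℤ) : hser 𝓜 s (⊥ : Submodule R M) = 0 := by
  ext n
  rw [coeff_hser, hilbertSeries, map_zero, Nat.cast_eq_zero, Submodule.restrictScalars_bot,
    bot_inf_eq, finrank_bot]

theorem constantCoeff_prod_one_sub_tpow (hδ : ∀ i, δ i ≠ 0) (A : Finset ι) :
    MvPolynomial.constantCoeff (∏ i ∈ A, (1 - tpow (δ i)) : MvPolynomial (Fin r) ℚ) = 1 := by
  rw [map_prod]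
  refine Finset.prod_eq_one fun i _ => ?_
  rw [map_sub, map_one, constantCoeff_tpow (hδ i), sub_zero]

theorem ne_zero_of_constantCoeff {B : MvPolynomial (Fin r) ℚ}
    (hB : MvPolynomial.constantCoeff B = 1) : B ≠ 0 := by
  rintro rfl
  simp at hB

theorem IsFiniteGraded.exists_common [IsNoetherian R M] [Finite ι]
    (h : IsFiniteGraded 𝓡 𝓜 s x δ) :
    ∃ D : MvPolynomial (Fin r) ℚ, MvPolynomial.constantCoeff D = 1 ∧
      ∀ P₁ P₂ : Submodule R M, P₁ ≤ P₂ → IsGradedSubmodule 𝓜 P₁ → IsGradedSubmodule 𝓜 P₂ →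
        (D : MvPowerSeries (Fin r) ℚ) * (hser 𝓜 s P₂ - hser 𝓜 s P₁) ∈ polys r := by
  have := Fintype.ofFinite ι
  exact ⟨_, constantCoeff_prod_one_sub_tpow h.irrelevant.ne_zero Finset.univ,
    fun P₁ P₂ hle h₁ h₂ => h.irrelevant.prod_mul_hser_mem h.graded h.finite h.lower Finset.univ
      hle h₁ h₂ fun i hi => absurd (Finset.mem_univ i) hi⟩

theorem IsFiniteGraded.exists_isUDenom [IsNoetherian R M] [Finite ι]
    (h : IsFiniteGraded 𝓡 𝓜 s x δ) : ∃ B, IsUDenom R 𝓜 B := by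
  obtain ⟨D, hD1, hD⟩ := h.exists_common
  have hD0 := ne_zero_of_constantCoeff hD1
  have hDP : ∀ P : Submodule R M, IsGradedSubmodule 𝓜 P →
      (D : MvPowerSeries (Fin r) ℚ) * hser 𝓜 s P ∈ polys r := by
    intro P hP
    have h1 := hD ⊥ P bot_le (IsGradedSubmodule.bot h.graded.isInternal) hP
    rwa [hser_bot, sub_zero] at h1
  obtain ⟨B, hB, hmin⟩ := exists_forall_dvd (J := fun B : MvPolynomial (Fin r) ℚ =>
    ∀ P : Submodule R M, IsGradedSubmodule 𝓜 P →
      (B : MvPowerSeries (Fin r) ℚ) * hser 𝓜 s P ∈ polys r) hD0 hDP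
    fun g b c hbc hb hc P hP => mem_polys_of_isRelPrime hD0 (hDP P hP) hbc (hb P hP) (hc P hP)
  -- `B` divides the Hilbert–Serre denominator `D`, whose constant term is 1; so `B` can be rescaled
  -- to constant term 1.
  have hB0 : MvPolynomial.constantCoeff B ≠ 0 := by
    obtain ⟨q, rfl⟩ := hmin D hDP
    rw [map_mul] at hD1
    exact left_ne_zero_of_mul_eq_one hD1
  refine ⟨MvPolynomial.C (MvPolynomial.constantCoeff B)⁻¹ * B, ?_, fun C hC => ?_⟩
  · rw [isCommonDenom_iff h.lower]
    refine ⟨?_, fun P hP => ?_⟩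
    · rw [map_mul, MvPolynomial.constantCoeff_C, inv_mul_cancel₀ hB0]
    · rw [MvPolynomial.coe_mul, mul_assoc]
      exact Subring.mul_mem _ (coe_mem_polys _) (hB P hP)
  · have hu : IsUnit (MvPolynomial.C (σ := Fin r) (MvPolynomial.constantCoeff B)⁻¹) :=
      (IsUnit.mk0 _ (inv_ne_zero hB0)).map MvPolynomial.C
    exact (hu.mul_left_dvd).2 (hmin C ((isCommonDenom_iff h.lower C).1 hC).2)

/-- The graded submodule obtained by omitting a component of minimal total degree. -/
theorem IsFiniteGraded.exists_hser_top_sub [Nontrivial M] (h : IsFiniteGraded 𝓡 𝓜 s x δ) :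
    ∃ (P : Submodule R M) (n : Fin r → ℕ) (c : ℚ), IsGradedSubmodule 𝓜 P ∧ c ≠ 0 ∧
      hser 𝓜 s (⊤ : Submodule R M) - hser 𝓜 s P =
        (MvPolynomial.C c * tpow n : MvPolynomial (Fin r) ℚ) := by
  have hne : ∃ d, 𝓜 d ≠ ⊥ := by
    by_contra! hbot
    obtain ⟨m, hm⟩ := exists_ne (0 : M)
    apply hm
    rw [← Submodule.mem_bot K]
    refine mem_of_homComp_mem h.graded.isInternal fun d => ?_
    rw [← hbot d]
    exact homComp_mem _ _ _
  obtain ⟨d₀, hd₀, hmin⟩ := (measure fun d : Fin r → ℤ => (∑ i, (d i - s i)).toNat).wf.has_min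
    {d | 𝓜 d ≠ ⊥} hne
  -- By minimality of the total degree of `d₀`, nothing of degree other than `d₀` can be multiplied
  -- into degree `d₀`. Hence the submodule generated by the other components has no part in degree
  -- `d₀`.
  have hmin' : ∀ δ : Fin r → ℕ, δ ≠ 0 → 𝓜 (d₀ - natToInt δ) = ⊥ := by
    intro δ hδ
    by_contra hne
    refine hmin _ hne ?_
    have h1 : 0 < ∑ j, (δ j : ℤ) := by
      refine Finset.sum_pos' (fun j _ => by positivity) ?_
      obtain ⟨j, hj⟩ := Function.ne_iff.1 hδ
      exact ⟨j, Finset.mem_univ _, by simp at hj; omega⟩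
    have h2 : ∑ j, ((d₀ - natToInt δ) j - s j) = ∑ j, (d₀ j - s j) - ∑ j, (δ j : ℤ) := by
      rw [← Finset.sum_sub_distrib]
      refine Finset.sum_congr rfl fun j _ => ?_
      simp only [Pi.sub_apply, natToInt]
      ring
    have h3 : 0 ≤ ∑ j, ((d₀ - natToInt δ) j - s j) :=
      Finset.sum_nonneg fun j _ => sub_nonneg.2 (h.lower _ hne j)
    change (∑ j, ((d₀ - natToInt δ) j - s j)).toNat < (∑ j, (d₀ j - s j)).toNat
    omega
  let P : Submodule R M := Submodule.span R {m | ∃ d, d ≠ d₀ ∧ m ∈ 𝓜 d}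
  have hP : IsGradedSubmodule 𝓜 P := isGradedSubmodule_span h.graded h.iSup_eq_top
    fun m ⟨d, _, hd⟩ => ⟨d, hd⟩
  have hP0 : ∀ m ∈ P, homComp h.graded.isInternal d₀ m = 0 := by
    intro m hm
    induction hm using Submodule.span_induction with
    | mem m hm => obtain ⟨d, hd, hm⟩ := hm; exact homComp_of_mem_ne _ hm hd
    | zero => simp
    | add m m' _ _ h1 h2 => rw [map_add, h1, h2, add_zero]
    | smul a m _ hm =>
      have ha : a ∈ iSup 𝓡 := h.iSup_eq_top ▸ Submodule.mem_top
      induction ha using Submodule.iSup_induction' with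
      | mem δ a ha =>
        rw [homComp_smul h.graded ha]
        by_cases hδ : δ = 0
        · have h0 : natToInt (0 : Fin r → ℕ) = 0 := by funext i; simp [natToInt]
          rw [hδ, h0, sub_zero, hm, smul_zero]
        · have h1 := homComp_mem h.graded.isInternal (d₀ - natToInt δ) m
          rw [hmin' δ hδ, Submodule.mem_bot] at h1
          rw [h1, smul_zero]
      | zero => simp
      | add a b _ _ h1 h2 => rw [add_smul, map_add, h1, h2, add_zero]
  obtain ⟨n, hn⟩ := exists_eq_add_natToInt (h.lower _ hd₀)
  refine ⟨P, n, Module.finrank K (𝓜 d₀), hP, ?_, ?_⟩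
  · have := h.finite d₀
    rw [Nat.cast_ne_zero, Ne, Submodule.finrank_eq_zero]
    exact hd₀
  · ext k
    have hn' : Finsupp.equivFunOnFinite.symm (n : Fin r → ℕ) = n := by ext; simp
    rw [map_sub, coeff_hser, coeff_hser, MvPolynomial.coeff_coe, MvPolynomial.coeff_C_mul, tpow,
      MvPolynomial.coeff_monomial, hn']
    split_ifs with hnk
    · subst hnk
      rw [← hn, hilbertSeries, hilbertSeries, Submodule.restrictScalars_top, top_inf_eq, mul_one]
      have hbot : P.restrictScalars K ⊓ 𝓜 d₀ = ⊥ := by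
        rw [eq_bot_iff]
        rintro m ⟨hm, hmd⟩
        rw [Submodule.mem_bot, ← homComp_of_mem h.graded.isInternal hmd]
        exact hP0 m hm
      rw [hbot, finrank_bot, Nat.cast_zero, sub_zero]
    · rw [mul_zero, sub_eq_zero]
      refine hilbertSeries_congr le_top fun m _ hm => Submodule.subset_span ⟨_, ?_, hm⟩
      intro heq
      rw [hn] at heq
      exact hnk (DFunLike.coe_injective (natToInt_injective (add_left_cancel heq))).symm

/-- The numerators `B(t) H(P, t)` have no common divisor, for `B` the universal denominator. -/
theorem IsFiniteGraded.dvd_of_forall_dvd_mul [Nontrivial M] (h : IsFiniteGraded 𝓡 𝓜 s x δ)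
    {B Z X : MvPolynomial (Fin r) ℚ} (hB : IsUDenom R 𝓜 B)
    (hZ : MvPolynomial.constantCoeff Z = 1)
    (hdvd : ∀ P : Submodule R M, IsGradedSubmodule 𝓜 P → ∀ a : MvPolynomial (Fin r) ℚ,
      (B : MvPowerSeries (Fin r) ℚ) * hser 𝓜 s P = a → Z ∣ X * a) : Z ∣ X := by
  obtain ⟨hB1, hBP⟩ := (isCommonDenom_iff h.lower B).1 hB.1
  obtain ⟨g, X', c, hrel, rfl, rfl⟩ := UniqueFactorizationMonoid.exists_reduced_factors Z
    (ne_zero_of_constantCoeff hZ) X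
  have hc : c ≠ 0 := left_ne_zero_of_mul (ne_zero_of_constantCoeff hZ)
  have hg0 : MvPolynomial.constantCoeff g ≠ 0 := by
    rw [map_mul] at hZ
    exact right_ne_zero_of_mul_eq_one hZ
  have hga : ∀ P : Submodule R M, IsGradedSubmodule 𝓜 P → ∀ a : MvPolynomial (Fin r) ℚ,
      (B : MvPowerSeries (Fin r) ℚ) * hser 𝓜 s P = a → g ∣ a := by
    intro P hP a ha
    have h1 := hdvd P hP a ha
    rw [mul_assoc, mul_dvd_mul_iff_left hc] at h1
    exact hrel.dvd_of_dvd_mul_left h1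
  -- `g` divides the numerators of `M` and of the submodule that omits one component. Their
  -- difference is `B` times a nonzero multiple of a monomial, and `g` is coprime to monomials.
  have hgB : g ∣ B := by
    obtain ⟨P, n, k, hP, hk, hsub⟩ := h.exists_hser_top_sub
    have htop := IsGradedSubmodule.top (R := R) h.graded.isInternal
    obtain ⟨a, ha⟩ := mem_polys_iff.1 (hBP _ htop)
    obtain ⟨b, hb⟩ := mem_polys_iff.1 (hBP _ hP)
    have h1 : a - b = B * (MvPolynomial.C k * tpow n) := by
      rw [← MvPolynomial.coe_inj, MvPolynomial.coe_mul, ← hsub, mul_sub, ha, hb]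
      exact map_sub (MvPolynomial.coeToMvPowerSeries.ringHom (σ := Fin r) (R := ℚ)) a b
    have h2 : g ∣ B * (MvPolynomial.C k * tpow n) :=
      h1 ▸ dvd_sub (hga _ htop a ha) (hga _ hP b hb)
    rw [← mul_assoc] at h2
    have h3 := (isRelPrime_tpow hg0 n).dvd_of_dvd_mul_right h2
    have hu : IsUnit (MvPolynomial.C (σ := Fin r) k) := (IsUnit.mk0 _ hk).map MvPolynomial.C
    exact hu.dvd_mul_right.1 h3
  obtain ⟨B', hB'⟩ := hgB
  have hgg : g ≠ 0 := by rintro rfl; simp at hg0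
  -- Since `g` divides `B` and all numerators, `B / g`, normalised to constant term 1, is still a
  -- common denominator. Minimality of `B` makes `g` a unit.
  have h4 : IsCommonDenom R 𝓜 (MvPolynomial.C (MvPolynomial.constantCoeff g) * B') := by
    rw [isCommonDenom_iff h.lower]
    refine ⟨?_, fun P hP => ?_⟩
    · rw [map_mul, MvPolynomial.constantCoeff_C, ← map_mul, ← hB', hB1]
    · rw [MvPolynomial.coe_mul, mul_assoc]
      refine Subring.mul_mem _ (coe_mem_polys _) ?_
      obtain ⟨a, ha⟩ := mem_polys_iff.1 (hBP _ hP)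
      obtain ⟨a', rfl⟩ := hga P hP a ha
      rw [hB', MvPolynomial.coe_mul, MvPolynomial.coe_mul, mul_assoc,
        mul_right_inj' (MvPolynomial.coe_eq_zero_iff.not.2 hgg)] at ha
      exact mem_polys_iff.2 ⟨a', ha⟩
  have h5 := hB.2 _ h4
  have hu : IsUnit (MvPolynomial.C (σ := Fin r) (MvPolynomial.constantCoeff g)) :=
    (IsUnit.mk0 _ hg0).map MvPolynomial.C
  rw [hu.dvd_mul_left, hB'] at h5
  have hB'0 : B' ≠ 0 := by
    rintro rfl
    rw [mul_zero] at hB'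
    exact ne_zero_of_constantCoeff hB1 hB'
  have h6 : g * B' ∣ 1 * B' := by rwa [one_mul]
  exact mul_dvd_mul_left c ((isUnit_of_dvd_one ((mul_dvd_mul_iff_right hB'0).1 h6)).dvd)

end Existence

/-! ### Comparison of poles of power series in one variable -/

section Growth

open PowerSeries

theorem coeff_mul_nonneg {f g : PowerSeries ℚ} (hf : ∀ n, 0 ≤ coeff n f)
    (hg : ∀ n, 0 ≤ coeff n g) (n : ℕ) : 0 ≤ coeff n (f * g) := by
  rw [coeff_mul]
  exact Finset.sum_nonneg fun p _ => mul_nonneg (hf _) (hg _)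

theorem coeff_pow_nonneg {f : PowerSeries ℚ} (hf : ∀ n, 0 ≤ coeff n f) (k n : ℕ) :
    0 ≤ coeff n (f ^ k) := by
  induction k generalizing n with
  | zero => rw [pow_zero, coeff_one]; split_ifs <;> norm_num
  | succ k ih => rw [pow_succ]; exact coeff_mul_nonneg ih hf n

theorem coeff_invOneSubPow_nonneg (d n : ℕ) : 0 ≤ coeff n (invOneSubPow ℚ d).val := by
  cases d with
  | zero => rw [invOneSubPow_zero, Units.val_one, coeff_one]; split_ifs <;> norm_num
  | succ d => rw [invOneSubPow_val_succ_eq_mk_add_choose, coeff_mk]; positivity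

/-- If `0 ≤ f ≤ g` coefficientwise, then the pole of `f` at `1` is at most that of `g`. -/
theorem pow_rootMultiplicity_dvd_of_coeff_le {f g : PowerSeries ℚ} (hf : ∀ n, 0 ≤ coeff n f)
    (hfg : ∀ n, coeff n f ≤ coeff n g) {p q : Polynomial ℚ} {n k : ℕ}
    (hp : (1 - X ^ n) ^ k * f = (p : PowerSeries ℚ))
    (hq : (1 - X ^ n) ^ k * g = (q : PowerSeries ℚ)) (hq0 : q ≠ 0) :
    (Polynomial.X - Polynomial.C 1) ^ q.rootMultiplicity 1 ∣ p := by
  by_cases hp0 : p = 0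
  · rw [hp0]; exact dvd_zero _
  rw [← Polynomial.le_rootMultiplicity_iff hp0]
  by_contra! hlt
  set μ := q.rootMultiplicity 1
  -- Multiplication by `U` preserves coefficientwise inequalities and turns the denominator `(1 -
  -- X^n)^k` into `(1 - X)^(k + μ + 1)`, for which coefficients are eventually polynomial. The extra
  -- `μ + 1` makes the exponent exceed both root multiplicities, as the degree formula for
  -- `hilbertPoly` requires.
  let U : PowerSeries ℚ := (∑ j ∈ Finset.range n, X ^ j) ^ k * (invOneSubPow ℚ (μ + 1)).val
  have hU : ∀ j, 0 ≤ coeff j U := by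
    refine coeff_mul_nonneg (coeff_pow_nonneg (fun j => ?_) k) (coeff_invOneSubPow_nonneg _)
    rw [map_sum]
    refine Finset.sum_nonneg fun i _ => ?_
    rw [coeff_X_pow]
    split_ifs <;> norm_num
  have hUf : ∀ {f : PowerSeries ℚ} {p : Polynomial ℚ},
      (1 - X ^ n) ^ k * f = (p : PowerSeries ℚ) →
        U * f = (p : PowerSeries ℚ) * (invOneSubPow ℚ (k + (μ + 1))).val := by
    intro f p hp
    have h1 : (1 - X : PowerSeries ℚ) ^ k * (invOneSubPow ℚ k).val = 1 := by
      rw [← invOneSubPow_inv_eq_one_sub_pow]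
      exact (invOneSubPow ℚ k).inv_val
    have h2 : (∑ j ∈ Finset.range n, (X : PowerSeries ℚ) ^ j) * (1 - X) = 1 - X ^ n :=
      geom_sum_mul_neg _ _
    rw [← hp, ← h2, invOneSubPow_add, Units.val_mul, mul_pow]
    linear_combination (-(∑ j ∈ Finset.range n, (X : PowerSeries ℚ) ^ j) ^ k *
      (invOneSubPow ℚ (μ + 1)).val * f) * h1
  set N := k + (μ + 1) with hN
  have hle : ∀ᶠ j : ℕ in Filter.atTop, 0 ≤ (p.hilbertPoly N).eval (j : ℚ) ∧
      (p.hilbertPoly N).eval (j : ℚ) ≤ (q.hilbertPoly N).eval (j : ℚ) := by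
    filter_upwards [Filter.eventually_gt_atTop p.natDegree,
      Filter.eventually_gt_atTop q.natDegree] with j hjp hjq
    rw [← Polynomial.coeff_mul_invOneSubPow_eq_hilbertPoly_eval N hjp,
      ← Polynomial.coeff_mul_invOneSubPow_eq_hilbertPoly_eval N hjq, ← hUf hp, ← hUf hq]
    refine ⟨coeff_mul_nonneg hU hf j, ?_⟩
    rw [← sub_nonneg, ← map_sub, ← mul_sub]
    exact coeff_mul_nonneg hU (fun i => by rw [map_sub, sub_nonneg]; exact hfg i) j
  have hdp := Polynomial.natDegree_hilbertPoly_of_ne_zero_of_rootMultiplicity_lt (d := N) hp0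
    (by omega)
  have hdq := Polynomial.natDegree_hilbertPoly_of_ne_zero_of_rootMultiplicity_lt (d := N) hq0
    (by omega)
  -- A smaller root multiplicity at 1 means a pole of higher order and faster growth. Then the
  -- quotient of the two Hilbert polynomials tends to 0, although it is eventually at least 1.
  have hdeg : (q.hilbertPoly N).degree < (p.hilbertPoly N).degree := by
    refine Polynomial.degree_lt_degree ?_
    rw [hdp, hdq]
    omega
  have hne : p.hilbertPoly N ≠ 0 := Polynomial.ne_zero_of_degree_gt hdeg
  have hlim := (Polynomial.div_tendsto_atTop_zero_of_degree_lt _ _ hdeg).comp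
    (tendsto_natCast_atTop_atTop (R := ℚ))
  have hroot := (tendsto_natCast_atTop_atTop (R := ℚ)).eventually
    (Polynomial.eventually_atTop_not_isRoot _ hne)
  refine absurd (ge_of_tendsto hlim (b := (1 : ℚ)) ?_) (by norm_num)
  filter_upwards [hle, hroot] with j hj hj'
  exact (one_le_div (lt_of_le_of_ne hj.1 (Ne.symm hj'))).2 hj.2

end Growth

/-! ### Prime divisors of `1 - t^a` -/

section PrimeDivisors

variable {r : ℕ}

/-- The Euler derivation `∑ w_i t_i ∂/∂t_i`. -/
def euler (w : Fin r → ℚ) : Derivation ℚ (MvPolynomial (Fin r) ℚ) (MvPolynomial (Fin r) ℚ) :=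
  ∑ i, (MvPolynomial.C (w i) * MvPolynomial.X i : MvPolynomial (Fin r) ℚ) • MvPolynomial.pderiv i

theorem euler_monomial (w : Fin r → ℚ) (e : Fin r →₀ ℕ) (a : ℚ) :
    euler w (MvPolynomial.monomial e a) =
      MvPolynomial.C (∑ i, w i * e i) * MvPolynomial.monomial e a := by
  have h : ∀ S : Finset (Fin r), (∑ i ∈ S, (MvPolynomial.C (w i) * MvPolynomial.X i :
      MvPolynomial (Fin r) ℚ) • MvPolynomial.pderiv i) (MvPolynomial.monomial e a) =
      ∑ i ∈ S, ((MvPolynomial.C (w i) * MvPolynomial.X i : MvPolynomial (Fin r) ℚ) •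
        MvPolynomial.pderiv (R := ℚ) i) (MvPolynomial.monomial e a) := fun S =>
    map_sum ((Pi.evalAddMonoidHom _ (MvPolynomial.monomial e a)).comp
      Derivation.coeFnAddMonoidHom) _ S
  rw [euler, h, map_sum, Finset.sum_mul]
  refine Finset.sum_congr rfl fun i _ => ?_
  rw [Derivation.smul_apply, smul_eq_mul, mul_assoc, MvPolynomial.X_mul_pderiv_monomial, map_mul,
    mul_assoc, nsmul_eq_mul]
  simp

theorem coeff_euler (w : Fin r → ℚ) (p : MvPolynomial (Fin r) ℚ) (e : Fin r →₀ ℕ) :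
    MvPolynomial.coeff e (euler w p) = (∑ i, w i * e i) * MvPolynomial.coeff e p := by
  induction p using MvPolynomial.induction_on' with
  | monomial u a =>
    rw [euler_monomial, MvPolynomial.coeff_C_mul, MvPolynomial.coeff_monomial]
    split_ifs with h
    · rw [h]
    · rw [mul_zero, mul_zero]
  | add p q hp hq => rw [map_add, MvPolynomial.coeff_add, hp, hq, MvPolynomial.coeff_add, mul_add]

theorem euler_tpow (w : Fin r → ℚ) (a : Fin r → ℕ) :
    euler w (tpow a) = MvPolynomial.C (∑ i, w i * a i) * tpow a := by
  rw [tpow, euler_monomial]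
  rfl

theorem not_dvd_tpow_of_dvd {p : MvPolynomial (Fin r) ℚ} (hp : Prime p) {a : Fin r → ℕ}
    (ha : p ∣ 1 - tpow a) (ha0 : a ≠ 0) (n : Fin r → ℕ) : ¬ p ∣ tpow n := by
  intro h
  refine hp.not_isUnit (isRelPrime_tpow ?_ n dvd_rfl h)
  obtain ⟨q, hq⟩ := ha
  have h1 := congrArg MvPolynomial.constantCoeff hq
  rw [map_sub, map_one, constantCoeff_tpow ha0, sub_zero, map_mul] at h1
  exact left_ne_zero_of_mul_eq_one h1.symm

theorem isUnit_C {k : ℚ} (hk : k ≠ 0) : IsUnit (MvPolynomial.C k : MvPolynomial (Fin r) ℚ) :=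
  (IsUnit.mk0 _ hk).map MvPolynomial.C

/-- A factor of a polynomial homogeneous of weight 0 for `w` is itself homogeneous, and the nonzero
constant term of `p` forces its weight to be 0. In the proof the Euler derivation of weight `w`
kills `1 - t^a` and hence preserves the ideal of its simple factor `p`. -/
theorem weight_eq_zero_of_prime_dvd {p : MvPolynomial (Fin r) ℚ} (hp : Prime p)
    {a : Fin r → ℕ} (ha : p ∣ 1 - tpow a) (ha0 : a ≠ 0) {w : Fin r → ℚ}
    (hw : ∑ i, w i * a i = 0) {e : Fin r →₀ ℕ} (he : e ∈ p.support) : ∑ i, w i * e i = 0 := by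
  have hpa : ∀ n, ¬ p ∣ tpow n := not_dvd_tpow_of_dvd hp ha ha0
  obtain ⟨q, hq⟩ := ha
  -- `1 - t^a` is squarefree: a square factor `p^2` would make `p` divide its Euler derivative of
  -- weight `a`, a nonzero constant times `t^a`.
  have hpq : ¬ p ∣ q := by
    rintro ⟨c, rfl⟩
    have h1 := congrArg (euler fun i => (a i : ℚ)) hq
    rw [map_sub, Derivation.map_one_eq_zero, zero_sub, euler_tpow, Derivation.leibniz,
      Derivation.leibniz, smul_eq_mul, smul_eq_mul, smul_eq_mul, smul_eq_mul] at h1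
    have h2 : p ∣ MvPolynomial.C (∑ i, (a i : ℚ) * a i) * tpow a :=
      ⟨-(p * euler (fun i => (a i : ℚ)) c + c * euler (fun i => (a i : ℚ)) p +
        c * euler (fun i => (a i : ℚ)) p), by linear_combination -h1⟩
    rcases hp.dvd_or_dvd h2 with h3 | h3
    · refine hp.not_isUnit (isUnit_of_dvd_unit h3 (isUnit_C (ne_of_gt ?_)))
      obtain ⟨i, hi⟩ := Function.ne_iff.1 ha0
      refine Finset.sum_pos' (fun j _ => by positivity) ⟨i, Finset.mem_univ _, ?_⟩
      have : (a i : ℚ) ≠ 0 := by exact_mod_cast hi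
      positivity
    · exact hpa a h3
  have h1 := congrArg (euler w) hq
  rw [map_sub, Derivation.map_one_eq_zero, zero_sub, euler_tpow, Derivation.leibniz,
    smul_eq_mul, smul_eq_mul, hw, map_zero, zero_mul, neg_zero] at h1
  have h2 : p ∣ q * euler w p := ⟨-euler w q, by linear_combination -h1⟩
  obtain ⟨c, hc⟩ := (hp.dvd_or_dvd h2).resolve_left hpq
  -- `euler w p` is a multiple of `p` of no larger degree, hence a constant multiple. Comparing
  -- constant terms, which `euler` kills but which is nonzero in `p`, gives the constant 0.
  have hzero : euler w p = 0 := by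
    by_contra hne
    have hc0 : c ≠ 0 := by
      rintro rfl
      exact hne (by rw [hc, mul_zero])
    have hdeg : (euler w p).totalDegree ≤ p.totalDegree := by
      refine Finset.sup_mono fun d hd => ?_
      rw [MvPolynomial.mem_support_iff, coeff_euler] at hd
      rw [MvPolynomial.mem_support_iff]
      exact right_ne_zero_of_mul hd
    rw [hc, MvPolynomial.totalDegree_mul_of_isDomain hp.ne_zero hc0] at hdeg
    have hc1 := MvPolynomial.totalDegree_eq_zero_iff_eq_C.1
      (show c.totalDegree = 0 by omega)
    have h3 := congrArg (MvPolynomial.coeff 0) hc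
    rw [coeff_euler, hc1, mul_comm p, MvPolynomial.coeff_C_mul] at h3
    have h4 : MvPolynomial.coeff 0 p ≠ 0 := by
      have h5 := congrArg MvPolynomial.constantCoeff hq
      rw [map_sub, map_one, constantCoeff_tpow ha0, sub_zero, map_mul] at h5
      exact left_ne_zero_of_mul_eq_one h5.symm
    simp only [Finsupp.coe_zero, Pi.zero_apply, Nat.cast_zero, mul_zero, Finset.sum_const_zero,
      zero_mul] at h3
    rw [zero_eq_mul] at h3
    apply hc0
    rw [hc1, h3.resolve_right h4, map_zero]
  have h5 := coeff_euler w p e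
  rw [hzero, MvPolynomial.coeff_zero, zero_eq_mul] at h5
  exact h5.resolve_right (MvPolynomial.mem_support_iff.1 he)

/-- The exponents `a` with `p ∣ 1 - t^a` are the multiples of a single one. -/
theorem exists_generator_of_prime_dvd {p : MvPolynomial (Fin r) ℚ} (hp : Prime p)
    {a : Fin r → ℕ} (ha : p ∣ 1 - tpow a) (ha0 : a ≠ 0) :
    ∃ c : Fin r → ℕ, c ≠ 0 ∧ p ∣ 1 - tpow c ∧
      ∀ b : Fin r → ℕ, p ∣ 1 - tpow b → ∃ k : ℕ, b = k • c := by
  obtain ⟨e, hep, he0⟩ : ∃ e ∈ p.support, e ≠ 0 := by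
    by_contra! h
    have h1 : p = MvPolynomial.C (MvPolynomial.coeff 0 p) := by
      ext d
      rw [MvPolynomial.coeff_C]
      split_ifs with hd
      · rw [hd]
      · by_contra hne
        exact hd (h d (MvPolynomial.mem_support_iff.2 hne)).symm
    have h2 : MvPolynomial.coeff 0 p ≠ 0 := by
      intro h0
      rw [h0, map_zero] at h1
      exact hp.ne_zero h1
    exact hp.not_isUnit (h1 ▸ isUnit_C h2)
  -- The weight `b_j ε_i - b_i ε_j` is orthogonal to `b`, hence to the exponent `e` of `p`. So all
  -- admissible `b` are parallel to the fixed vector `e`.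
  have hpar : ∀ b : Fin r → ℕ, p ∣ 1 - tpow b → ∀ i j, b j * e i = b i * e j := by
    intro b hb i j
    by_cases hb0 : b = 0
    · simp [hb0]
    have h1 := weight_eq_zero_of_prime_dvd hp hb hb0
      (w := Pi.single i (b j : ℚ) - Pi.single j (b i : ℚ)) (by
        simp only [Pi.sub_apply, sub_mul, Finset.sum_sub_distrib, Pi.single_apply, ite_mul,
          zero_mul, Finset.sum_ite_eq', Finset.mem_univ, if_true]
        ring) hep
    simp only [Pi.sub_apply, sub_mul, Finset.sum_sub_distrib, Pi.single_apply, ite_mul,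
      zero_mul, Finset.sum_ite_eq', Finset.mem_univ, if_true, sub_eq_zero] at h1
    exact_mod_cast h1
  obtain ⟨i, hi⟩ : ∃ i, e i ≠ 0 := by
    by_contra! h
    exact he0 (Finsupp.ext h)
  have hpos : ∀ b : Fin r → ℕ, p ∣ 1 - tpow b → b i = 0 → b = 0 := by
    intro b hb hbi
    funext j
    have h1 := hpar b hb i j
    rw [hbi, zero_mul] at h1
    exact (Nat.mul_eq_zero.1 h1).resolve_right hi
  -- On the line through `e`, the coordinate `i` orders the admissible exponents. These are closed
  -- under subtracting the smallest nonzero one, so the Euclidean algorithm shows that they are its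
  -- multiples.
  obtain ⟨c, ⟨hc0, hc⟩, hmin⟩ := (measure fun b : Fin r → ℕ => b i).wf.has_min
    {b | b ≠ 0 ∧ p ∣ 1 - tpow b} ⟨a, ha0, ha⟩
  refine ⟨c, hc0, hc, fun b => ?_⟩
  induction hk : b i using Nat.strong_induction_on generalizing b with
  | _ k ih =>
    intro hb
    by_cases hb0 : b = 0
    · exact ⟨0, by rw [hb0, zero_smul]⟩
    have hci : c i ≠ 0 := fun h => hc0 (hpos c hc h)
    have hcb : c i ≤ b i := not_lt.1 fun h => hmin b ⟨hb0, hb⟩ h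
    have hle : c ≤ b := by
      intro j
      have h1 := hpar b hb i j
      have h2 := hpar c hc i j
      refine le_of_mul_le_mul_right ?_ (Nat.pos_of_ne_zero hi)
      rw [h1, h2]
      exact Nat.mul_le_mul_right _ hcb
    have hsub : b - c + c = b := by
      funext j
      exact Nat.sub_add_cancel (hle j)
    have hdvd : p ∣ 1 - tpow (b - c) := by
      have h1 : p ∣ tpow c * (1 - tpow (b - c)) := by
        have h2 : tpow c * (1 - tpow (b - c)) = (1 - tpow b) - (1 - tpow c) := by
          conv_rhs => rw [← hsub, tpow_add]
          ring
        rw [h2]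
        exact dvd_sub hb hc
      exact (hp.dvd_or_dvd h1).resolve_left (not_dvd_tpow_of_dvd hp hc hc0 c)
    obtain ⟨l, hl⟩ := ih ((b - c) i) (by simp only [Pi.sub_apply]; omega) (b - c) rfl hdvd
    exact ⟨l + 1, by rw [succ_nsmul, ← hl, hsub]⟩

end PrimeDivisors

/-! ### Power series supported on a ray -/

section Ray

variable {r : ℕ}

theorem coe_tpow (δ : Fin r → ℕ) : (tpow δ : MvPowerSeries (Fin r) ℚ) =
    MvPowerSeries.monomial (Finsupp.equivFunOnFinite.symm δ) 1 :=
  MvPolynomial.coe_monomial _ _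

theorem hasSubst_tpow {c : Fin r → ℕ} (hc : c ≠ 0) :
    PowerSeries.HasSubst (S := ℚ) (tpow c : MvPowerSeries (Fin r) ℚ) := by
  rw [coe_tpow]
  refine PowerSeries.HasSubst.monomial (fun h => hc ?_) 1
  funext i
  simpa using DFunLike.congr_fun h i

/-- The substitution `u ↦ t^c` into power series in one variable. -/
def raySeries {c : Fin r → ℕ} (hc : c ≠ 0) : PowerSeries ℚ →ₐ[ℚ] MvPowerSeries (Fin r) ℚ :=
  PowerSeries.substAlgHom (hasSubst_tpow hc)

theorem raySeries_coe {c : Fin r → ℕ} (hc : c ≠ 0) (p : Polynomial ℚ) :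
    raySeries hc (p : PowerSeries ℚ) =
      ((Polynomial.aeval (tpow c) p : MvPolynomial (Fin r) ℚ) : MvPowerSeries (Fin r) ℚ) := by
  rw [raySeries, PowerSeries.substAlgHom_coe]
  induction p using Polynomial.induction_on' with
  | add p q hp hq => rw [map_add, map_add, hp, hq, MvPolynomial.coe_add]
  | monomial n a =>
    rw [Polynomial.aeval_monomial, Polynomial.aeval_monomial, MvPolynomial.coe_mul,
      MvPolynomial.coe_pow]
    congr 1
    exact (MvPolynomial.coe_C a).symm

theorem nsmul_left_injective_of_ne_zero {c : Fin r → ℕ} (hc : c ≠ 0) :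
    Function.Injective fun k : ℕ => k • c := by
  intro k l hkl
  obtain ⟨i, hi⟩ := Function.ne_iff.1 hc
  exact Nat.eq_of_mul_eq_mul_right (Nat.pos_of_ne_zero hi) (congrFun hkl i)

theorem coeff_raySeries_nsmul {c : Fin r → ℕ} (hc : c ≠ 0) (f : PowerSeries ℚ) (k : ℕ) :
    MvPowerSeries.coeff (Finsupp.equivFunOnFinite.symm (k • c)) (raySeries hc f) =
      PowerSeries.coeff k f := by
  rw [raySeries, PowerSeries.coe_substAlgHom, PowerSeries.coeff_subst (hasSubst_tpow hc),
    finsum_eq_single _ k]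
  · rw [← MvPolynomial.coe_pow, ← tpow_nsmul, coe_tpow, MvPowerSeries.coeff_monomial_same,
      smul_eq_mul, mul_one]
  · intro l hl
    rw [← MvPolynomial.coe_pow, ← tpow_nsmul, coe_tpow, MvPowerSeries.coeff_monomial_ne,
      smul_zero]
    intro h
    exact hl (nsmul_left_injective_of_ne_zero hc (Finsupp.equivFunOnFinite.symm.injective h)).symm

theorem coeff_raySeries_eq_zero {c : Fin r → ℕ} (hc : c ≠ 0) (f : PowerSeries ℚ)
    {n : Fin r →₀ ℕ} (hn : ∀ k : ℕ, (n : Fin r → ℕ) ≠ k • c) :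
    MvPowerSeries.coeff n (raySeries hc f) = 0 := by
  rw [raySeries, PowerSeries.coe_substAlgHom, PowerSeries.coeff_subst (hasSubst_tpow hc)]
  refine finsum_eq_zero_of_forall_eq_zero fun l => ?_
  rw [← MvPolynomial.coe_pow, ← tpow_nsmul, coe_tpow, MvPowerSeries.coeff_monomial_ne,
    smul_zero]
  rintro rfl
  exact hn l rfl

theorem coeff_tpow_mul_add (e : Fin r → ℕ) (f : MvPowerSeries (Fin r) ℚ) (n : Fin r → ℕ) :
    MvPowerSeries.coeff (Finsupp.equivFunOnFinite.symm (e + n))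
      ((tpow e : MvPowerSeries (Fin r) ℚ) * f) =
      MvPowerSeries.coeff (Finsupp.equivFunOnFinite.symm n) f := by
  have h : Finsupp.equivFunOnFinite.symm (e + n) =
    Finsupp.equivFunOnFinite.symm e + Finsupp.equivFunOnFinite.symm n := by ext; simp
  rw [coe_tpow, h, MvPowerSeries.coeff_add_monomial_mul, one_mul]

/-- A power series supported on `e + ℕ c` is `t^e` times a power series in `t^c`. -/
theorem eq_tpow_mul_raySeries {c e : Fin r → ℕ} (hc : c ≠ 0) {f : MvPowerSeries (Fin r) ℚ}
    (hf : ∀ n : Fin r →₀ ℕ, MvPowerSeries.coeff n f ≠ 0 → ∃ k : ℕ, (n : Fin r → ℕ) = e + k • c) :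
    f = (tpow e : MvPowerSeries (Fin r) ℚ) * raySeries hc (PowerSeries.mk fun k =>
      MvPowerSeries.coeff (Finsupp.equivFunOnFinite.symm (e + k • c)) f) := by
  ext n
  by_cases h : ∃ k : ℕ, (n : Fin r → ℕ) = e + k • c
  · obtain ⟨k, hk⟩ := h
    have hn : n = Finsupp.equivFunOnFinite.symm (e + k • c) := by
      rw [← hk]; ext; simp
    rw [hn, coeff_tpow_mul_add, coeff_raySeries_nsmul, PowerSeries.coeff_mk]
  · rw [not_imp_comm.1 (hf n) h, coe_tpow, MvPowerSeries.coeff_monomial_mul]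
    split_ifs with hle
    · rw [coeff_raySeries_eq_zero hc, mul_zero]
      intro k hk
      refine h ⟨k, ?_⟩
      rw [← hk]
      funext i
      have := hle i
      simp at this ⊢
      omega
    · rfl

theorem exists_polynomial_of_mem_polys {c e : Fin r → ℕ} (hc : c ≠ 0) {f : PowerSeries ℚ}
    (hf : (tpow e : MvPowerSeries (Fin r) ℚ) * raySeries hc f ∈ polys r) :
    ∃ p : Polynomial ℚ, f = p := by
  rw [mem_polys_iff_finite] at hf
  have hfin : {k | PowerSeries.coeff k f ≠ 0}.Finite := by
    refine Set.Finite.of_finite_image (f := fun k : ℕ => Finsupp.equivFunOnFinite.symm (e + k • c))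
      (hf.subset ?_) ?_
    · rintro _ ⟨k, hk, rfl⟩
      change MvPowerSeries.coeff _ _ ≠ 0
      rw [coeff_tpow_mul_add, coeff_raySeries_nsmul]
      exact hk
    · intro k _ l _ hkl
      exact nsmul_left_injective_of_ne_zero hc
        (add_left_cancel (Finsupp.equivFunOnFinite.symm.injective hkl))
  refine ⟨∑ k ∈ hfin.toFinset, Polynomial.monomial k (PowerSeries.coeff k f), ?_⟩
  ext n
  rw [Polynomial.coeff_coe, Polynomial.finsetSum_coeff]
  simp only [Polynomial.coeff_monomial]
  rw [Finset.sum_ite_eq' hfin.toFinset n]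
  simp only [Set.Finite.mem_toFinset, Set.mem_ofPred_eq]
  split_ifs with h1
  · rfl
  · exact not_not.1 h1

/-- Modulo `p` one has `t^c = 1`, so `g(t^c)` reduces to the nonzero constant `g(1)`. Thus, for
series in `t^c`, only the order at `u = 1` matters along `p`. -/
theorem not_dvd_aeval_tpow {p : MvPolynomial (Fin r) ℚ} (hp : Prime p) {c : Fin r → ℕ}
    (hpc : p ∣ 1 - tpow c) {g : Polynomial ℚ} (hg : ¬ g.IsRoot 1) :
    ¬ p ∣ Polynomial.aeval (tpow c) g := by
  intro h
  have h1 : tpow c - 1 ∣ Polynomial.aeval (tpow c) g - Polynomial.aeval 1 g := by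
    rw [← Polynomial.eval_map_algebraMap, ← Polynomial.eval_map_algebraMap]
    exact Polynomial.sub_dvd_eval_sub _ _ _
  have h2 : p ∣ Polynomial.aeval (1 : MvPolynomial (Fin r) ℚ) g := by
    rw [← neg_sub, neg_dvd] at h1
    have h3 := dvd_sub h (hpc.trans h1)
    rwa [sub_sub_cancel] at h3
  have h3 : Polynomial.aeval (1 : MvPolynomial (Fin r) ℚ) g = MvPolynomial.C (g.eval 1) := by
    rw [← map_one (algebraMap ℚ (MvPolynomial (Fin r) ℚ)), Polynomial.aeval_algebraMap_apply]
    simp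
  rw [h3] at h2
  exact hp.not_isUnit (isUnit_of_dvd_unit h2 (isUnit_C hg))

theorem one_sub_tpow_pow_ne_zero {c : Fin r → ℕ} (hc : c ≠ 0) {n : ℕ} (hn : n ≠ 0) (m : ℕ) :
    (1 - tpow c ^ n) ^ m ≠ 0 := by
  refine pow_ne_zero _ (ne_zero_of_constantCoeff ?_)
  rw [map_sub, map_one, map_pow, constantCoeff_tpow hc, zero_pow hn, sub_zero]

theorem raySeries_one_sub_pow {c : Fin r → ℕ} (hc : c ≠ 0) (n m : ℕ) (f : PowerSeries ℚ) :
    raySeries hc ((1 - PowerSeries.X ^ n) ^ m * f) =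
      (((1 - tpow c ^ n) ^ m : MvPolynomial (Fin r) ℚ) : MvPowerSeries (Fin r) ℚ) *
        raySeries hc f := by
  have h := raySeries_coe hc ((1 - Polynomial.X ^ n) ^ m)
  rw [map_pow, map_sub, map_one, map_pow, Polynomial.aeval_X] at h
  rw [map_mul, ← h]
  congr 2
  simp

/-- Let `f`, `g`, `h` be supported on translates of the ray `ℕ c`, with `0 ≤ h ≤ f g`
coefficientwise on these rays. Then the pole of `h` along a prime divisor of `1 - t^c` is bounded
by the product of the denominators of `f` and `g`. -/
theorem isLocalDenom_of_coeff_le {p : MvPolynomial (Fin r) ℚ} (hp : Prime p) {c : Fin r → ℕ}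
    (hc : c ≠ 0) (hpc : p ∣ 1 - tpow c) {n m : ℕ} (hn : n ≠ 0)
    {e₁ e₂ e₃ : Fin r → ℕ} {f g h : MvPowerSeries (Fin r) ℚ}
    (hf : ∀ n : Fin r →₀ ℕ, MvPowerSeries.coeff n f ≠ 0 → ∃ k : ℕ, (n : Fin r → ℕ) = e₁ + k • c)
    (hg : ∀ n : Fin r →₀ ℕ, MvPowerSeries.coeff n g ≠ 0 → ∃ k : ℕ, (n : Fin r → ℕ) = e₂ + k • c)
    (hh : ∀ n : Fin r →₀ ℕ, MvPowerSeries.coeff n h ≠ 0 → ∃ k : ℕ, (n : Fin r → ℕ) = e₃ + k • c)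
    (hf0 : f ≠ 0) (hg0 : g ≠ 0)
    (hDf : (((1 - tpow c ^ n) ^ m : MvPolynomial (Fin r) ℚ) : MvPowerSeries (Fin r) ℚ) * f ∈
      polys r)
    (hDg : (((1 - tpow c ^ n) ^ m : MvPolynomial (Fin r) ℚ) : MvPowerSeries (Fin r) ℚ) * g ∈
      polys r)
    (hDh : (((1 - tpow c ^ n) ^ (m + m) : MvPolynomial (Fin r) ℚ) :
      MvPowerSeries (Fin r) ℚ) * h ∈ polys r)
    (hpos : ∀ k : ℕ, 0 ≤ MvPowerSeries.coeff (Finsupp.equivFunOnFinite.symm (e₃ + k • c)) h)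
    (hle : ∀ k : ℕ, MvPowerSeries.coeff (Finsupp.equivFunOnFinite.symm (e₃ + k • c)) h ≤
      ∑ ij ∈ Finset.HasAntidiagonal.antidiagonal k,
        MvPowerSeries.coeff (Finsupp.equivFunOnFinite.symm (e₁ + ij.1 • c)) f *
          MvPowerSeries.coeff (Finsupp.equivFunOnFinite.symm (e₂ + ij.2 • c)) g)
    {B B' : MvPolynomial (Fin r) ℚ} (hB : (B : MvPowerSeries (Fin r) ℚ) * f ∈ polys r)
    (hB' : (B' : MvPowerSeries (Fin r) ℚ) * g ∈ polys r) : IsLocalDenom p (B * B') h := by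
  have hray : ∀ {e : Fin r → ℕ} {f : MvPowerSeries (Fin r) ℚ} {α : PowerSeries ℚ} {m : ℕ},
      f = (tpow e : MvPowerSeries (Fin r) ℚ) * raySeries hc α →
      (((1 - tpow c ^ n) ^ m : MvPolynomial (Fin r) ℚ) : MvPowerSeries (Fin r) ℚ) * f ∈ polys r →
      ∃ P : Polynomial ℚ, (1 - PowerSeries.X ^ n) ^ m * α = (P : PowerSeries ℚ) ∧
        (((1 - tpow c ^ n) ^ m : MvPolynomial (Fin r) ℚ) : MvPowerSeries (Fin r) ℚ) * f =
          ((tpow e * Polynomial.aeval (tpow c) P : MvPolynomial (Fin r) ℚ) :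
            MvPowerSeries (Fin r) ℚ) := by
    intro e f α m hf hD
    have h1 : (((1 - tpow c ^ n) ^ m : MvPolynomial (Fin r) ℚ) : MvPowerSeries (Fin r) ℚ) * f =
        (tpow e : MvPowerSeries (Fin r) ℚ) *
          raySeries hc ((1 - PowerSeries.X ^ n) ^ m * α) := by
      rw [hf, raySeries_one_sub_pow, mul_left_comm]
    rw [h1] at hD
    obtain ⟨P, hP⟩ := exists_polynomial_of_mem_polys hc hD
    exact ⟨P, hP, by rw [h1, hP, raySeries_coe, MvPolynomial.coe_mul]⟩
  obtain ⟨P, hP, hPf⟩ := hray (eq_tpow_mul_raySeries hc hf) hDf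
  obtain ⟨Q, hQ, hQg⟩ := hray (eq_tpow_mul_raySeries hc hg) hDg
  obtain ⟨W, hW, hWh⟩ := hray (eq_tpow_mul_raySeries hc hh) hDh
  have hD := one_sub_tpow_pow_ne_zero hc hn
  have hD' := fun m => (MvPolynomial.coe_eq_zero_iff.not.2 (hD m))
  have hP0 : P ≠ 0 := by
    rintro rfl
    rw [map_zero, mul_zero, MvPolynomial.coe_zero] at hPf
    exact hf0 ((mul_eq_zero.1 hPf).resolve_left (hD' m))
  have hQ0 : Q ≠ 0 := by
    rintro rfl
    rw [map_zero, mul_zero, MvPolynomial.coe_zero] at hQg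
    exact hg0 ((mul_eq_zero.1 hQg).resolve_left (hD' m))
  have hPQ0 : P * Q ≠ 0 := mul_ne_zero hP0 hQ0
  have hdvd : (Polynomial.X - Polynomial.C 1) ^ (P * Q).rootMultiplicity 1 ∣ W := by
    refine pow_rootMultiplicity_dvd_of_coeff_le (fun k => ?_) (fun k => ?_) hW
      (g := PowerSeries.mk (fun k => MvPowerSeries.coeff
        (Finsupp.equivFunOnFinite.symm (e₁ + k • c)) f) * PowerSeries.mk (fun k =>
        MvPowerSeries.coeff (Finsupp.equivFunOnFinite.symm (e₂ + k • c)) g)) ?_ hPQ0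
    · rw [PowerSeries.coeff_mk]
      exact hpos k
    · rw [PowerSeries.coeff_mk, PowerSeries.coeff_mul]
      simp only [PowerSeries.coeff_mk]
      exact hle k
    · rw [Polynomial.coe_mul, ← hP, ← hQ]
      ring
  obtain ⟨S, hS, hS1⟩ := Polynomial.exists_eq_pow_rootMultiplicity_mul_and_not_dvd (P * Q) hPQ0 1
  rw [Polynomial.dvd_iff_isRoot] at hS1
  obtain ⟨V, hV⟩ := hdvd
  rw [coe_mul_mem_polys_iff (hD m) hPf] at hB
  rw [coe_mul_mem_polys_iff (hD m) hQg] at hB'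
  -- With `D = (1 - t^(nc))^m` and `P Q = (u - 1)^μ S`, the assumptions on `B` and `B'` make `D^2`
  -- divide `B B' t^(e₁ + e₂) (t^c - 1)^μ S(t^c)`. Since `(u - 1)^μ` divides the numerator `W` of
  -- `h`, this choice of `G` gives `D^2 ∣ G B B' t^(e₃) W(t^c)`.
  refine ⟨tpow (e₁ + e₂) * Polynomial.aeval (tpow c) S, hp.not_dvd_mul
    (not_dvd_tpow_of_dvd hp hpc hc _) (not_dvd_aeval_tpow hp hpc hS1), ?_⟩
  rw [coe_mul_mem_polys_iff (hD _) hWh, pow_add]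
  refine (mul_dvd_mul hB hB').trans ?_
  have h1 : B * (tpow e₁ * Polynomial.aeval (tpow c) P) *
      (B' * (tpow e₂ * Polynomial.aeval (tpow c) Q)) =
      B * B' * tpow (e₁ + e₂) * Polynomial.aeval (tpow c) (P * Q) := by
    rw [tpow_add, map_mul]
    ring
  rw [h1, hS, hV, map_mul, map_mul]
  exact ⟨tpow e₃ * Polynomial.aeval (tpow c) V, by ring⟩

end Ray

/-! ### Hilbert series of tensor products of submodules -/

section FinrankSup

variable {K V κ : Type*} [Field K] [AddCommGroup V] [Module K V]

/-- The maps `π k` act as projections that separate the `A k`, so the sum of these subspaces is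
direct. -/
theorem finrank_biSup_eq_sum {A : κ → Submodule K V} [∀ k, Module.Finite K (A k)]
    {π : κ → V →ₗ[K] V} (h₁ : ∀ k, ∀ v ∈ A k, π k v = v)
    (h₂ : ∀ k l, k ≠ l → ∀ v ∈ A l, π k v = 0) (s : Finset κ) :
    Module.finrank K ↥(⨆ k ∈ s, A k) = ∑ k ∈ s, Module.finrank K (A k) := by
  classical
  induction s using Finset.induction_on with
  | empty =>
    have h : ⨆ k ∈ (∅ : Finset κ), A k = ⊥ := by simp
    rw [h, finrank_bot, Finset.sum_empty]
  | insert k s hk ih =>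
    have : Module.Finite K ↥(⨆ k ∈ s, A k) := by
      rw [← Finset.sup_eq_iSup]
      infer_instance
    have hbot : A k ⊓ ⨆ l ∈ s, A l = ⊥ := by
      rw [eq_bot_iff]
      rintro v ⟨hv, hv'⟩
      have hle : ⨆ l ∈ s, A l ≤ LinearMap.ker (π k) := by
        refine iSup₂_le fun l hl v hv => h₂ k l ?_ v hv
        rintro rfl
        exact hk hl
      rw [Submodule.mem_bot, ← h₁ k v hv]
      exact hle hv'
    have h3 := Submodule.finrank_sup_add_finrank_inf_eq (A k) (⨆ l ∈ s, A l)
    rw [hbot, finrank_bot, add_zero] at h3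
    rw [Finset.iSup_insert, h3, Finset.sum_insert hk, ih]

theorem finrank_biSup_le_sum (A : κ → Submodule K V) [∀ k, Module.Finite K (A k)] (s : Finset κ) :
    Module.finrank K ↥(⨆ k ∈ s, A k) ≤ ∑ k ∈ s, Module.finrank K (A k) := by
  classical
  induction s using Finset.induction_on with
  | empty =>
    have h : ⨆ k ∈ (∅ : Finset κ), A k = ⊥ := by simp
    rw [h, finrank_bot, Finset.sum_empty]
  | insert k s hk ih =>
    have : Module.Finite K ↥(⨆ k ∈ s, A k) := by
      rw [← Finset.sup_eq_iSup]
      infer_instance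
    rw [Finset.iSup_insert, Finset.sum_insert hk]
    exact (Submodule.finrank_add_le_finrank_add_finrank _ _).trans (Nat.add_le_add_left ih _)

end FinrankSup

section TensorSub

variable {K R S M N : Type*} [Field K] [CommRing R] [Algebra K R] [CommRing S] [Algebra K S]
  [AddCommGroup M] [Module K M] [Module R M] [IsScalarTower K R M]
  [AddCommGroup N] [Module K N] [Module S N] [IsScalarTower K S N] {r : ℕ}
  {𝓜 : (Fin r → ℤ) → Submodule K M} {𝓝 : (Fin r → ℤ) → Submodule K N}

theorem range_mapIncl_le {A : Submodule K M} {B : Submodule K N} {Q : Submodule K (M ⊗[K] N)}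
    (h : ∀ m ∈ A, ∀ n ∈ B, m ⊗ₜ[K] n ∈ Q) : LinearMap.range (TensorProduct.mapIncl A B) ≤ Q := by
  rintro _ ⟨x, rfl⟩
  induction x with
  | zero => simp
  | add x y hx hy => rw [map_add]; exact Q.add_mem hx hy
  | tmul m n => simpa [TensorProduct.mapIncl] using h m m.2 n n.2

theorem tmul_mem_range_mapIncl {A : Submodule K M} {B : Submodule K N} {m : M} {n : N}
    (hm : m ∈ A) (hn : n ∈ B) : m ⊗ₜ[K] n ∈ LinearMap.range (TensorProduct.mapIncl A B) :=
  ⟨(⟨m, hm⟩ : A) ⊗ₜ[K] (⟨n, hn⟩ : B), by simp [TensorProduct.mapIncl]⟩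

theorem finrank_range_mapIncl (A : Submodule K M) (B : Submodule K N) :
    Module.finrank K (LinearMap.range (TensorProduct.mapIncl A B)) =
      Module.finrank K A * Module.finrank K B := by
  rw [LinearMap.finrank_range_of_inj, Module.finrank_tensorProduct]
  exact Module.Flat.tensorProduct_mapIncl_injective_of_right A B

/-- The image of `P ⊗ Q` in `M ⊗ N`. -/
def tensorSub (P : Submodule R M) (Q : Submodule S N) : Submodule (R ⊗[K] S) (M ⊗[K] N) where
  __ := LinearMap.range (TensorProduct.mapIncl (P.restrictScalars K) (Q.restrictScalars K))
  smul_mem' x y hy := by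
    change x • y ∈ LinearMap.range
      (TensorProduct.mapIncl (P.restrictScalars K) (Q.restrictScalars K))
    induction x with
    | zero => rw [zero_smul]; exact Submodule.zero_mem _
    | add x x' hx hx' => rw [add_smul]; exact Submodule.add_mem _ hx hx'
    | tmul a b =>
      have h1 : LinearMap.range
          (TensorProduct.mapIncl (P.restrictScalars K) (Q.restrictScalars K)) ≤
          (LinearMap.range (TensorProduct.mapIncl (P.restrictScalars K)
            (Q.restrictScalars K))).comap (tensorAction K R S M N (a ⊗ₜ b)) := by
        refine range_mapIncl_le fun m hm n hn => ?_
        rw [Submodule.mem_comap, ← tensor_smul_def, tmul_smul_tmul]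
        exact tmul_mem_range_mapIncl (P.smul_mem a hm) (Q.smul_mem b hn)
      exact h1 hy

/-- A pure tensor `m ⊗ n` expands into the tensors of the components of `m` and `n`, which stay in
`P` and `Q`. -/
theorem homComp_tensorSub_mem (hM : DirectSum.IsInternal 𝓜) (hN : DirectSum.IsInternal 𝓝)
    {P : Submodule R M} {Q : Submodule S N} (hP : IsGradedSubmodule 𝓜 P)
    (hQ : IsGradedSubmodule 𝓝 Q) {y : M ⊗[K] N} (hy : y ∈ tensorSub (K := K) P Q)
    (d : Fin r → ℤ) :
    homComp (tensorGrading_isInternal hM hN) d y ∈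
      tensorGrading (fun a => P.restrictScalars K ⊓ 𝓜 a) (fun b => Q.restrictScalars K ⊓ 𝓝 b)
        d := by
  rw [isGradedSubmodule_iff hM] at hP
  rw [isGradedSubmodule_iff hN] at hQ
  have h1 : LinearMap.range
      (TensorProduct.mapIncl (P.restrictScalars K) (Q.restrictScalars K)) ≤
      (tensorGrading (fun a => P.restrictScalars K ⊓ 𝓜 a) (fun b => Q.restrictScalars K ⊓ 𝓝 b)
        d).comap (homComp (tensorGrading_isInternal hM hN) d) := by
    refine range_mapIncl_le fun m hm n hn => ?_
    obtain ⟨s, hs⟩ := exists_sum_homComp hM m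
    obtain ⟨t, ht⟩ := exists_sum_homComp hN n
    rw [← hs, ← ht, TensorProduct.sum_tmul]
    refine Submodule.sum_mem _ fun a _ => ?_
    rw [TensorProduct.tmul_sum]
    refine Submodule.sum_mem _ fun b _ => ?_
    rw [Submodule.mem_comap, homComp_of_mem_eq_ite _
      (tmul_mem_tensorGrading (homComp_mem hM a m) (homComp_mem hN b n))]
    split_ifs with hab
    · rw [← hab]
      exact tmul_mem_tensorGrading (𝓜 := fun a => P.restrictScalars K ⊓ 𝓜 a)
        (𝓝 := fun b => Q.restrictScalars K ⊓ 𝓝 b) ⟨hP m hm a, homComp_mem hM a m⟩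
        ⟨hQ n hn b, homComp_mem hN b n⟩
    · exact Submodule.zero_mem _
  exact h1 hy

theorem tensorGrading_inf_le (P : Submodule R M) (Q : Submodule S N) (d : Fin r → ℤ) :
    tensorGrading (fun a => P.restrictScalars K ⊓ 𝓜 a) (fun b => Q.restrictScalars K ⊓ 𝓝 b) d ≤
      (tensorSub (K := K) P Q).restrictScalars K ⊓ tensorGrading 𝓜 𝓝 d := by
  refine tensorGrading_induction _ ?_
  rintro a b rfl m hm n hn
  exact ⟨tmul_mem_range_mapIncl hm.1 hn.1, tmul_mem_tensorGrading hm.2 hn.2⟩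

theorem IsGradedSubmodule.tensorSub (hM : DirectSum.IsInternal 𝓜) (hN : DirectSum.IsInternal 𝓝)
    {P : Submodule R M} {Q : Submodule S N} (hP : IsGradedSubmodule 𝓜 P)
    (hQ : IsGradedSubmodule 𝓝 Q) :
    IsGradedSubmodule (tensorGrading 𝓜 𝓝) (tensorSub (K := K) P Q) := by
  rw [isGradedSubmodule_iff (tensorGrading_isInternal hM hN)]
  exact fun y hy d => (tensorGrading_inf_le P Q d (homComp_tensorSub_mem hM hN hP hQ hy d)).1

theorem tensorSub_inf_tensorGrading (hM : DirectSum.IsInternal 𝓜) (hN : DirectSum.IsInternal 𝓝)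
    {P : Submodule R M} {Q : Submodule S N} (hP : IsGradedSubmodule 𝓜 P)
    (hQ : IsGradedSubmodule 𝓝 Q) (d : Fin r → ℤ) :
    (tensorSub (K := K) P Q).restrictScalars K ⊓ tensorGrading 𝓜 𝓝 d =
      tensorGrading (fun a => P.restrictScalars K ⊓ 𝓜 a) (fun b => Q.restrictScalars K ⊓ 𝓝 b)
        d := by
  refine le_antisymm ?_ (tensorGrading_inf_le P Q d)
  rintro y ⟨hy, hyd⟩
  rw [← homComp_of_mem (tensorGrading_isInternal hM hN) hyd]
  exact homComp_tensorSub_mem hM hN hP hQ hy d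

theorem le_of_tensorGrading_ne_bot {s s' : Fin r → ℤ} (hs : ∀ d, 𝓜 d ≠ ⊥ → s ≤ d)
    (hs' : ∀ d, 𝓝 d ≠ ⊥ → s' ≤ d) (d : Fin r → ℤ) (hd : tensorGrading 𝓜 𝓝 d ≠ ⊥) :
    s + s' ≤ d := by
  by_contra hsd
  apply hd
  rw [eq_bot_iff]
  refine tensorGrading_induction _ ?_
  rintro a b rfl m hm n hn
  rw [Submodule.mem_bot]
  by_cases ha : 𝓜 a = ⊥
  · rw [ha, Submodule.mem_bot] at hm
    rw [hm, TensorProduct.zero_tmul]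
  · by_cases hb : 𝓝 b = ⊥
    · rw [hb, Submodule.mem_bot] at hn
      rw [hn, TensorProduct.tmul_zero]
    · exact absurd (add_le_add (hs a ha) (hs' b hb)) hsd

/-- Hilbert series are multiplicative for tensor products. -/
theorem hser_tensorSub (hM : DirectSum.IsInternal 𝓜) (hN : DirectSum.IsInternal 𝓝)
    (hfM : ∀ d, Module.Finite K (𝓜 d)) (hfN : ∀ d, Module.Finite K (𝓝 d))
    {s s' : Fin r → ℤ} (hs : ∀ d, 𝓜 d ≠ ⊥ → s ≤ d) (hs' : ∀ d, 𝓝 d ≠ ⊥ → s' ≤ d)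
    {P : Submodule R M} {Q : Submodule S N} (hP : IsGradedSubmodule 𝓜 P)
    (hQ : IsGradedSubmodule 𝓝 Q) :
    hser (tensorGrading 𝓜 𝓝) (s + s') (tensorSub (K := K) P Q) = hser 𝓜 s P * hser 𝓝 s' Q := by
  classical
  ext n
  rw [coeff_hser, hilbertSeries, tensorSub_inf_tensorGrading hM hN hP hQ,
    MvPowerSeries.coeff_mul]
  let A : (Fin r →₀ ℕ) × (Fin r →₀ ℕ) → Submodule K (M ⊗[K] N) := fun ij =>
    LinearMap.range (TensorProduct.mapIncl (P.restrictScalars K ⊓ 𝓜 (s + natToInt ij.1))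
      (Q.restrictScalars K ⊓ 𝓝 (s' + natToInt ij.2)))
  have hA : tensorGrading (fun a => P.restrictScalars K ⊓ 𝓜 a)
      (fun b => Q.restrictScalars K ⊓ 𝓝 b) (s + s' + natToInt n) =
      ⨆ ij ∈ Finset.HasAntidiagonal.antidiagonal n, A ij := by
    apply le_antisymm
    · refine tensorGrading_induction _ ?_
      intro a b hab m hm y hy
      by_cases ha : 𝓜 a = ⊥
      · have : m ∈ 𝓜 a := hm.2
        rw [ha, Submodule.mem_bot] at this
        rw [this, TensorProduct.zero_tmul]
        exact Submodule.zero_mem _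
      by_cases hb : 𝓝 b = ⊥
      · have : y ∈ 𝓝 b := hy.2
        rw [hb, Submodule.mem_bot] at this
        rw [this, TensorProduct.tmul_zero]
        exact Submodule.zero_mem _
      obtain ⟨i, rfl⟩ := exists_eq_add_natToInt (hs a ha)
      obtain ⟨j, rfl⟩ := exists_eq_add_natToInt (hs' b hb)
      have hij : i + j = n := by
        refine DFunLike.coe_injective (natToInt_injective ?_)
        rw [Finsupp.coe_add, natToInt_add]
        refine add_left_cancel (a := s + s') ?_
        rw [← hab]
        abel
      refine Submodule.mem_iSup_of_mem (i, j) (Submodule.mem_iSup_of_mem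
        (Finset.HasAntidiagonal.mem_antidiagonal.2 hij) (tmul_mem_range_mapIncl hm hy))
    · refine iSup₂_le fun ij hij => ?_
      rw [Finset.HasAntidiagonal.mem_antidiagonal] at hij
      have h1 : s + s' + natToInt n = (s + natToInt ij.1) + (s' + natToInt ij.2) := by
        rw [← hij, Finsupp.coe_add, natToInt_add]
        abel
      rw [h1]
      exact range_mapIncl_le fun m hm y hy =>
        tmul_mem_tensorGrading (𝓜 := fun a => P.restrictScalars K ⊓ 𝓜 a)
          (𝓝 := fun b => Q.restrictScalars K ⊓ 𝓝 b) hm hy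
  have hfin : ∀ ij, Module.Finite K (A ij) := by
    intro ij
    have := hfM (s + natToInt ij.1)
    have := hfN (s' + natToInt ij.2)
    have : Module.Finite K ↥(P.restrictScalars K ⊓ 𝓜 (s + natToInt ij.1)) :=
      Submodule.finiteDimensional_of_le inf_le_right
    have : Module.Finite K ↥(Q.restrictScalars K ⊓ 𝓝 (s' + natToInt ij.2)) :=
      Submodule.finiteDimensional_of_le inf_le_right
    infer_instance
  -- The pieces indexed by the antidiagonal are independent, as the tensor products of the component
  -- projections separate them.
  rw [hA, finrank_biSup_eq_sum (π := fun ij => TensorProduct.map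
    (homComp hM (s + natToInt ij.1)) (homComp hN (s' + natToInt ij.2))), Nat.cast_sum]
  · refine Finset.sum_congr rfl fun ij _ => ?_
    rw [finrank_range_mapIncl, Nat.cast_mul]
    rfl
  · intro ij v hv
    have hle : A ij ≤ LinearMap.eqLocus (TensorProduct.map
        (homComp hM (s + natToInt ij.1)) (homComp hN (s' + natToInt ij.2))) LinearMap.id := by
      refine range_mapIncl_le fun m hm y hy => ?_
      rw [LinearMap.mem_eqLocus, TensorProduct.map_tmul, homComp_of_mem _ hm.2,
        homComp_of_mem _ hy.2, LinearMap.id_apply]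
    exact hle hv
  · intro ij kl hne v hv
    have hle : A kl ≤ LinearMap.ker (TensorProduct.map
        (homComp hM (s + natToInt ij.1)) (homComp hN (s' + natToInt ij.2))) := by
      refine range_mapIncl_le fun m hm y hy => ?_
      rw [LinearMap.mem_ker, TensorProduct.map_tmul, homComp_of_mem_eq_ite _ hm.2,
        homComp_of_mem_eq_ite _ hy.2]
      split_ifs with h1 h2
      · refine absurd (Prod.ext ?_ ?_) hne
        · exact DFunLike.coe_injective (natToInt_injective (add_left_cancel h1)).symm
        · exact DFunLike.coe_injective (natToInt_injective (add_left_cancel h2)).symm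
      · rw [TensorProduct.tmul_zero]
      · rw [TensorProduct.zero_tmul]
      · rw [TensorProduct.zero_tmul]
    exact hle hv

end TensorSub

/-! ### Cyclic modules whose degrees lie on a ray -/

section CyclicModule

variable {K R M : Type*} [Field K] [CommRing R] [Algebra K R]
  [AddCommGroup M] [Module K M] [Module R M] {r : ℕ}
  {𝓡 : (Fin r → ℕ) → Submodule K R} [GradedAlgebra 𝓡] {𝓜 : (Fin r → ℤ) → Submodule K M}
  {s : Fin r → ℤ} {ι : Type*} {x : ι → R} {δ : ι → Fin r → ℕ}

theorem homComp_smul_of_mem (hM : IsGradedModule 𝓡 𝓜) {e : Fin r → ℤ} {m : M} (hm : m ∈ 𝓜 e)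
    (b : R) (d : Fin r → ℕ) :
    homComp hM.isInternal (natToInt d + e) (b • m) = (DirectSum.decompose 𝓡 b d : R) • m := by
  induction b using DirectSum.Decomposition.inductionOn 𝓡 with
  | zero => simp
  | @homogeneous i b =>
    rw [homComp_of_mem_eq_ite _ (hM.smul_mem _ _ _ _ b.2 hm), DirectSum.decompose_coe,
      DirectSum.coe_of_apply]
    by_cases h : i = d
    · rw [if_pos h, if_pos (by rw [h])]
    · rw [if_neg h, if_neg (fun h' => h (natToInt_injective (add_right_cancel h'))),
        ZeroMemClass.coe_zero, zero_smul]
  | add a b ha hb =>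
    rw [add_smul, map_add, ha, hb, DirectSum.decompose_add, DirectSum.add_apply,
      Submodule.coe_add, add_smul]

theorem homComp_smul_eq_zero (hM : IsGradedModule 𝓡 𝓜) {e : Fin r → ℤ} {m : M} (hm : m ∈ 𝓜 e)
    (b : R) {d : Fin r → ℤ} (hd : ∀ δ : Fin r → ℕ, natToInt δ + e ≠ d) :
    homComp hM.isInternal d (b • m) = 0 := by
  induction b using DirectSum.Decomposition.inductionOn 𝓡 with
  | zero => simp
  | @homogeneous i b => exact homComp_of_mem_ne _ (hM.smul_mem _ _ _ _ b.2 hm) (hd i)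
  | add a b ha hb => rw [add_smul, map_add, ha, hb, add_zero]

variable [IsScalarTower K R M]

theorem isGradedSubmodule_map_toSpanSingleton (hM : IsGradedModule 𝓡 𝓜) {e : Fin r → ℤ} {m : M}
    (hm : m ∈ 𝓜 e) {I : Ideal R} (hI : I.IsHomogeneous 𝓡) :
    IsGradedSubmodule 𝓜 (Submodule.map (LinearMap.toSpanSingleton R M m) I) := by
  rw [isGradedSubmodule_iff hM.isInternal]
  rintro _ ⟨b, hb, rfl⟩ d
  rw [LinearMap.toSpanSingleton_apply]
  by_cases hd : ∃ δ : Fin r → ℕ, natToInt δ + e = d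
  · obtain ⟨δ, rfl⟩ := hd
    rw [homComp_smul_of_mem hM hm]
    exact ⟨_, hI δ hb, rfl⟩
  · rw [homComp_smul_eq_zero hM hm b (not_exists.1 hd)]
    exact Submodule.zero_mem _

/-- `1 - t^(kc)` divides `1 - t^(nc)` whenever `k ∣ n`, so the product of the multipliers `k i`
serves as `n₀`. The freedom in `n` and `m` later allows one denominator for several series. -/
theorem exists_prod_dvd_one_sub_pow {c : Fin r → ℕ} (A : Finset ι)
    (hA : ∀ i ∈ A, δ i ≠ 0 ∧ ∃ k : ℕ, δ i = k • c) :
    ∃ n₀ : ℕ, n₀ ≠ 0 ∧ ∀ n, n₀ ∣ n → ∀ m, A.card ≤ m →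
      ∏ i ∈ A, (1 - tpow (δ i)) ∣ (1 - tpow c ^ n) ^ m := by
  have hA' : ∀ i ∈ A, ∃ k : ℕ, k ≠ 0 ∧ δ i = k • c := by
    intro i hi
    obtain ⟨h0, k, hk⟩ := hA i hi
    refine ⟨k, ?_, hk⟩
    rintro rfl
    exact h0 (by rw [hk, zero_smul])
  choose! k hk0 hk using hA'
  refine ⟨∏ i ∈ A, k i, Finset.prod_ne_zero_iff.2 hk0, fun n hn m hm => ?_⟩
  refine dvd_trans ?_ (pow_dvd_pow _ hm)
  rw [← Finset.prod_const]
  refine Finset.prod_dvd_prod_of_dvd _ _ fun i hi => ?_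
  obtain ⟨l, hl⟩ := (Finset.dvd_prod_of_mem k hi).trans hn
  rw [hk i hi, tpow_nsmul, hl, pow_mul]
  exact one_sub_dvd_one_sub_pow _ _

/-- For a homogeneous ideal `I` containing the annihilator of a homogeneous element `m`, such that
`R / I` lives in degrees `ℕ c`, the Hilbert series of `R m / I m` is supported on a ray and bounds
that of `R / I`. -/
theorem IsFiniteGraded.exists_ray_series [IsNoetherian R M] [Finite ι]
    (h : IsFiniteGraded 𝓡 𝓜 s x δ) {B : MvPolynomial (Fin r) ℚ}
    (hB : ∀ P : Submodule R M, IsGradedSubmodule 𝓜 P →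
        (B : MvPowerSeries (Fin r) ℚ) * hser 𝓜 s P ∈ polys r)
    {I : Ideal R} (hI : I.IsHomogeneous 𝓡) (hI1 : (1 : R) ∉ I) {e : Fin r → ℤ} {m : M}
    (hm : m ∈ 𝓜 e) (hann : ∀ d, ∀ a ∈ 𝓡 d, a • m = 0 → a ∈ I) {c : Fin r → ℕ}
    (hray : ∀ d, ∀ a ∈ 𝓡 d, a ∉ I → ∃ k : ℕ, d = k • c) :
    ∃ (f : MvPowerSeries (Fin r) ℚ) (e₀ : Fin r → ℕ) (C : ℕ → Submodule K R) (n₀ m₀ : ℕ),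
      f ≠ 0 ∧
      (∀ n : Fin r →₀ ℕ, MvPowerSeries.coeff n f ≠ 0 → ∃ k : ℕ, (n : Fin r → ℕ) = e₀ + k • c) ∧
      (B : MvPowerSeries (Fin r) ℚ) * f ∈ polys r ∧
      n₀ ≠ 0 ∧ (∀ n, n₀ ∣ n → ∀ k, m₀ ≤ k →
        (((1 - tpow c ^ n) ^ k : MvPolynomial (Fin r) ℚ) : MvPowerSeries (Fin r) ℚ) * f ∈
          polys r) ∧
      ∀ k, C k ≤ 𝓡 (k • c) ∧ (∀ a ∈ 𝓡 (k • c), ∃ b ∈ C k, a - b ∈ I) ∧ Module.Finite K (C k) ∧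
        (Module.finrank K (C k) : ℚ) ≤
          MvPowerSeries.coeff (Finsupp.equivFunOnFinite.symm (e₀ + k • c)) f := by
  classical
  have hM := h.graded
  have hm0 : m ≠ 0 := by
    rintro rfl
    exact hI1 (hann 0 1 (SetLike.GradedOne.one_mem) (smul_zero _))
  obtain ⟨e₀, rfl⟩ := exists_eq_add_natToInt (h.lower e fun hbot => hm0 (by
    rwa [hbot, Submodule.mem_bot] at hm))
  let P : Submodule R M := Submodule.span R {m}
  let Q : Submodule R M := Submodule.map (LinearMap.toSpanSingleton R M m) I
  have hP : IsGradedSubmodule 𝓜 P := isGradedSubmodule_span hM h.iSup_eq_top (by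
    rintro _ rfl
    exact ⟨_, hm⟩)
  have hQ : IsGradedSubmodule 𝓜 Q := isGradedSubmodule_map_toSpanSingleton hM hm hI
  have hQP : Q ≤ P := by
    rintro _ ⟨a, -, rfl⟩
    exact Submodule.smul_mem _ _ (Submodule.mem_span_singleton_self m)
  have hdeg : ∀ k : ℕ, s + natToInt (Finsupp.equivFunOnFinite.symm ((e₀ : Fin r → ℕ) + k • c)) =
      natToInt (k • c) + (s + natToInt e₀) := by
    intro k
    change s + natToInt ((e₀ : Fin r → ℕ) + k • c) = _
    rw [natToInt_add]
    abel
  have hC : ∀ k : ℕ, ∃ C : Submodule K R, C ≤ 𝓡 (k • c) ∧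
      (∀ a ∈ 𝓡 (k • c), ∃ b ∈ C, a - b ∈ I) ∧ Module.Finite K C ∧
        (Module.finrank K C : ℚ) ≤
          MvPowerSeries.coeff (Finsupp.equivFunOnFinite.symm ((e₀ : Fin r → ℕ) + k • c))
            (hser 𝓜 s P - hser 𝓜 s Q) := by
    intro k
    -- The space `C k` is a complement of `I` inside `R_{kc}`, a model of `(R/I)_{kc}` made of
    -- honest elements of `R`.
    obtain ⟨C', hC'⟩ := Submodule.exists_isCompl (I.restrictScalars K ⊓ 𝓡 (k • c))
    have hsup : I.restrictScalars K ⊓ 𝓡 (k • c) ⊔ C' ⊓ 𝓡 (k • c) = 𝓡 (k • c) := by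
      rw [← sup_inf_assoc_of_le _ inf_le_right, hC'.sup_eq_top, top_inf_eq]
    let φ : R →ₗ[K] M := (LinearMap.toSpanSingleton R M m).restrictScalars K
    have hφ : ∀ a : R, φ a = a • m := fun _ => rfl
    -- If `a m = b m` with `b ∈ I`, then `a` minus the degree `kc` component of `b` kills `m`, so it
    -- lies in `I` by `hann`. Hence `a ∈ I`, and `a` is in a complement of `I`. So `C k` embeds into
    -- `Rm/Im`.
    have hinj : ∀ a ∈ C' ⊓ 𝓡 (k • c), a • m ∈ Q → a = 0 := by
      rintro a ⟨haC, had⟩ ⟨b, hb, hab⟩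
      rw [LinearMap.toSpanSingleton_apply] at hab
      have h1 := homComp_smul_of_mem hM hm b (k • c)
      rw [hab, homComp_of_mem _ (hM.smul_mem _ _ _ _ had hm)] at h1
      have h2 : a - (DirectSum.decompose 𝓡 b (k • c) : R) ∈ I :=
        hann (k • c) _ (Submodule.sub_mem _ had (SetLike.coe_mem _)) (by
          rw [sub_smul, ← h1, sub_self])
      have h3 : a ∈ I := (Submodule.sub_mem_iff_left _ (hI _ hb)).1 h2
      exact (Submodule.disjoint_def.1 hC'.disjoint) a ⟨h3, had⟩ haC
    have := h.finite (natToInt (k • c) + (s + natToInt e₀))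
    have hfin : Module.Finite K ↥(C' ⊓ 𝓡 (k • c)) := by
      refine Module.Finite.of_injective (φ.restrict (p := C' ⊓ 𝓡 (k • c))
        (q := 𝓜 (natToInt (k • c) + (s + natToInt e₀)))
        fun a ha => hM.smul_mem _ _ _ _ ha.2 hm) ?_
      rw [injective_iff_map_eq_zero]
      intro a ha
      refine Subtype.ext (hinj a a.2 ?_)
      have h1 : (a : R) • m = 0 := congrArg Subtype.val ha
      rw [h1]
      exact Submodule.zero_mem _
    refine ⟨C' ⊓ 𝓡 (k • c), inf_le_right, fun a ha => ?_, hfin, ?_⟩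
    · rw [← hsup] at ha
      obtain ⟨i, hi, b, hb, rfl⟩ := Submodule.mem_sup.1 ha
      exact ⟨b, hb, by rw [add_sub_cancel_right]; exact hi.1⟩
    · rw [map_sub, coeff_hser, coeff_hser, hdeg, le_sub_iff_add_le, hilbertSeries, hilbertSeries]
      set d := natToInt (k • c) + (s + natToInt e₀)
      have hfQ : Module.Finite K ↥(Q.restrictScalars K ⊓ 𝓜 d) :=
        Submodule.finiteDimensional_of_le inf_le_right
      have hfP : Module.Finite K ↥(P.restrictScalars K ⊓ 𝓜 d) :=
        Submodule.finiteDimensional_of_le inf_le_right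
      have h1 := finrank_map_add_finrank_inf_ker φ (C' ⊓ 𝓡 (k • c))
      have h2 : C' ⊓ 𝓡 (k • c) ⊓ LinearMap.ker φ = ⊥ := by
        rw [eq_bot_iff]
        rintro a ⟨ha, ha0⟩
        refine hinj a ha ?_
        have h3 : a • m = 0 := ha0
        rw [h3]
        exact Submodule.zero_mem _
      rw [h2, finrank_bot, add_zero] at h1
      have h3 := Submodule.finrank_sup_add_finrank_inf_eq ((C' ⊓ 𝓡 (k • c)).map φ)
        (Q.restrictScalars K ⊓ 𝓜 d)
      have h4 : (C' ⊓ 𝓡 (k • c)).map φ ⊓ (Q.restrictScalars K ⊓ 𝓜 d) = ⊥ := by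
        rw [eq_bot_iff]
        rintro _ ⟨⟨a, ha, rfl⟩, hQa, -⟩
        have h5 : a = 0 := hinj a ha hQa
        rw [h5, map_zero]
        exact Submodule.zero_mem _
      rw [h4, finrank_bot, add_zero, h1] at h3
      rw [← Nat.cast_add, ← h3, Nat.cast_le]
      refine Submodule.finrank_mono (sup_le ?_ (inf_le_inf_right _ hQP))
      rintro _ ⟨a, ha, rfl⟩
      exact ⟨Submodule.smul_mem _ _ (Submodule.mem_span_singleton_self m),
        hM.smul_mem _ _ _ _ ha.2 hm⟩
  choose C hC₁ hC₂ hC₃ hC₄ using hC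
  have := Fintype.ofFinite ι
  -- The generators in `I` kill `Rm/Im`; the others have degrees that are multiples of `c`. So
  -- Hilbert–Serre only needs factors `1 - t^(kc)`.
  let A : Finset ι := Finset.univ.filter fun i => x i ∉ I
  obtain ⟨n₀, hn₀, hdvd⟩ := exists_prod_dvd_one_sub_pow (δ := δ) (c := c) A fun i hi =>
    ⟨h.irrelevant.ne_zero i, hray _ _ (h.irrelevant.mem i) (Finset.mem_filter.1 hi).2⟩
  refine ⟨hser 𝓜 s P - hser 𝓜 s Q, e₀, C, n₀, A.card, ?_, ?_, ?_, hn₀, ?_,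
    fun k => ⟨hC₁ k, hC₂ k, hC₃ k, hC₄ k⟩⟩
  -- The series is nonzero because `1 ∉ I` makes the complement in degree 0 nonzero.
  · intro h0
    have h1 := hC₄ 0
    have := hC₃ 0
    rw [h0, map_zero] at h1
    have h2 : Module.finrank K (C 0) = 0 := by
      have : (Module.finrank K (C 0) : ℚ) = 0 := le_antisymm h1 (Nat.cast_nonneg _)
      exact_mod_cast this
    rw [Submodule.finrank_eq_zero] at h2
    obtain ⟨b, hb, h1b⟩ := hC₂ 0 1 (by rw [zero_smul]; exact SetLike.GradedOne.one_mem)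
    rw [h2, Submodule.mem_bot] at hb
    rw [hb, sub_zero] at h1b
    exact hI1 h1b
  · intro n hn
    by_contra hk
    apply hn
    rw [map_sub, coeff_hser, coeff_hser, sub_eq_zero]
    refine hilbertSeries_congr hQP fun p hp hpn => ?_
    obtain ⟨b, rfl⟩ := Submodule.mem_span_singleton.1 hp
    rw [← homComp_of_mem hM.isInternal hpn]
    by_cases hd : ∃ δ : Fin r → ℕ, natToInt δ + (s + natToInt e₀) = s + natToInt n
    · obtain ⟨δ, hδ⟩ := hd
      rw [← hδ, homComp_smul_of_mem hM hm]
      refine ⟨_, ?_, rfl⟩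
      by_contra hbI
      obtain ⟨k, hk'⟩ := hray δ _ (SetLike.coe_mem _) hbI
      refine hk ⟨k, natToInt_injective ?_⟩
      rw [natToInt_add, ← hk']
      refine add_left_cancel (a := s) ?_
      rw [← hδ]
      abel
    · rw [homComp_smul_eq_zero hM hm b (not_exists.1 hd)]
      exact Submodule.zero_mem _
  · rw [mul_sub]
    exact Subring.sub_mem _ (hB P hP) (hB Q hQ)
  · intro n hn k hk
    obtain ⟨q, hq⟩ := hdvd n hn k hk
    rw [hq, mul_comm (∏ i ∈ A, _) q, MvPolynomial.coe_mul, mul_assoc]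
    refine Subring.mul_mem _ (coe_mem_polys q) (h.irrelevant.prod_mul_hser_mem hM h.finite
      h.lower A hQP hQ hP fun i hi p hp => ?_)
    obtain ⟨b, rfl⟩ := Submodule.mem_span_singleton.1 hp
    have hxi : x i ∈ I := by
      by_contra hxi
      exact hi (Finset.mem_filter.2 ⟨Finset.mem_univ i, hxi⟩)
    rw [← mul_smul]
    exact ⟨x i * b, I.mul_mem_right b hxi, rfl⟩

end CyclicModule

/-! ### Subquotients of `M ⊗ N` whose degrees lie on rays -/

section TensorRay

variable {K R S M N : Type*} [Field K] [CommRing R] [Algebra K R] [CommRing S] [Algebra K S]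
  [AddCommGroup M] [Module K M] [Module R M] [IsScalarTower K R M]
  [AddCommGroup N] [Module K N] [Module S N] [IsScalarTower K S N] {r : ℕ}
  {𝓡 : (Fin r → ℕ) → Submodule K R} {𝓢 : (Fin r → ℕ) → Submodule K S}
  {𝓜 : (Fin r → ℤ) → Submodule K M} {𝓝 : (Fin r → ℤ) → Submodule K N}

/-- Only the homogeneous parts of `τ` of degree `d - e` contribute to the component. It is enough
that the homogeneous elements span `T`. -/
theorem homComp_smul_mem_of_forall {V T : Type*} [CommRing T] [Algebra K T] [AddCommGroup V]
    [Module K V] [Module T V] [IsScalarTower K T V] {𝓣 : (Fin r → ℕ) → Submodule K T}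
    {𝓥 : (Fin r → ℤ) → Submodule K V} (hV : IsGradedModule 𝓣 𝓥) (h𝓣 : iSup 𝓣 = ⊤)
    {e d : Fin r → ℤ} {w : V} (hw : w ∈ 𝓥 e) {Z : Submodule K V}
    (hZ : ∀ δ : Fin r → ℕ, natToInt δ + e = d → ∀ τ ∈ 𝓣 δ, τ • w ∈ Z) (τ : T) :
    homComp hV.isInternal d (τ • w) ∈ Z := by
  have hτ : τ ∈ iSup 𝓣 := h𝓣 ▸ Submodule.mem_top
  induction hτ using Submodule.iSup_induction' with
  | mem δ τ hτ =>
    rw [homComp_of_mem_eq_ite _ (hV.smul_mem _ _ _ _ hτ hw)]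
    split_ifs with hd
    · exact hZ δ hd τ hτ
    · exact Submodule.zero_mem _
  | zero => rw [zero_smul, map_zero]; exact Submodule.zero_mem _
  | add a b _ _ ha hb => rw [add_smul, map_add]; exact Submodule.add_mem _ ha hb

/-- The subspace `(C ⊗ C') w` of `M ⊗ N`. -/
def tensorSmul (C : Submodule K R) (C' : Submodule K S) (w : M ⊗[K] N) :
    Submodule K (M ⊗[K] N) :=
  (LinearMap.range (TensorProduct.mapIncl C C')).map
    ((LinearMap.toSpanSingleton (R ⊗[K] S) (M ⊗[K] N) w).restrictScalars K)

theorem finite_tensorSmul (C : Submodule K R) (C' : Submodule K S) [Module.Finite K C]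
    [Module.Finite K C'] (w : M ⊗[K] N) : Module.Finite K (tensorSmul C C' w) := by
  unfold tensorSmul
  infer_instance

theorem finrank_tensorSmul_le (C : Submodule K R) (C' : Submodule K S) [Module.Finite K C]
    [Module.Finite K C'] (w : M ⊗[K] N) :
    Module.finrank K (tensorSmul C C' w) ≤ Module.finrank K C * Module.finrank K C' := by
  rw [← finrank_range_mapIncl]
  exact Submodule.finrank_map_le _ _

theorem tmul_smul_mem_tensorSmul {C : Submodule K R} {C' : Submodule K S} (w : M ⊗[K] N)
    {a : R} {b : S} (ha : a ∈ C) (hb : b ∈ C') : (a ⊗ₜ[K] b) • w ∈ tensorSmul C C' w :=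
  ⟨a ⊗ₜ b, tmul_mem_range_mapIncl ha hb, rfl⟩

theorem tmul_smul_mem_of_left {P : Submodule (R ⊗[K] S) (M ⊗[K] N)} {w : M ⊗[K] N} {a : R}
    (h : (a ⊗ₜ[K] (1 : S)) • w ∈ P) (b : S) : (a ⊗ₜ[K] b) • w ∈ P := by
  have h1 : (a ⊗ₜ[K] b) = ((1 : R) ⊗ₜ[K] b) * (a ⊗ₜ[K] (1 : S)) := by
    rw [Algebra.TensorProduct.tmul_mul_tmul, one_mul, mul_one]
  rw [h1, mul_smul]
  exact P.smul_mem _ h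

theorem tmul_smul_mem_of_right {P : Submodule (R ⊗[K] S) (M ⊗[K] N)} {w : M ⊗[K] N} {b : S}
    (h : ((1 : R) ⊗ₜ[K] b) • w ∈ P) (a : R) : (a ⊗ₜ[K] b) • w ∈ P := by
  have h1 : (a ⊗ₜ[K] b) = (a ⊗ₜ[K] (1 : S)) * ((1 : R) ⊗ₜ[K] b) := by
    rw [Algebra.TensorProduct.tmul_mul_tmul, one_mul, mul_one]
  rw [h1, mul_smul]
  exact P.smul_mem _ h

/-- Modulo `P` the ideals `I` and `J` kill `w`, so in `(a ⊗ b) w` the factors may be replaced by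
their representatives in the `C i` and `C' j`. The supremum over `k` is zero when `δ` is off the
ray, which covers both comparisons of Hilbert series below. -/
theorem smul_mem_inf_sup_iSup (hM : IsGradedModule 𝓡 𝓜) (hN : IsGradedModule 𝓢 𝓝)
    {P : Submodule (R ⊗[K] S) (M ⊗[K] N)} {e : Fin r → ℤ} {w : M ⊗[K] N}
    (hw : w ∈ tensorGrading 𝓜 𝓝 e) {I : Ideal R} {J : Ideal S}
    (hI : ∀ a ∈ I, (a ⊗ₜ[K] (1 : S)) • w ∈ P) (hJ : ∀ b ∈ J, ((1 : R) ⊗ₜ[K] b) • w ∈ P)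
    {c : Fin r → ℕ} (hrI : ∀ d, ∀ a ∈ 𝓡 d, a ∉ I → ∃ k : ℕ, d = k • c)
    (hrJ : ∀ d, ∀ b ∈ 𝓢 d, b ∉ J → ∃ k : ℕ, d = k • c)
    {C : ℕ → Submodule K R} {C' : ℕ → Submodule K S} (hC : ∀ k, C k ≤ 𝓡 (k • c))
    (hC₂ : ∀ k, ∀ a ∈ 𝓡 (k • c), ∃ b ∈ C k, a - b ∈ I)
    (hC' : ∀ k, C' k ≤ 𝓢 (k • c)) (hC'₂ : ∀ k, ∀ a ∈ 𝓢 (k • c), ∃ b ∈ C' k, a - b ∈ J)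
    {δ : Fin r → ℕ} {τ : R ⊗[K] S} (hτ : τ ∈ tensorGrading 𝓡 𝓢 δ) :
    τ • w ∈ (P.restrictScalars K ⊓ tensorGrading 𝓜 𝓝 (natToInt δ + e)) ⊔
      ⨆ (k : ℕ) (_ : δ = k • c), ⨆ ij ∈ Finset.HasAntidiagonal.antidiagonal k,
        tensorSmul (C ij.1) (C' ij.2) w := by
  set Z := (P.restrictScalars K ⊓ tensorGrading 𝓜 𝓝 (natToInt δ + e)) ⊔
      ⨆ (k : ℕ) (_ : δ = k • c), ⨆ ij ∈ Finset.HasAntidiagonal.antidiagonal k,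
        tensorSmul (C ij.1) (C' ij.2) w with hZ
  have hle : tensorGrading 𝓡 𝓢 δ ≤ Z.comap
      ((LinearMap.toSpanSingleton (R ⊗[K] S) (M ⊗[K] N) w).restrictScalars K) := by
    refine tensorGrading_induction _ ?_
    rintro d₁ d₂ rfl a ha b hb
    change (a ⊗ₜ[K] b) • w ∈ Z
    have hmem : ∀ a ∈ 𝓡 d₁, ∀ b ∈ 𝓢 d₂, (a ⊗ₜ[K] b) • w ∈ P → (a ⊗ₜ[K] b) • w ∈ Z :=
      fun a ha b hb h => Submodule.mem_sup_left
        ⟨h, (hM.tensor hN).smul_mem _ _ _ _ (tmul_mem_tensorGrading ha hb) hw⟩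
    by_cases haI : a ∈ I
    · exact hmem a ha b hb (tmul_smul_mem_of_left (hI a haI) b)
    by_cases hbJ : b ∈ J
    · exact hmem a ha b hb (tmul_smul_mem_of_right (hJ b hbJ) a)
    obtain ⟨i, rfl⟩ := hrI d₁ a ha haI
    obtain ⟨j, rfl⟩ := hrJ d₂ b hb hbJ
    obtain ⟨a', ha', haa'⟩ := hC₂ i a ha
    obtain ⟨b', hb', hbb'⟩ := hC'₂ j b hb
    have h1 : (a ⊗ₜ[K] b) • w = ((a - a') ⊗ₜ[K] b) • w + (a' ⊗ₜ[K] (b - b')) • w +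
        (a' ⊗ₜ[K] b') • w := by
      rw [← add_smul, ← add_smul]
      congr 1
      rw [TensorProduct.sub_tmul, TensorProduct.tmul_sub]
      abel
    rw [h1]
    refine Submodule.add_mem _ (Submodule.add_mem _ ?_ ?_) ?_
    · exact hmem _ (Submodule.sub_mem _ ha (hC i ha')) b hb
        (tmul_smul_mem_of_left (hI _ haa') b)
    · exact hmem _ (hC i ha') _ (Submodule.sub_mem _ hb (hC' j hb'))
        (tmul_smul_mem_of_right (hJ _ hbb') a')
    · refine Submodule.mem_sup_right (Submodule.mem_iSup_of_mem (i + j)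
        (Submodule.mem_iSup_of_mem (add_smul i j c).symm (Submodule.mem_iSup_of_mem (i, j)
          (Submodule.mem_iSup_of_mem (Finset.HasAntidiagonal.mem_antidiagonal.2 rfl) ?_))))
      exact tmul_smul_mem_tensorSmul w ha' hb'
  exact hle hτ

theorem mem_inf_sup_of_mem_sup_span (hM : IsGradedModule 𝓡 𝓜) (hN : IsGradedModule 𝓢 𝓝)
    (hT : iSup (tensorGrading 𝓡 𝓢) = ⊤)
    {P : Submodule (R ⊗[K] S) (M ⊗[K] N)} (hP : IsGradedSubmodule (tensorGrading 𝓜 𝓝) P)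
    {e : Fin r → ℤ} {w : M ⊗[K] N} (hw : w ∈ tensorGrading 𝓜 𝓝 e) {d : Fin r → ℤ}
    {U : Submodule K (M ⊗[K] N)}
    (hU : ∀ δ : Fin r → ℕ, natToInt δ + e = d → ∀ τ ∈ tensorGrading 𝓡 𝓢 δ,
      τ • w ∈ (P.restrictScalars K ⊓ tensorGrading 𝓜 𝓝 d) ⊔ U) {y : M ⊗[K] N}
    (hy : y ∈ P ⊔ Submodule.span (R ⊗[K] S) {w}) (hyd : y ∈ tensorGrading 𝓜 𝓝 d) :
    y ∈ (P.restrictScalars K ⊓ tensorGrading 𝓜 𝓝 d) ⊔ U := by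
  have hV := hM.tensor hN
  obtain ⟨p, hp, z, hz, rfl⟩ := Submodule.mem_sup.1 hy
  obtain ⟨τ, rfl⟩ := Submodule.mem_span_singleton.1 hz
  rw [← homComp_of_mem hV.isInternal hyd, map_add]
  refine Submodule.add_mem _ (Submodule.mem_sup_left ⟨?_, homComp_mem _ _ _⟩) ?_
  · exact (isGradedSubmodule_iff hV.isInternal).1 hP p hp d
  · exact homComp_smul_mem_of_forall hV hT hw hU τ

theorem hilbertSeries_sup_span_eq (hM : IsGradedModule 𝓡 𝓜) (hN : IsGradedModule 𝓢 𝓝)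
    (hT : iSup (tensorGrading 𝓡 𝓢) = ⊤)
    {P : Submodule (R ⊗[K] S) (M ⊗[K] N)} (hP : IsGradedSubmodule (tensorGrading 𝓜 𝓝) P)
    {e : Fin r → ℤ} {w : M ⊗[K] N} (hw : w ∈ tensorGrading 𝓜 𝓝 e) {I : Ideal R} {J : Ideal S}
    (hI : ∀ a ∈ I, (a ⊗ₜ[K] (1 : S)) • w ∈ P) (hJ : ∀ b ∈ J, ((1 : R) ⊗ₜ[K] b) • w ∈ P)
    {c : Fin r → ℕ} (hrI : ∀ d, ∀ a ∈ 𝓡 d, a ∉ I → ∃ k : ℕ, d = k • c)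
    (hrJ : ∀ d, ∀ b ∈ 𝓢 d, b ∉ J → ∃ k : ℕ, d = k • c)
    {C : ℕ → Submodule K R} {C' : ℕ → Submodule K S} (hC : ∀ k, C k ≤ 𝓡 (k • c))
    (hC₂ : ∀ k, ∀ a ∈ 𝓡 (k • c), ∃ b ∈ C k, a - b ∈ I)
    (hC' : ∀ k, C' k ≤ 𝓢 (k • c)) (hC'₂ : ∀ k, ∀ a ∈ 𝓢 (k • c), ∃ b ∈ C' k, a - b ∈ J)
    {d : Fin r → ℤ} (hd : ∀ k : ℕ, natToInt (k • c) + e ≠ d) :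
    hilbertSeries (tensorGrading 𝓜 𝓝) (P ⊔ Submodule.span (R ⊗[K] S) {w}) d =
      hilbertSeries (tensorGrading 𝓜 𝓝) P d := by
  refine hilbertSeries_congr le_sup_left fun q hq hqd => ?_
  have h1 := mem_inf_sup_of_mem_sup_span hM hN hT hP hw (U := ⊥) (fun δ hδ τ hτ => ?_) hq hqd
  · rw [sup_bot_eq] at h1
    exact h1.1
  · have h2 := smul_mem_inf_sup_iSup hM hN hw hI hJ hrI hrJ hC hC₂ hC' hC'₂ hτ
    rw [hδ] at h2
    refine SetLike.le_def.1 (sup_le_sup_left ?_ _) h2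
    refine iSup₂_le fun l hl => ?_
    exact absurd (hl ▸ hδ) (hd l)

theorem hilbertSeries_sup_span_le (hM : IsGradedModule 𝓡 𝓜) (hN : IsGradedModule 𝓢 𝓝)
    (hT : iSup (tensorGrading 𝓡 𝓢) = ⊤)
    {P : Submodule (R ⊗[K] S) (M ⊗[K] N)} (hP : IsGradedSubmodule (tensorGrading 𝓜 𝓝) P)
    {e : Fin r → ℤ} {w : M ⊗[K] N} (hw : w ∈ tensorGrading 𝓜 𝓝 e) {I : Ideal R} {J : Ideal S}
    (hI : ∀ a ∈ I, (a ⊗ₜ[K] (1 : S)) • w ∈ P) (hJ : ∀ b ∈ J, ((1 : R) ⊗ₜ[K] b) • w ∈ P)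
    {c : Fin r → ℕ} (hrI : ∀ d, ∀ a ∈ 𝓡 d, a ∉ I → ∃ k : ℕ, d = k • c)
    (hrJ : ∀ d, ∀ b ∈ 𝓢 d, b ∉ J → ∃ k : ℕ, d = k • c)
    {C : ℕ → Submodule K R} {C' : ℕ → Submodule K S} (hC : ∀ k, C k ≤ 𝓡 (k • c))
    (hC₂ : ∀ k, ∀ a ∈ 𝓡 (k • c), ∃ b ∈ C k, a - b ∈ I)
    (hC' : ∀ k, C' k ≤ 𝓢 (k • c)) (hC'₂ : ∀ k, ∀ a ∈ 𝓢 (k • c), ∃ b ∈ C' k, a - b ∈ J)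
    (hfC : ∀ k, Module.Finite K (C k)) (hfC' : ∀ k, Module.Finite K (C' k))
    (hfV : ∀ d, Module.Finite K (tensorGrading 𝓜 𝓝 d)) (hc : c ≠ 0) (k : ℕ) :
    hilbertSeries (tensorGrading 𝓜 𝓝) (P ⊔ Submodule.span (R ⊗[K] S) {w})
        (natToInt (k • c) + e) ≤
      hilbertSeries (tensorGrading 𝓜 𝓝) P (natToInt (k • c) + e) +
        ∑ ij ∈ Finset.HasAntidiagonal.antidiagonal k,
          (Module.finrank K (C ij.1) : ℚ) * Module.finrank K (C' ij.2) := by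
  set d := natToInt (k • c) + e with hd
  let U : Submodule K (M ⊗[K] N) := ⨆ ij ∈ Finset.HasAntidiagonal.antidiagonal k,
    tensorSmul (C ij.1) (C' ij.2) w
  have hfU : ∀ ij : ℕ × ℕ, Module.Finite K (tensorSmul (C ij.1) (C' ij.2) w) :=
    fun ij => finite_tensorSmul _ _ w
  have hfU' : Module.Finite K U := by
    have hU : U = (Finset.HasAntidiagonal.antidiagonal k).sup fun ij : ℕ × ℕ =>
        tensorSmul (C ij.1) (C' ij.2) w := (Finset.sup_eq_iSup _ _).symm
    rw [hU]
    infer_instance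
  have := hfV d
  have hfP : Module.Finite K ↥(P.restrictScalars K ⊓ tensorGrading 𝓜 𝓝 d) :=
    Submodule.finiteDimensional_of_le inf_le_right
  have hsub : (P ⊔ Submodule.span (R ⊗[K] S) {w}).restrictScalars K ⊓ tensorGrading 𝓜 𝓝 d ≤
      (P.restrictScalars K ⊓ tensorGrading 𝓜 𝓝 d) ⊔ U := by
    rintro q ⟨hq, hqd⟩
    refine mem_inf_sup_of_mem_sup_span hM hN hT hP hw (fun δ hδ τ hτ => ?_) hq hqd
    have h2 := smul_mem_inf_sup_iSup hM hN hw hI hJ hrI hrJ hC hC₂ hC' hC'₂ hτ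
    have hδ' : δ = k • c := natToInt_injective (add_right_cancel (hδ.trans hd))
    rw [hδ] at h2
    refine SetLike.le_def.1 (sup_le_sup_left ?_ _) h2
    refine iSup₂_le fun l hl => ?_
    have hkl : l = k := nsmul_left_injective_of_ne_zero hc (hl.symm.trans hδ')
    rw [hkl]
  have h3 := (Submodule.finrank_mono hsub).trans
    (Submodule.finrank_add_le_finrank_add_finrank _ _)
  have h4 := finrank_biSup_le_sum (fun ij : ℕ × ℕ => tensorSmul (C ij.1) (C' ij.2) w)
    (Finset.HasAntidiagonal.antidiagonal k)
  have h5 : (∑ ij ∈ Finset.HasAntidiagonal.antidiagonal k,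
      Module.finrank K (tensorSmul (C ij.1) (C' ij.2) w) : ℕ) ≤
      ∑ ij ∈ Finset.HasAntidiagonal.antidiagonal k,
        Module.finrank K (C ij.1) * Module.finrank K (C' ij.2) :=
    Finset.sum_le_sum fun ij _ => finrank_tensorSmul_le _ _ w
  have h7 := h3.trans (Nat.add_le_add_left (h4.trans h5) _)
  simp only [hilbertSeries]
  exact_mod_cast h7

theorem smul_mem_of_mem_sup_span {T V : Type*} [CommRing T] [AddCommGroup V] [Module T V]
    {P : Submodule T V} {w z : V} {τ : T} (hτ : τ • w ∈ P) (hz : z ∈ P ⊔ Submodule.span T {w}) :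
    τ • z ∈ P := by
  have hle : P ⊔ Submodule.span T {w} ≤ P.comap (LinearMap.lsmul T V τ) := by
    refine sup_le (fun q hq => P.smul_mem τ hq) ?_
    rw [Submodule.span_singleton_le_iff_mem]
    exact hτ
  exact hle hz

variable [GradedAlgebra 𝓡] [GradedAlgebra 𝓢] {s s' : Fin r → ℤ}
  {ι ι' : Type*} {x : ι → R} {δ : ι → Fin r → ℕ} {y : ι' → S} {δ' : ι' → Fin r → ℕ}

theorem isLocalDenom_of_ray [IsNoetherian R M] [IsNoetherian S N]
    [IsNoetherian (R ⊗[K] S) (M ⊗[K] N)] [Finite ι] [Finite ι']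
    (hM : IsFiniteGraded 𝓡 𝓜 s x δ) (hN : IsFiniteGraded 𝓢 𝓝 s' y δ')
    (hV : IsFiniteGraded (tensorGrading 𝓡 𝓢) (tensorGrading 𝓜 𝓝) (s + s')
      (Sum.elim (fun i => x i ⊗ₜ[K] (1 : S)) fun j => (1 : R) ⊗ₜ[K] y j) (Sum.elim δ δ'))
    {B B' : MvPolynomial (Fin r) ℚ}
    (hB : ∀ P : Submodule R M, IsGradedSubmodule 𝓜 P →
        (B : MvPowerSeries (Fin r) ℚ) * hser 𝓜 s P ∈ polys r)
    (hB' : ∀ Q : Submodule S N, IsGradedSubmodule 𝓝 Q →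
        (B' : MvPowerSeries (Fin r) ℚ) * hser 𝓝 s' Q ∈ polys r)
    {p : MvPolynomial (Fin r) ℚ} (hp : Prime p) {c : Fin r → ℕ} (hc : c ≠ 0)
    (hpc : p ∣ 1 - tpow c)
    {I : Ideal R} (hI : I.IsHomogeneous 𝓡) (hI1 : (1 : R) ∉ I)
    {J : Ideal S} (hJ : J.IsHomogeneous 𝓢) (hJ1 : (1 : S) ∉ J)
    {e : Fin r → ℤ} {m : M} (hm : m ∈ 𝓜 e) (hmI : ∀ d, ∀ a ∈ 𝓡 d, a • m = 0 → a ∈ I)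
    {e' : Fin r → ℤ} {n : N} (hn : n ∈ 𝓝 e') (hnJ : ∀ d, ∀ b ∈ 𝓢 d, b • n = 0 → b ∈ J)
    (hrI : ∀ d, ∀ a ∈ 𝓡 d, a ∉ I → ∃ k : ℕ, d = k • c)
    (hrJ : ∀ d, ∀ b ∈ 𝓢 d, b ∉ J → ∃ k : ℕ, d = k • c)
    {P₁ P₂ : Submodule (R ⊗[K] S) (M ⊗[K] N)} (hle : P₁ ≤ P₂)
    (h₁ : IsGradedSubmodule (tensorGrading 𝓜 𝓝) P₁)
    (h₂ : IsGradedSubmodule (tensorGrading 𝓜 𝓝) P₂)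
    (hIP : ∀ a ∈ I, ∀ q ∈ P₂, (a ⊗ₜ[K] (1 : S)) • q ∈ P₁)
    (hJP : ∀ b ∈ J, ∀ q ∈ P₂, ((1 : R) ⊗ₜ[K] b) • q ∈ P₁) :
    IsLocalDenom p (B * B') (hser (tensorGrading 𝓜 𝓝) (s + s') P₂ -
      hser (tensorGrading 𝓜 𝓝) (s + s') P₁) := by
  classical
  obtain ⟨f, e₁, C, n₁, m₁, hf0, hf, hBf, hn₁, hDf, hC⟩ :=
    hM.exists_ray_series hB hI hI1 hm hmI hrI
  obtain ⟨g, e₂, C', n₂, m₂, hg0, hg, hBg, hn₂, hDg, hC'⟩ :=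
    hN.exists_ray_series hB' hJ hJ1 hn hnJ hrJ
  have := Fintype.ofFinite ι
  have := Fintype.ofFinite ι'
  -- The generators of the irrelevant ideal of `R ⊗ S` that come from neither `I` nor `J`; their
  -- degrees lie on the ray ℕc.
  let A : Finset (ι ⊕ ι') := Finset.univ.filter
    fun i => Sum.elim (fun i => x i ∉ I) (fun j => y j ∉ J) i
  obtain ⟨n₃, hn₃, hdvd⟩ := exists_prod_dvd_one_sub_pow (δ := Sum.elim δ δ') (c := c) A (by
    intro i hi
    refine ⟨hV.irrelevant.ne_zero i, ?_⟩
    have hi' := (Finset.mem_filter.1 hi).2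
    cases i with
    | inl i => exact hrI _ _ (hM.irrelevant.mem i) hi'
    | inr j => exact hrJ _ _ (hN.irrelevant.mem j) hi')
  -- `P₂` is built from `P₁` by adjoining one homogeneous generator at a time, and each successive
  -- quotient is cyclic and killed by `I` and `J`.
  have step : ∀ P : Submodule (R ⊗[K] S) (M ⊗[K] N), P₁ ≤ P →
      IsGradedSubmodule (tensorGrading 𝓜 𝓝) P → ∀ w ∈ P₂, ∀ d, w ∈ tensorGrading 𝓜 𝓝 d →
      IsLocalDenom p (B * B') (hser (tensorGrading 𝓜 𝓝) (s + s')
        (P ⊔ Submodule.span (R ⊗[K] S) {w}) - hser (tensorGrading 𝓜 𝓝) (s + s') P) := by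
    intro P hP₁ hP w hw₂ d hwd
    by_cases hw0 : w = 0
    · rw [hw0, Submodule.span_singleton_eq_bot.2 rfl, sup_bot_eq, sub_self]
      exact IsLocalDenom.zero hp
    obtain ⟨e₃, rfl⟩ := exists_eq_add_natToInt (hV.lower d fun hbot => hw0 (by
      rwa [hbot, Submodule.mem_bot] at hwd))
    have hQ : IsGradedSubmodule (tensorGrading 𝓜 𝓝) (P ⊔ Submodule.span (R ⊗[K] S) {w}) :=
      hP.sup hV.graded.isInternal (isGradedSubmodule_span hV.graded hV.iSup_eq_top (by
        rintro _ rfl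
        exact ⟨_, hwd⟩))
    have hIw : ∀ a ∈ I, (a ⊗ₜ[K] (1 : S)) • w ∈ P := fun a ha => hP₁ (hIP a ha w hw₂)
    have hJw : ∀ b ∈ J, ((1 : R) ⊗ₜ[K] b) • w ∈ P := fun b hb => hP₁ (hJP b hb w hw₂)
    -- These `n` and `m` are a common multiple and an upper bound, so that one power of `1 - t^(nc)`
    -- clears `f` and `g`, and its square clears `h`.
    refine isLocalDenom_of_coeff_le hp hc hpc (n := n₁ * n₂ * n₃) (m := m₁ + m₂ + A.card)
      (mul_ne_zero (mul_ne_zero hn₁ hn₂) hn₃) hf hg (e₃ := e₃) ?_ hf0 hg0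
      (hDf _ ((dvd_mul_right _ _).trans (dvd_mul_right _ _)) _ (by omega))
      (hDg _ ((dvd_mul_left _ _).trans (dvd_mul_right _ _)) _ (by omega)) ?_ ?_ ?_ hBf hBg
    · intro k hk
      by_contra hne
      apply hk
      rw [map_sub, coeff_hser, coeff_hser, sub_eq_zero]
      refine hilbertSeries_sup_span_eq hM.graded hN.graded hV.iSup_eq_top hP hwd hIw hJw hrI hrJ
        (fun k => (hC k).1) (fun k => (hC k).2.1) (fun k => (hC' k).1) (fun k => (hC' k).2.1)
        fun l hl => hne ⟨l, natToInt_injective ?_⟩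
      rw [natToInt_add]
      refine add_left_cancel (a := s + s') ?_
      rw [← hl]
      abel
    · obtain ⟨q, hq⟩ := hdvd (n₁ * n₂ * n₃) (dvd_mul_left _ _)
        (m₁ + m₂ + A.card + (m₁ + m₂ + A.card)) (by omega)
      rw [hq, mul_comm (∏ i ∈ A, _) q, MvPolynomial.coe_mul, mul_assoc]
      refine Subring.mul_mem _ (coe_mem_polys q) (hV.irrelevant.prod_mul_hser_mem hV.graded
        hV.finite hV.lower A le_sup_left hP hQ fun i hi z hz => ?_)
      refine smul_mem_of_mem_sup_span ?_ hz
      have hi' : ¬ Sum.elim (fun i => x i ∉ I) (fun j => y j ∉ J) i := fun h =>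
        hi (Finset.mem_filter.2 ⟨Finset.mem_univ i, h⟩)
      cases i with
      | inl i => exact hIw _ (not_not.1 hi')
      | inr j => exact hJw _ (not_not.1 hi')
    · intro k
      rw [map_sub, sub_nonneg]
      exact hilbertSeries_mono hV.finite le_sup_left _
    · intro k
      have hdeg : s + s' + natToInt (Finsupp.equivFunOnFinite.symm
          ((e₃ : Fin r → ℕ) + k • c)) = natToInt (k • c) + (s + s' + natToInt e₃) := by
        change s + s' + natToInt ((e₃ : Fin r → ℕ) + k • c) = _
        rw [natToInt_add]
        abel
      rw [map_sub, coeff_hser, coeff_hser, hdeg, sub_le_iff_le_add']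
      refine (hilbertSeries_sup_span_le hM.graded hN.graded hV.iSup_eq_top hP hwd hIw hJw hrI hrJ
        (fun k => (hC k).1) (fun k => (hC k).2.1) (fun k => (hC' k).1) (fun k => (hC' k).2.1)
        (fun k => (hC k).2.2.1) (fun k => (hC' k).2.2.1) hV.finite hc k).trans
        (add_le_add_right (Finset.sum_le_sum fun ij _ => ?_) _)
      exact mul_le_mul (hC _).2.2.2 (hC' _).2.2.2 (Nat.cast_nonneg _)
        ((Nat.cast_nonneg _).trans (hC _).2.2.2)
  obtain ⟨X, hX, hspan⟩ := exists_finset_span_eq hV.graded.isInternal h₂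
  have hmain : ∀ Y : Finset (M ⊗[K] N), Y ⊆ X →
      IsGradedSubmodule (tensorGrading 𝓜 𝓝) (P₁ ⊔ Submodule.span (R ⊗[K] S) (Y : Set _)) ∧
      IsLocalDenom p (B * B') (hser (tensorGrading 𝓜 𝓝) (s + s')
        (P₁ ⊔ Submodule.span (R ⊗[K] S) (Y : Set _)) -
          hser (tensorGrading 𝓜 𝓝) (s + s') P₁) := by
    intro Y
    induction Y using Finset.induction_on with
    | empty =>
      intro _
      rw [Finset.coe_empty, Submodule.span_empty, sup_bot_eq, sub_self]
      exact ⟨h₁, IsLocalDenom.zero hp⟩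
    | insert w Y _ ih =>
      intro hY
      obtain ⟨ih1, ih2⟩ := ih ((Finset.subset_insert w Y).trans hY)
      have hwX : w ∈ X := hY (Finset.mem_insert_self w Y)
      obtain ⟨d, hd⟩ := hX w hwX
      have hw₂ : w ∈ P₂ := hspan ▸ Submodule.subset_span hwX
      have heq : P₁ ⊔ Submodule.span (R ⊗[K] S) ((insert w Y : Finset _) : Set _) =
          (P₁ ⊔ Submodule.span (R ⊗[K] S) (Y : Set _)) ⊔
            Submodule.span (R ⊗[K] S) {w} := by
        rw [Finset.coe_insert, Submodule.span_insert, sup_assoc, sup_comm (Submodule.span _ {w})]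
      rw [heq]
      refine ⟨ih1.sup hV.graded.isInternal (isGradedSubmodule_span hV.graded hV.iSup_eq_top (by
        rintro _ rfl
        exact ⟨_, hd⟩)), ?_⟩
      have h3 := (step _ le_sup_left ih1 w hw₂ d hd).add hp ih2
      rwa [sub_add_sub_cancel] at h3
  have h4 := (hmain X (Finset.Subset.refl X)).2
  rwa [hspan, sup_eq_right.2 hle] at h4

end TensorRay

/-! ### Reduction to rays -/

section Kills

variable {R T V : Type*} [CommRing R] [CommRing T] [AddCommGroup V] [Module T V]

/-- `φ(I)` kills the subquotient `P₂ / P₁`. -/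
def Kills (φ : R →+* T) (I : Ideal R) (P₁ P₂ : Submodule T V) : Prop :=
  ∀ a ∈ I, ∀ q ∈ P₂, φ a • q ∈ P₁

theorem Kills.mono {φ : R →+* T} {I : Ideal R} {P₁ P₂ Q₁ Q₂ : Submodule T V}
    (h : Kills φ I P₁ P₂) (h₁ : P₁ ≤ Q₁) (h₂ : Q₂ ≤ P₂) : Kills φ I Q₁ Q₂ :=
  fun a ha q hq => h₁ (h a ha q (h₂ hq))

theorem Kills.sup_span {φ : R →+* T} {I : Ideal R} {P₁ P₂ : Submodule T V}
    (h : Kills φ I P₁ P₂) {a : R} (ha : ∀ q ∈ P₂, φ a • q ∈ P₁) :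
    Kills φ (I ⊔ Ideal.span {a}) P₁ P₂ := by
  intro b hb q hq
  let L : Ideal R := Ideal.comap φ (P₁.comap (LinearMap.toSpanSingleton T V q))
  have hle : I ⊔ Ideal.span {a} ≤ L := by
    refine sup_le (fun b hb => h b hb q hq) ?_
    rw [Ideal.span_singleton_le_iff_mem]
    exact ha q hq
  exact hle hb

end Kills

section Reduction

variable {K R S T V : Type*} [Field K] [CommRing R] [Algebra K R] [CommRing S]
  [CommRing T] [Algebra K T] [AddCommGroup V] [Module K V] [Module T V] [IsScalarTower K T V]
  {r : ℕ} {𝓡 : (Fin r → ℕ) → Submodule K R} [GradedAlgebra 𝓡]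
  {𝓣 : (Fin r → ℕ) → Submodule K T} {𝓥 : (Fin r → ℤ) → Submodule K V}
  {s : Fin r → ℤ} {ι : Type*} {x : ι → T} {δ : ι → Fin r → ℕ}

/-- A noetherian induction reduces local denominators of subquotients killed by `I` to the case
where `I` is prime and the degrees occurring in `R / I` are those `d` with `p ∣ 1 - t^d`. -/
theorem isLocalDenom_or_prime {p X : MvPolynomial (Fin r) ℚ} (hp : Prime p)
    (hV : IsFiniteGraded 𝓣 𝓥 s x δ) {φ : R →+* T} (hφ : ∀ d, ∀ a ∈ 𝓡 d, φ a ∈ 𝓣 d)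
    {ψ : S →+* T} {I : Ideal R} {J : Ideal S} (hI : I.IsHomogeneous 𝓡)
    (ih : ∀ I', I < I' → I'.IsHomogeneous 𝓡 → ∀ P₁ P₂ : Submodule T V, P₁ ≤ P₂ →
      IsGradedSubmodule 𝓥 P₁ → IsGradedSubmodule 𝓥 P₂ → Kills φ I' P₁ P₂ → Kills ψ J P₁ P₂ →
      IsLocalDenom p X (hser 𝓥 s P₂ - hser 𝓥 s P₁))
    {P₁ P₂ : Submodule T V} (hle : P₁ ≤ P₂) (h₁ : IsGradedSubmodule 𝓥 P₁)
    (h₂ : IsGradedSubmodule 𝓥 P₂) (hIP : Kills φ I P₁ P₂) (hJP : Kills ψ J P₁ P₂) :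
    IsLocalDenom p X (hser 𝓥 s P₂ - hser 𝓥 s P₁) ∨
      (∀ d, ∀ a ∈ 𝓡 d, a ∉ I → p ∣ 1 - tpow d) ∧
      (∀ d e, ∀ a ∈ 𝓡 d, ∀ b ∈ 𝓡 e, a * b ∈ I → a ∈ I ∨ b ∈ I) ∧
      (∀ d, ∀ a ∈ 𝓡 d, (∀ v : V, φ a • v = 0) → a ∈ I) := by
  by_cases hloc : IsLocalDenom p X (hser 𝓥 s P₂ - hser 𝓥 s P₁)
  · exact Or.inl hloc
  -- A subquotient of `P₂/P₁` killed by a homogeneous `a ∉ I` is killed by the strictly larger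
  -- homogeneous ideal `I + (a)`.
  have ih' : ∀ d, ∀ a ∈ 𝓡 d, a ∉ I → ∀ Q₁ Q₂ : Submodule T V, P₁ ≤ Q₁ → Q₂ ≤ P₂ → Q₁ ≤ Q₂ →
      IsGradedSubmodule 𝓥 Q₁ → IsGradedSubmodule 𝓥 Q₂ → (∀ q ∈ Q₂, φ a • q ∈ Q₁) →
      IsLocalDenom p X (hser 𝓥 s Q₂ - hser 𝓥 s Q₁) := by
    intro d a ha haI Q₁ Q₂ hPQ₁ hPQ₂ hQ hQ₁ hQ₂ hkill
    refine ih (I ⊔ Ideal.span {a}) ?_ ?_ Q₁ Q₂ hQ hQ₁ hQ₂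
      ((hIP.mono hPQ₁ hPQ₂).sup_span hkill) (hJP.mono hPQ₁ hPQ₂)
    · refine lt_of_le_of_ne le_sup_left fun h => haI ?_
      rw [h]
      exact Ideal.mem_sup_right (Ideal.mem_span_singleton_self a)
    · refine hI.sup (Ideal.homogeneous_span 𝓡 {a} ?_)
      rintro _ rfl
      exact ⟨d, ha⟩
  have hmap : ∀ d, ∀ a ∈ 𝓡 d,
      IsGradedSubmodule 𝓥 (P₁ ⊔ P₂.map (LinearMap.lsmul T V (φ a))) := fun d a ha =>
    h₁.sup hV.graded.isInternal (IsGradedSubmodule.map_lsmul hV.graded h₂ (hφ d a ha))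
  have hmap_le : ∀ a : R, P₁ ⊔ P₂.map (LinearMap.lsmul T V (φ a)) ≤ P₂ := by
    refine fun a => sup_le hle ?_
    rintro _ ⟨q, hq, rfl⟩
    exact P₂.smul_mem _ hq
  refine Or.inr ⟨fun d a ha haI => ?_, fun d e a ha b hb hab => ?_, fun d a ha hkill => ?_⟩
  -- If `p ∤ 1 - t^d`, this factor may be cleared for free, and the kernel and cokernel of `a` fall
  -- under `ih'`.
  · by_contra hpd
    refine hloc (IsLocalDenom.of_coe_mul hp hpd ?_)
    rw [hser_smul hV.graded hV.finite hV.lower h₁ h₂ (hφ d a ha)]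
    refine IsLocalDenom.sub hp ?_ (IsLocalDenom.coe_mul ?_ _)
    · exact ih' d a ha haI _ _ le_sup_left le_rfl (hmap_le a) (hmap d a ha) h₂
        fun q hq => Submodule.mem_sup_right ⟨q, hq, rfl⟩
    · exact ih' d a ha haI _ _ le_rfl inf_le_left (le_inf hle fun q hq => P₁.smul_mem _ hq) h₁
        (h₂.inf hV.graded.isInternal (IsGradedSubmodule.comap_lsmul hV.graded h₁ (hφ d a ha)))
        fun q hq => hq.2
  -- In the filtration `P₁ ≤ P₁ + a P₂ ≤ P₂`, the upper quotient is killed by `a` and the lower one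
  -- by `b`, since `a b ∈ I`.
  · by_contra! hnot
    apply hloc
    have h3 := (ih' d a ha hnot.1 _ _ le_sup_left le_rfl (hmap_le a) (hmap d a ha) h₂
        fun q hq => Submodule.mem_sup_right ⟨q, hq, rfl⟩).add hp
      (ih' e b hb hnot.2 _ _ le_rfl (hmap_le a) le_sup_left h₁ (hmap d a ha) fun q hq => ?_)
    · rwa [sub_add_sub_cancel] at h3
    · obtain ⟨q₁, hq₁, _, ⟨q₂, hq₂, rfl⟩, rfl⟩ := Submodule.mem_sup.1 hq
      rw [smul_add]
      refine P₁.add_mem (P₁.smul_mem _ hq₁) ?_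
      have h4 := hIP _ hab q₂ hq₂
      rwa [mul_comm, map_mul, mul_smul] at h4
  · by_contra haI
    refine hloc (ih' d a ha haI _ _ le_rfl le_rfl hle h₁ h₂ fun q _ => ?_)
    rw [hkill]
    exact P₁.zero_mem

/-- Over a noetherian graded ring a homogeneous prime containing the annihilator of `M` contains
the annihilator of a homogeneous element of `M`. -/
theorem exists_homogeneous_annihilator_le {M : Type*} [AddCommGroup M] [Module K M] [Module R M]
    [IsScalarTower K R M] [IsNoetherian R M] {𝓜 : (Fin r → ℤ) → Submodule K M}
    (hM : IsGradedModule 𝓡 𝓜) {I : Ideal R} (h1 : (1 : R) ∉ I)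
    (hprime : ∀ d e, ∀ a ∈ 𝓡 d, ∀ b ∈ 𝓡 e, a * b ∈ I → a ∈ I ∨ b ∈ I)
    (hann : ∀ d, ∀ a ∈ 𝓡 d, (∀ m : M, a • m = 0) → a ∈ I) :
    ∃ e, ∃ m ∈ 𝓜 e, ∀ d, ∀ a ∈ 𝓡 d, a • m = 0 → a ∈ I := by
  by_contra! hcon
  obtain ⟨X, hX, hspan⟩ := exists_finset_span_eq hM.isInternal
    (IsGradedSubmodule.top (R := R) hM.isInternal)
  -- Otherwise each homogeneous generator is killed by some homogeneous element outside `I`. By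
  -- primality the product of these elements is outside `I`, yet it kills all of `M`.
  have key : ∀ Y : Finset M, Y ⊆ X → ∃ d, ∃ a ∈ 𝓡 d, a ∉ I ∧ ∀ m ∈ Y, a • m = 0 := by
    classical
    intro Y
    induction Y using Finset.induction_on with
    | empty => exact fun _ => ⟨0, 1, SetLike.GradedOne.one_mem, h1, by simp⟩
    | insert m Y _ ih =>
      intro hY
      obtain ⟨d, a, ha, haI, hkill⟩ := ih ((Finset.subset_insert m Y).trans hY)
      obtain ⟨e, hm⟩ := hX m (hY (Finset.mem_insert_self m Y))
      obtain ⟨d', b, hb, hbm, hbI⟩ := hcon e m hm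
      refine ⟨d + d', a * b, SetLike.GradedMul.mul_mem ha hb, fun hab => ?_, fun n hn => ?_⟩
      · exact (hprime d d' a ha b hb hab).elim haI hbI
      · rcases Finset.mem_insert.1 hn with rfl | hn
        · rw [mul_smul, hbm, smul_zero]
        · rw [mul_comm, mul_smul, hkill n hn, smul_zero]
  obtain ⟨d, a, ha, haI, hkill⟩ := key X (Finset.Subset.refl X)
  refine haI (hann d a ha fun m => ?_)
  have hm : m ∈ Submodule.span R (X : Set M) := hspan ▸ Submodule.mem_top
  have hle : Submodule.span R (X : Set M) ≤ LinearMap.ker (LinearMap.lsmul R M a) :=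
    Submodule.span_le.2 fun n hn => hkill n hn
  exact hle hm

end Reduction

/-! ### The universal denominator of a tensor product -/

section TensorDenominator

variable {K R S M N : Type*} [Field K] [CommRing R] [Algebra K R] [CommRing S] [Algebra K S]
  [AddCommGroup M] [Module K M] [Module R M] [IsScalarTower K R M]
  [AddCommGroup N] [Module K N] [Module S N] [IsScalarTower K S N] {r : ℕ}
  {𝓡 : (Fin r → ℕ) → Submodule K R} {𝓢 : (Fin r → ℕ) → Submodule K S}
  {𝓜 : (Fin r → ℤ) → Submodule K M} {𝓝 : (Fin r → ℤ) → Submodule K N}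
  {s s' : Fin r → ℤ} {ι ι' : Type*} {x : ι → R} {δ : ι → Fin r → ℕ}
  {y : ι' → S} {δ' : ι' → Fin r → ℕ}

theorem tmul_one_smul_eq_zero {a : R} (h : ∀ m : M, a • m = 0) (v : M ⊗[K] N) :
    (a ⊗ₜ[K] (1 : S)) • v = 0 := by
  induction v with
  | zero => rw [smul_zero]
  | add v w hv hw => rw [smul_add, hv, hw, add_zero]
  | tmul m n => rw [tmul_smul_tmul, h, TensorProduct.zero_tmul]

theorem one_tmul_smul_eq_zero {b : S} (h : ∀ n : N, b • n = 0) (v : M ⊗[K] N) :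
    ((1 : R) ⊗ₜ[K] b) • v = 0 := by
  induction v with
  | zero => rw [smul_zero]
  | add v w hv hw => rw [smul_add, hv, hw, add_zero]
  | tmul m n => rw [tmul_smul_tmul, h, TensorProduct.tmul_zero]

theorem tmul_one_mem_tensorGrading [GradedAlgebra 𝓢] {d : Fin r → ℕ} {a : R} (ha : a ∈ 𝓡 d) :
    a ⊗ₜ[K] (1 : S) ∈ tensorGrading 𝓡 𝓢 d := by
  have h := tmul_mem_tensorGrading ha (SetLike.GradedOne.one_mem (A := 𝓢))
  rwa [add_zero] at h

theorem one_tmul_mem_tensorGrading [GradedAlgebra 𝓡] {d : Fin r → ℕ} {b : S} (hb : b ∈ 𝓢 d) :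
    (1 : R) ⊗ₜ[K] b ∈ tensorGrading 𝓡 𝓢 d := by
  have h := tmul_mem_tensorGrading (SetLike.GradedOne.one_mem (A := 𝓡)) hb
  rwa [zero_add] at h

/-- The Noetherian induction on pairs `(I, J)`, started at `(0, 0)`, which kills every subquotient.
Enlarging either ideal is a step up in the product order, so `isLocalDenom_or_prime` can be used
once for each factor. -/
theorem isLocalDenom_tensor [GradedAlgebra 𝓡] [GradedAlgebra 𝓢]
    [IsNoetherianRing R] [IsNoetherianRing S] [IsNoetherian R M] [IsNoetherian S N]
    [IsNoetherian (R ⊗[K] S) (M ⊗[K] N)] [Finite ι] [Finite ι']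
    (hM : IsFiniteGraded 𝓡 𝓜 s x δ) (hN : IsFiniteGraded 𝓢 𝓝 s' y δ')
    (hV : IsFiniteGraded (tensorGrading 𝓡 𝓢) (tensorGrading 𝓜 𝓝) (s + s')
      (Sum.elim (fun i => x i ⊗ₜ[K] (1 : S)) fun j => (1 : R) ⊗ₜ[K] y j) (Sum.elim δ δ'))
    {B B' : MvPolynomial (Fin r) ℚ}
    (hB : ∀ P : Submodule R M, IsGradedSubmodule 𝓜 P →
        (B : MvPowerSeries (Fin r) ℚ) * hser 𝓜 s P ∈ polys r)
    (hB' : ∀ Q : Submodule S N, IsGradedSubmodule 𝓝 Q →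
        (B' : MvPowerSeries (Fin r) ℚ) * hser 𝓝 s' Q ∈ polys r)
    {p : MvPolynomial (Fin r) ℚ} (hp : Prime p)
    {P₁ P₂ : Submodule (R ⊗[K] S) (M ⊗[K] N)} (hle : P₁ ≤ P₂)
    (h₁ : IsGradedSubmodule (tensorGrading 𝓜 𝓝) P₁)
    (h₂ : IsGradedSubmodule (tensorGrading 𝓜 𝓝) P₂) :
    IsLocalDenom p (B * B') (hser (tensorGrading 𝓜 𝓝) (s + s') P₂ -
      hser (tensorGrading 𝓜 𝓝) (s + s') P₁) := by
  let φ : R →+* R ⊗[K] S := Algebra.TensorProduct.includeLeftRingHom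
  let ψ : S →+* R ⊗[K] S := (Algebra.TensorProduct.includeRight : S →ₐ[K] R ⊗[K] S).toRingHom
  suffices ∀ IJ : Ideal R × Ideal S, IJ.1.IsHomogeneous 𝓡 → IJ.2.IsHomogeneous 𝓢 →
      ∀ P₁ P₂ : Submodule (R ⊗[K] S) (M ⊗[K] N), P₁ ≤ P₂ →
      IsGradedSubmodule (tensorGrading 𝓜 𝓝) P₁ → IsGradedSubmodule (tensorGrading 𝓜 𝓝) P₂ →
      Kills φ IJ.1 P₁ P₂ → Kills ψ IJ.2 P₁ P₂ →
      IsLocalDenom p (B * B') (hser (tensorGrading 𝓜 𝓝) (s + s') P₂ -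
        hser (tensorGrading 𝓜 𝓝) (s + s') P₁) by
    refine this (⊥, ⊥) (Ideal.IsHomogeneous.bot 𝓡) (Ideal.IsHomogeneous.bot 𝓢) P₁ P₂ hle h₁ h₂
      (fun a ha q _ => ?_) fun b hb q _ => ?_
    · rw [(Submodule.mem_bot R).1 ha, map_zero, zero_smul]
      exact P₁.zero_mem
    · rw [(Submodule.mem_bot S).1 hb, map_zero, zero_smul]
      exact P₁.zero_mem
  intro IJ
  induction IJ using WellFoundedGT.induction with
  | ind IJ ih =>
  obtain ⟨I, J⟩ := IJ
  intro hI hJ P₁ P₂ hle h₁ h₂ hIP hJP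
  have htriv : P₂ ≤ P₁ → IsLocalDenom p (B * B') (hser (tensorGrading 𝓜 𝓝) (s + s') P₂ -
      hser (tensorGrading 𝓜 𝓝) (s + s') P₁) := by
    intro h
    rw [le_antisymm hle h, sub_self]
    exact IsLocalDenom.zero hp
  by_cases hI1 : (1 : R) ∈ I
  · exact htriv fun q hq => by simpa using hIP 1 hI1 q hq
  by_cases hJ1 : (1 : S) ∈ J
  · exact htriv fun q hq => by simpa using hJP 1 hJ1 q hq
  rcases isLocalDenom_or_prime (φ := φ) (ψ := ψ) (X := B * B') hp hV
    (fun d a ha => tmul_one_mem_tensorGrading ha) hI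
    (fun I' hlt hI' Q₁ Q₂ hQ hQ₁ hQ₂ hk hk' => ih (I', J) (Prod.mk_lt_mk_iff_left.2 hlt) hI' hJ
      Q₁ Q₂ hQ hQ₁ hQ₂ hk hk') hle h₁ h₂ hIP hJP with hloc | ⟨hrI, hprI, hannI⟩
  · exact hloc
  rcases isLocalDenom_or_prime (φ := ψ) (ψ := φ) (X := B * B') hp hV
    (fun d b hb => one_tmul_mem_tensorGrading hb) hJ
    (fun J' hlt hJ' Q₁ Q₂ hQ hQ₁ hQ₂ hk hk' => ih (I, J') (Prod.mk_lt_mk_iff_right.2 hlt) hI hJ'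
      Q₁ Q₂ hQ hQ₁ hQ₂ hk' hk) hle h₁ h₂ hJP hIP with hloc | ⟨hrJ, hprJ, hannJ⟩
  · exact hloc
  by_cases hd : ∃ d : Fin r → ℕ, d ≠ 0 ∧ p ∣ 1 - tpow d
  · obtain ⟨d, hd0, hpd⟩ := hd
    obtain ⟨c, hc, hpc, hray⟩ := exists_generator_of_prime_dvd hp hpd hd0
    -- A homogeneous `a` that kills `M` makes `a ⊗ 1` kill `M ⊗ N`, so it lies in `I`; this provides
    -- the annihilator condition.
    obtain ⟨e, m, hm, hmI⟩ := exists_homogeneous_annihilator_le hM.graded hI1 hprI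
      fun d a ha h => hannI d a ha (tmul_one_smul_eq_zero h)
    obtain ⟨e', n, hn, hnJ⟩ := exists_homogeneous_annihilator_le hN.graded hJ1 hprJ
      fun d b hb h => hannJ d b hb (one_tmul_smul_eq_zero h)
    exact isLocalDenom_of_ray hM hN hV hB hB' hp hc hpc hI hI1 hJ hJ1 hm hmI hn hnJ
      (fun d a ha haI => hray d (hrI d a ha haI)) (fun d b hb hbJ => hray d (hrJ d b hb hbJ))
      hle h₁ h₂ hIP hJP
  -- If `p` divides no `1 - t^d` with `d ≠ 0`, all irrelevant generators lie in `I` or `J` and kill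
  -- the subquotient, whose series is then a polynomial.
  · push Not at hd
    refine ⟨1, hp.not_dvd_one, ?_⟩
    rw [one_mul]
    refine Subring.mul_mem _ (coe_mem_polys _) ?_
    have h3 := hV.irrelevant.prod_mul_hser_mem hV.graded hV.finite hV.lower ∅ hle h₁ h₂ ?_
    · rwa [Finset.prod_empty, MvPolynomial.coe_one, one_mul] at h3
    · rintro (i | j) - q hq
      · refine hIP _ ?_ q hq
        by_contra hi
        exact hd _ (hM.irrelevant.ne_zero i) (hrI _ _ (hM.irrelevant.mem i) hi)
      · refine hJP _ ?_ q hq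
        by_contra hj
        exact hd _ (hN.irrelevant.ne_zero j) (hrJ _ _ (hN.irrelevant.mem j) hj)

/-- Universal denominators are multiplicative for tensor products. -/
theorem IsUDenom.tensor [GradedAlgebra 𝓡] [GradedAlgebra 𝓢]
    [IsNoetherianRing R] [IsNoetherianRing S] [IsNoetherian R M] [IsNoetherian S N]
    [IsNoetherian (R ⊗[K] S) (M ⊗[K] N)] [Finite ι] [Finite ι'] [Nontrivial M] [Nontrivial N]
    (hM : IsFiniteGraded 𝓡 𝓜 s x δ) (hN : IsFiniteGraded 𝓢 𝓝 s' y δ')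
    (hV : IsFiniteGraded (tensorGrading 𝓡 𝓢) (tensorGrading 𝓜 𝓝) (s + s')
      (Sum.elim (fun i => x i ⊗ₜ[K] (1 : S)) fun j => (1 : R) ⊗ₜ[K] y j) (Sum.elim δ δ'))
    {B B' : MvPolynomial (Fin r) ℚ} (hB : IsUDenom R 𝓜 B) (hB' : IsUDenom S 𝓝 B') :
    IsUDenom (R ⊗[K] S) (tensorGrading 𝓜 𝓝) (B * B') := by
  obtain ⟨hB1, hBP⟩ := (isCommonDenom_iff hM.lower B).1 hB.1
  obtain ⟨hB'1, hBP'⟩ := (isCommonDenom_iff hN.lower B').1 hB'.1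
  have h1 : MvPolynomial.constantCoeff (B * B') = 1 := by rw [map_mul, hB1, hB'1, mul_one]
  refine ⟨(isCommonDenom_iff hV.lower _).2 ⟨h1, fun P hP => ?_⟩, fun C hC => ?_⟩
  · obtain ⟨D, hD1, hD⟩ := hV.exists_common
    have hbot := IsGradedSubmodule.bot (R := R ⊗[K] S) hV.graded.isInternal
    have hDP := hD ⊥ P bot_le hbot hP
    rw [hser_bot, sub_zero] at hDP
    refine mem_polys_of_isLocalDenom (ne_zero_of_constantCoeff hD1) hDP fun p hp => ?_
    have h2 := isLocalDenom_tensor hM hN hV hBP hBP' hp bot_le hbot hP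
    rwa [hser_bot, sub_zero] at h2
  · obtain ⟨-, hCP⟩ := (isCommonDenom_iff hV.lower C).1 hC
    -- Cancellation is done twice, for the numerators over `M` and then over `N`, both times with `B
    -- B'` as the divisor. What remains is `B B' ∣ C a b`, witnessed by `C H(P ⊗ Q)`.
    refine hM.dvd_of_forall_dvd_mul hB h1 fun P hP a ha => ?_
    refine hN.dvd_of_forall_dvd_mul hB' h1 fun Q hQ b hb => ?_
    obtain ⟨q, hq⟩ := mem_polys_iff.1
      (hCP _ (IsGradedSubmodule.tensorSub hM.graded.isInternal hN.graded.isInternal hP hQ))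
    rw [hser_tensorSub hM.graded.isInternal hN.graded.isInternal hM.finite hN.finite hM.lower
      hN.lower hP hQ] at hq
    refine ⟨q, ?_⟩
    rw [← MvPolynomial.coe_inj]
    simp only [MvPolynomial.coe_mul]
    rw [← ha, ← hb, ← hq]
    ring

end TensorDenominator

/-! ### Finiteness -/

section Finiteness

variable {K R S M N : Type*} [Field K] [CommRing R] [Algebra K R] [CommRing S] [Algebra K S]
  [AddCommGroup M] [Module K M] [Module R M] [IsScalarTower K R M]
  [AddCommGroup N] [Module K N] [Module S N] [IsScalarTower K S N] {r : ℕ}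
  {𝓡 : (Fin r → ℕ) → Submodule K R} {𝓢 : (Fin r → ℕ) → Submodule K S}

/-- The ideal generated by all homogeneous elements of nonzero degree has finitely many generators
among them, and `R_0` supplies the finite-dimensional rest. -/
theorem exists_isIrrelevantSystem [IsNoetherianRing R] [Module.Finite K (𝓡 0)]
    (h𝓡 : iSup 𝓡 = ⊤) :
    ∃ (X : Finset R) (δ : X → Fin r → ℕ), IsIrrelevantSystem 𝓡 (fun a : X => (a : R)) δ := by
  let Y : Set R := {a | ∃ d, d ≠ 0 ∧ a ∈ 𝓡 d}
  obtain ⟨X, hXY, hX⟩ := (Submodule.fg_span_iff_fg_span_finset_subset (R := R) Y).1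
    (IsNoetherian.noetherian _)
  choose δ hδ0 hδ using fun a : X => hXY a.2
  refine ⟨X, δ, hδ, hδ0, 𝓡 0, Module.Finite.iff_fg.1 inferInstance, ?_⟩
  rw [eq_top_iff, ← h𝓡]
  refine iSup_le fun d => ?_
  by_cases hd : d = 0
  · rw [hd]
    exact le_sup_left
  · refine le_sup_of_le_right fun a ha => ?_
    have h1 : a ∈ Submodule.span R Y := Submodule.subset_span ⟨d, hd, ha⟩
    rw [hX] at h1
    rw [Submodule.restrictScalars_mem, Subtype.range_coe_subtype]
    exact h1

/-- If `F` and `G` complement the two irrelevant ideals, expanding `(f + a') ⊗ (g + b')` shows that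
`F ⊗ G` complements the ideal generated by both families. -/
theorem IsIrrelevantSystem.tensor [GradedAlgebra 𝓡] [GradedAlgebra 𝓢] {ι ι' : Type*}
    {x : ι → R} {δ : ι → Fin r → ℕ} {y : ι' → S} {δ' : ι' → Fin r → ℕ}
    (hx : IsIrrelevantSystem 𝓡 x δ) (hy : IsIrrelevantSystem 𝓢 y δ') :
    IsIrrelevantSystem (tensorGrading 𝓡 𝓢)
      (Sum.elim (fun i => x i ⊗ₜ[K] (1 : S)) fun j => (1 : R) ⊗ₜ[K] y j) (Sum.elim δ δ') where
  mem
    | .inl i => tmul_one_mem_tensorGrading (hx.mem i)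
    | .inr j => one_tmul_mem_tensorGrading (hy.mem j)
  ne_zero
    | .inl i => hx.ne_zero i
    | .inr j => hy.ne_zero j
  exists_fg := by
    obtain ⟨F, hF, hFtop⟩ := hx.exists_fg
    obtain ⟨G, hG, hGtop⟩ := hy.exists_fg
    have := Module.Finite.iff_fg.2 hF
    have := Module.Finite.iff_fg.2 hG
    refine ⟨LinearMap.range (TensorProduct.mapIncl F G), Module.Finite.iff_fg.1 inferInstance, ?_⟩
    set L : Ideal (R ⊗[K] S) := Ideal.span (Set.range
      (Sum.elim (fun i => x i ⊗ₜ[K] (1 : S)) fun j => (1 : R) ⊗ₜ[K] y j)) with hL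
    have hleft : ∀ a ∈ Ideal.span (Set.range x), ∀ b : S, a ⊗ₜ[K] b ∈ L := by
      intro a ha b
      have h1 : Ideal.span (Set.range x) ≤
          L.comap (Algebra.TensorProduct.includeLeftRingHom : R →+* R ⊗[K] S) := by
        rw [Ideal.span_le]
        rintro _ ⟨i, rfl⟩
        exact Ideal.subset_span ⟨Sum.inl i, rfl⟩
      have h2 := L.mul_mem_left ((1 : R) ⊗ₜ[K] b) (h1 ha)
      simpa using h2
    have hright : ∀ b ∈ Ideal.span (Set.range y), ∀ a : R, a ⊗ₜ[K] b ∈ L := by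
      intro b hb a
      have h1 : Ideal.span (Set.range y) ≤ L.comap
          (Algebra.TensorProduct.includeRight : S →ₐ[K] R ⊗[K] S).toRingHom := by
        rw [Ideal.span_le]
        rintro _ ⟨j, rfl⟩
        exact Ideal.subset_span ⟨Sum.inr j, rfl⟩
      have h2 := L.mul_mem_left (a ⊗ₜ[K] (1 : S)) (h1 hb)
      simpa using h2
    rw [eq_top_iff, ← TensorProduct.span_tmul_eq_top, Submodule.span_le]
    rintro _ ⟨a, b, rfl⟩
    obtain ⟨f, hf, a', ha', rfl⟩ := Submodule.mem_sup.1
      (show a ∈ F ⊔ (Ideal.span (Set.range x)).restrictScalars K from hFtop ▸ Submodule.mem_top)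
    obtain ⟨g, hg, b', hb', rfl⟩ := Submodule.mem_sup.1
      (show b ∈ G ⊔ (Ideal.span (Set.range y)).restrictScalars K from hGtop ▸ Submodule.mem_top)
    rw [TensorProduct.add_tmul, TensorProduct.tmul_add, add_assoc]
    exact Submodule.add_mem_sup (tmul_mem_range_mapIncl hf hg)
      (L.add_mem (hright b' hb' f) (hleft a' ha' (g + b')))

theorem isNoetherianRing_tensor [Algebra.FiniteType K R] [Algebra.FiniteType K S] :
    IsNoetherianRing (R ⊗[K] S) := by
  have := Algebra.FiniteType.isNoetherianRing K R
  exact Algebra.FiniteType.isNoetherianRing R (R ⊗[K] S)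

theorem finite_tensor [Module.Finite R M] [Module.Finite S N] :
    Module.Finite (R ⊗[K] S) (M ⊗[K] N) := by
  obtain ⟨X, hX⟩ := (Module.finite_def.1 ‹Module.Finite R M›)
  obtain ⟨Y, hY⟩ := (Module.finite_def.1 ‹Module.Finite S N›)
  classical
  refine ⟨⟨(X ×ˢ Y).image fun z => z.1 ⊗ₜ[K] z.2, ?_⟩⟩
  set L := Submodule.span (R ⊗[K] S)
    (((X ×ˢ Y).image fun z => z.1 ⊗ₜ[K] z.2 : Finset (M ⊗[K] N)) : Set (M ⊗[K] N))
  have h1 : ∀ m ∈ X, ∀ n : N, m ⊗ₜ[K] n ∈ L := by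
    intro m hm n
    have hn : n ∈ Submodule.span S (Y : Set N) := hY ▸ Submodule.mem_top
    induction hn using Submodule.span_induction with
    | mem n hn =>
      exact Submodule.subset_span (Finset.mem_coe.2 (Finset.mem_image.2
        ⟨(m, n), Finset.mem_product.2 ⟨hm, hn⟩, rfl⟩))
    | zero => rw [TensorProduct.tmul_zero]; exact L.zero_mem
    | add n n' _ _ h h' => rw [TensorProduct.tmul_add]; exact L.add_mem h h'
    | smul b n _ h =>
      have h2 := L.smul_mem ((1 : R) ⊗ₜ[K] b) h
      rwa [tmul_smul_tmul, one_smul] at h2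
  have h2 : ∀ (m : M) (n : N), m ⊗ₜ[K] n ∈ L := by
    intro m n
    have hm : m ∈ Submodule.span R (X : Set M) := hX ▸ Submodule.mem_top
    induction hm using Submodule.span_induction with
    | mem m hm => exact h1 m hm n
    | zero => rw [TensorProduct.zero_tmul]; exact L.zero_mem
    | add m m' _ _ h h' => rw [TensorProduct.add_tmul]; exact L.add_mem h h'
    | smul a m _ h =>
      have h2 := L.smul_mem (a ⊗ₜ[K] (1 : S)) h
      rwa [tmul_smul_tmul, one_smul] at h2
  refine eq_top_iff.2 fun v _ => ?_
  induction v with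
  | zero => exact L.zero_mem
  | add v w hv hw => exact L.add_mem (hv trivial) (hw trivial)
  | tmul m n => exact h2 m n

end Finiteness

end UDenom

end

open UDenom TensorProduct in
theorem mainTheorem10 {K R S M N : Type*} [Field K] {r : ℕ}
    [CommRing R] [Algebra K R] (𝓡 : (Fin r → ℕ) → Submodule K R) [GradedAlgebra 𝓡]
    [Algebra.FiniteType K R] [Module.Finite K (𝓡 0)]
    [CommRing S] [Algebra K S] (𝓢 : (Fin r → ℕ) → Submodule K S) [GradedAlgebra 𝓢]
    [Algebra.FiniteType K S] [Module.Finite K (𝓢 0)]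
    [AddCommGroup M] [Module K M] [Module R M] [IsScalarTower K R M] [Module.Finite R M]
    [Nontrivial M] (𝓜 : (Fin r → ℤ) → Submodule K M) (h𝓜 : IsGradedModule 𝓡 𝓜)
    [AddCommGroup N] [Module K N] [Module S N] [IsScalarTower K S N] [Module.Finite S N]
    [Nontrivial N] (𝓝 : (Fin r → ℤ) → Submodule K N) (h𝓝 : IsGradedModule 𝓢 𝓝) :
    IsUDenom R 𝓜 (udenom R 𝓜) ∧ IsUDenom S 𝓝 (udenom S 𝓝) ∧
      IsUDenom (R ⊗[K] S) (tensorGrading 𝓜 𝓝) (udenom (R ⊗[K] S) (tensorGrading 𝓜 𝓝)) ∧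
      udenom (R ⊗[K] S) (tensorGrading 𝓜 𝓝) = udenom R 𝓜 * udenom S 𝓝 := by
  have := Algebra.FiniteType.isNoetherianRing K R
  have := Algebra.FiniteType.isNoetherianRing K S
  have : IsNoetherianRing (R ⊗[K] S) := isNoetherianRing_tensor
  have : Module.Finite (R ⊗[K] S) (M ⊗[K] N) := finite_tensor
  have : IsNoetherian R M := isNoetherian_of_isNoetherianRing_of_finite R M
  have : IsNoetherian S N := isNoetherian_of_isNoetherianRing_of_finite S N
  have : IsNoetherian (R ⊗[K] S) (M ⊗[K] N) := isNoetherian_of_isNoetherianRing_of_finite _ _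
  have hR := DirectSum.Decomposition.isInternal 𝓡
  have hS := DirectSum.Decomposition.isInternal 𝓢
  obtain ⟨X, δ, hx⟩ := exists_isIrrelevantSystem hR.submodule_iSup_eq_top
  obtain ⟨Y, δ', hy⟩ := exists_isIrrelevantSystem hS.submodule_iSup_eq_top
  obtain ⟨s, hM⟩ := hx.exists_isFiniteGraded h𝓜 hR.submodule_iSup_eq_top
  obtain ⟨s', hN⟩ := hy.exists_isFiniteGraded h𝓝 hS.submodule_iSup_eq_top
  have hlow := le_of_tensorGrading_ne_bot hM.lower hN.lower
  -- Finite dimensionality of the components of `M ⊗ N` comes from its own irrelevant system and the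
  -- lower bound `s + s'` on its degrees.
  have hV : IsFiniteGraded (tensorGrading 𝓡 𝓢) (tensorGrading 𝓜 𝓝) (s + s') _ _ :=
    ⟨h𝓜.tensor h𝓝, (tensorGrading_isInternal hR hS).submodule_iSup_eq_top, hx.tensor hy,
      (hx.tensor hy).finite (h𝓜.tensor h𝓝) hlow, hlow⟩
  obtain ⟨B, hB⟩ := hM.exists_isUDenom
  obtain ⟨B', hB'⟩ := hN.exists_isUDenom
  have hBB' := hB.tensor hM hN hV hB'
  rw [hB.udenom_eq, hB'.udenom_eq, hBB'.udenom_eq]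
  exact ⟨hB, hB', hBB', rfl⟩
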